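/- Let $d,q\ge 1$ and $\Omega=\{1,\dots,q\}^{\mathbb Z^d}$ with the product topology and Borel $\sigma$-algebra. For $\Lambda\Subset\mathbb Z^d$ (finite subset), $\omega_\Lambda$ also denotes the event that a configuration agrees with $\omega$ on $\Lambda$. **Dynamics.** Let $c_\Delta(\eta,\xi_\Delta)\ge 0$ ($\Delta\Subset\mathbb Z^d$, $\xi_\Delta\in\{1,\dots,q\}^\Delta$) be translation-invariant rates, continuous in $\eta\in\Omega$, and put $c_\Delta(\eta)=\sum_{\xi_\Delta}c_\Delta(\eta,\xi_\Delta)$, $c_\Delta=\sup_\eta c_\Delta(\eta)$. Assume that the interacting particle system with $Lf(\eta)=\sum_{\Delta}\sum_{\xi_\Delta}c_\Delta(\eta,\xi_\Delta)[f(\xi_\Delta\eta_{\Delta^c})-f(\eta)]$ is well-defined in the sense of Liggett: $\sup_x\sum_{\Delta\ni x}c_\Delta<\infty$ and $\sup_x\sum_{u\ne x}\sum_{\Delta\ni x}c_\Delta(u)<\infty$, where $c_\Delta(u)=\sup\{\sum_{\xi_\Delta}|c_\Delta(\eta,\xi_\Delta)-c_\Delta(\eta',\xi_\Delta)|:\eta=\eta'\text{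 off }u\}$. Let $(P^L_t)_{t\ge0}$ be its Markov semigroup on $C(\Omega)$, whose generator is the closure of $L$ on functions of finitely many coordinates. Assume moreover: 1. (finitely many types of transitions) there is a finite $\Gamma\ni 0$ with $c_\Delta=0$ whenever $0\in\Delta\not\subset\Gamma$; 2. (uniform continuity) $\lim_{\Lambda\uparrow\mathbb Z^d}\sup_{\Delta\ni0}\sup_{\eta,\xi,\sigma}|c_\Delta(\eta_\Lambda\xi_{\Lambda^c},\sigma_\Delta)-c_\Delta(\eta,\sigma_\Delta)|=0$; 3. (no trap states) $c_\Delta(\eta,\sigma_\Delta)>0$ implies $c_\Delta(\sigma_\Delta\eta_{\Delta^c})>0$; 4. (minimal transition rate) for every $\Delta$ with $c_\Delta>0$, $\inf\{c_\Delta(\eta,\sigma_\Delta):c_\Delta(\eta,\sigma_\Delta)>0\}>0$. **Stationary Gibbs measure.** Let $\gamma=(\gamma_\Lambda)_{\Lambda\Subset\mathbb Z^d}$ be a specification (a consistent family of proper probability kernels) which is translation-invariant, non-null ($\inf_\eta\gamma_{\{0\}}(\eta_0|\eta_{0^c})>0$) and quasilocal ($\sup_{\eta,\xi}|\gamma_\Lambda(\eta_\Lambda|\eta_{\Delta\setminus\Lambda}\xi_{\Delta^c})-\gamma_\Lambda(\eta_\Lambda|\eta_{\Lambda^c})|\to0$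 as $\Delta\uparrow\mathbb Z^d$ for each $\Lambda$). Let $\mathcal G(\gamma)$ be the set of its Gibbs measures, i.e. the probability measures $\mu$ with $\mu\gamma_\Lambda=\mu$ for all $\Lambda$. Let $\mu\in\mathcal G(\gamma)$ be translation-invariant, time-stationary ($P^L_t\mu=\mu$ for all $t$) and asymptotically decoupled: there are $a:\mathbb N\to\mathbb N$ and $b:\mathbb N\to[0,\infty)$ with $a(n)/n\to0$ and $b(n)/(2n+1)^d\to0$ such that $e^{-b(n)}\mu(A)\mu(B)\le\mu(A\cap B)\le e^{b(n)}\mu(A)\mu(B)$ for all $i\in\mathbb Z^d$, $n\in\mathbb N$, all events $A$ depending only on the sites in $[-n,n]^d+i$ and all events $B$ depending only on the sites outside $[-n-a(n),n+a(n)]^d+i$. **Approximated zero entropy loss condition.** Let $\Lambda_n=[-2^n+1,2^n-1]^d$ and $\tilde\Lambda_n=[-2^n+n+1,2^n-n-1]^d$. For a translation-invariant probability measure $\nu$ on $\Omega$ put, in $[-\infty,\infty)$ (with $\log0=-\infty$, $0\cdot(-\infty)=0$), $$\tilde g^n_L(\nu)=\frac1{|\Lambda_n|}\sum_{i\in\tilde\Lambda_n}\sum_{\Delta\ni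 i}\sum_{\sigma_\Delta}\frac1{|\Delta|}\int\nu(d\eta)\,c_\Delta(\eta,\sigma_\Delta)\log\frac{\nu(\sigma_{\Delta\cap\Lambda_n}|\eta_{\Lambda_n\setminus\Delta})}{\nu(\eta_{\Delta\cap\Lambda_n}|\eta_{\Lambda_n\setminus\Delta})},$$ $\tilde g_L(\nu)=\lim_n\tilde g_L^n(\nu)$, $\rho_L(\nu,\mu)=-\lim_{\Lambda\uparrow\mathbb Z^d}\frac1{|\Lambda|}\sum_{\omega_\Lambda}\nu(L1_{\omega_\Lambda})\log\mu(\omega_\Lambda)$ (along the cubes $\Lambda=[-n,n]^d$), and $\tilde g_L(\nu|\mu)=\tilde g_L(\nu)+\rho_L(\nu,\mu)$. Assume that for every translation-invariant probability measure $\nu$ the quantity $\tilde g_L(\nu|\mu)$ exists in $[-\infty,\infty)$ and is $\le0$, and that $\tilde g_L(\nu|\mu)=0$ implies $\nu\in\mathcal G(\gamma)$. **Conclusion.** For every translation-invariant probability measure $\nu$ on $\Omega$ and every sequence $t_n\to\infty$ in $[0,\infty)$ such that $P^L_{t_n}\nu$ converges weakly to a probability measure $\nu_*$, one has $\nu_*\in\mathcal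 G(\gamma)$. -/

import Mathlib

open MeasureTheory ProbabilityTheory Filter Topology
open scoped NNReal ENNReal

/-- The sites of the lattice `ℤ^d`. -/
abbrev Site (d : ℕ) : Type := Fin d → ℤ

/-- Configurations on `ℤ^d` with `q` local states. The product topology and the product
(= Borel) sigma-algebra are the instances of Mathlib for function types. -/
abbrev Config (d q : ℕ) : Type := Site d → Fin q

noncomputable section

namespace IPS

variable {d q : ℕ}

/-- The lattice shift of configurations by `i`. -/
def shift (i : Site d) (η : Config d q) : Config d q := fun x => η (x - i)

/-- The translate `Λ + i`. -/
def translate (i : Site d) (Λ : Finset (Site d)) : Finset (Site d) := Λ.image (fun x => x + i)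

/-- The centered cube `[-n, n]^d`. -/
def box (d : ℕ) (n : ℤ) : Finset (Site d) := Finset.Icc (fun _ => -n) (fun _ => n)

/-- The cylinder event `ω_Λ`: the configurations that agree with `ω` on `Λ`. -/
def cyl (Λ : Finset (Site d)) (ω : Λ → Fin q) : Set (Config d q) :=
  {η | Λ.restrict η = ω}

/-- Translation invariance of a probability measure on configurations. -/
def IsTranslationInvariant (ν : ProbabilityMeasure (Config d q)) : Prop :=
  ∀ i : Site d, (ν : Measure (Config d q)).map (shift i) = ν

/-! ### Specifications and Gibbs measures -/

/-- A specification: a consistent family of proper probability kernels `γ_Λ(· | η_{Λᶜ})`,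
where `γ_Λ` is measurable with respect to the coordinates outside of `Λ`. -/
structure Specification (d q : ℕ) where
  kernel : (Λ : Finset (Site d)) →
    Kernel[cylinderEvents ((Λ : Set (Site d))ᶜ), MeasurableSpace.pi] (Config d q) (Config d q)
  isMarkov : ∀ Λ η, IsProbabilityMeasure (kernel Λ η)
  proper : ∀ Λ, (kernel Λ).IsProper
  consistent : ∀ Δ Λ, Δ ⊆ Λ → ∀ η, (kernel Λ η).bind (kernel Δ) = kernel Λ η

namespace Specification

/-- The number `γ_Λ(σ_Λ | η_{Λᶜ})`. -/
def prob (γ : Specification d q) (Λ : Finset (Site d)) (σ : Λ → Fin q) (η : Config d q) : ℝ :=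
  (γ.kernel Λ η).real (cyl Λ σ)

/-- `γ_{Λ+i}(· | shifted η)` is the shift of `γ_Λ(· | η)`. -/
def IsTranslationInvariant (γ : Specification d q) : Prop :=
  ∀ (Λ : Finset (Site d)) (i : Site d) (η : Config d q),
    γ.kernel (translate i Λ) (shift i η) = (γ.kernel Λ η).map (shift i)

/-- `inf_η γ_0(η_0 | η_{0ᶜ}) ≥ δ` for some `δ > 0`. -/
def IsNonNull (γ : Specification d q) : Prop :=
  ∃ δ : ℝ, 0 < δ ∧ ∀ η : Config d q, δ ≤ γ.prob {0} (Finset.restrict {0} η) η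

/-- `sup_{η,ξ} |γ_Λ(η_Λ | η_{Δ∖Λ} ξ_{Δᶜ}) - γ_Λ(η_Λ | η_{Λᶜ})| → 0` as `Δ ↑ ℤ^d`. -/
def IsQuasilocal (γ : Specification d q) : Prop :=
  ∀ Λ : Finset (Site d), ∀ ε : ℝ, 0 < ε → ∃ Δ₀ : Finset (Site d), ∀ Δ, Δ₀ ⊆ Δ →
    ∀ η ξ : Config d q,
      |γ.prob Λ (Λ.restrict η) (Function.updateFinset ξ Δ (Δ.restrict η))
        - γ.prob Λ (Λ.restrict η) η| ≤ ε

/-- `μ ∈ 𝒢(γ)`: the DLR equations `μ γ_Λ = μ` for all finite `Λ`. -/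
def IsGibbs (γ : Specification d q) (μ : ProbabilityMeasure (Config d q)) : Prop :=
  ∀ Λ : Finset (Site d), (μ : Measure (Config d q)).bind (γ.kernel Λ) = μ

end Specification

/-- Asymptotic decoupledness of a measure. -/
def IsAsymptoticallyDecoupled (μ : ProbabilityMeasure (Config d q)) : Prop :=
  ∃ (a : ℕ → ℕ) (b : ℕ → ℝ), (∀ n, 0 ≤ b n) ∧
    Tendsto (fun n => (a n : ℝ) / n) atTop (𝓝 0) ∧
    Tendsto (fun n : ℕ => b n / ((box d n).card : ℝ)) atTop (𝓝 0) ∧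
    ∀ (i : Site d) (n : ℕ) (A B : Set (Config d q)),
      MeasurableSet[cylinderEvents (translate i (box d n) : Set (Site d))] A →
      MeasurableSet[cylinderEvents ((translate i (box d (n + a n)) : Set (Site d))ᶜ)] B →
      Real.exp (-b n) * ((μ : Measure (Config d q)).real A * (μ : Measure (Config d q)).real B)
          ≤ (μ : Measure (Config d q)).real (A ∩ B) ∧
        (μ : Measure (Config d q)).real (A ∩ B)
          ≤ Real.exp (b n) *
            ((μ : Measure (Config d q)).real A * (μ : Measure (Config d q)).real B)

/-! ### Jump rates -/

/-- Jump rates `c_Δ(η, ξ_Δ)`, continuous in the starting configuration `η`. -/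
structure JumpRates (d q : ℕ) where
  rate : (Δ : Finset (Site d)) → Config d q → (Δ → Fin q) → ℝ
  nonneg : ∀ Δ η ξ, 0 ≤ rate Δ η ξ
  continuous : ∀ Δ ξ, Continuous fun η => rate Δ η ξ

namespace JumpRates

/-- `c_Δ(η) = ∑_ξ c_Δ(η, ξ_Δ)`. -/
def total (c : JumpRates d q) (Δ : Finset (Site d)) (η : Config d q) : ℝ := ∑ ξ, c.rate Δ η ξ

/-- `c_Δ = sup_η c_Δ(η)`. -/
def sup (c : JumpRates d q) (Δ : Finset (Site d)) : ℝ≥0∞ := ⨆ η, ENNReal.ofReal (c.total Δ η)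

/-- `c_Δ(u)`: the largest total variation distance of `c_Δ(η, ·)` and `c_Δ(η', ·)` for `η`, `η'`
which agree off the site `u`. -/
def influence (c : JumpRates d q) (Δ : Finset (Site d)) (u : Site d) : ℝ≥0∞ :=
  ⨆ (η : Config d q) (η' : Config d q) (_ : ∀ x, x ≠ u → η x = η' x),
    ENNReal.ofReal (∑ ξ, |c.rate Δ η ξ - c.rate Δ η' ξ|)

/-- Liggett's conditions for the well-definedness of an interacting particle system:
`sup_x ∑_{Δ ∋ x} c_Δ < ∞` and `sup_x ∑_{u ≠ x} ∑_{Δ ∋ x} c_Δ(u) < ∞`. -/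
structure IsWellDefined (c : JumpRates d q) : Prop where
  sup_sum_lt_top : (⨆ x : Site d, ∑' Δ : {Δ : Finset (Site d) // x ∈ Δ}, c.sup Δ) < ⊤
  sup_influence_lt_top :
    (⨆ x : Site d, ∑' u : {u : Site d // u ≠ x},
      ∑' Δ : {Δ : Finset (Site d) // x ∈ Δ}, c.influence Δ u) < ⊤

/-- The rates are invariant under lattice translations. -/
def IsTranslationInvariant (c : JumpRates d q) : Prop :=
  ∀ (i : Site d) (Δ : Finset (Site d)) (η σ : Config d q),
    c.rate (translate i Δ) (shift i η) ((translate i Δ).restrict (shift i σ))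
      = c.rate Δ η (Δ.restrict σ)

/-- There are only finitely many types of transitions. -/
def HasFinitelyManyTransitions (c : JumpRates d q) : Prop :=
  ∃ Γ : Finset (Site d), 0 ∈ Γ ∧ ∀ Δ, 0 ∈ Δ → ¬ Δ ⊆ Γ → ∀ η ξ, c.rate Δ η ξ = 0

/-- `sup_{Δ ∋ 0} sup_{η,ξ,σ} |c_Δ(η_Λ ξ_{Λᶜ}, σ_Δ) - c_Δ(η, σ_Δ)| → 0` as `Λ ↑ ℤ^d`. -/
def IsUniformlyContinuous (c : JumpRates d q) : Prop :=
  ∀ ε : ℝ, 0 < ε → ∃ Λ₀ : Finset (Site d), ∀ Λ, Λ₀ ⊆ Λ →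
    ∀ Δ : Finset (Site d), 0 ∈ Δ → ∀ (η ξ : Config d q) (σ : Δ → Fin q),
      |c.rate Δ (Function.updateFinset ξ Λ (Λ.restrict η)) σ - c.rate Δ η σ| ≤ ε

/-- The dynamics can not enter trap states: after a possible transition in `Δ`, the total rate of
transitions in `Δ` is positive. -/
def HasNoTraps (c : JumpRates d q) : Prop :=
  ∀ (Δ : Finset (Site d)) (η : Config d q) (σ : Δ → Fin q),
    0 < c.rate Δ η σ → 0 < c.total Δ (Function.updateFinset η Δ σ)

/-- There is a minimal transition rate: for each `Δ`, the positive rates in `Δ` are bounded away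
from `0`. -/
def HasMinimalRate (c : JumpRates d q) : Prop :=
  ∀ Δ : Finset (Site d), ∃ δ : ℝ, 0 < δ ∧
    ∀ (η : Config d q) (σ : Δ → Fin q), 0 < c.rate Δ η σ → δ ≤ c.rate Δ η σ

/-- The formal generator
`L f(η) = ∑_Δ ∑_ξ c_Δ(η, ξ_Δ) (f(ξ_Δ η_{Δᶜ}) - f(η))`, used for functions `f` of finitely many
coordinates; for well-defined rates the sum over `Δ` is then absolutely convergent. -/
def gen (c : JumpRates d q) (f : Config d q → ℝ) (η : Config d q) : ℝ :=
  ∑' Δ : Finset (Site d), ∑ ξ : Δ → Fin q,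
    c.rate Δ η ξ * (f (Function.updateFinset η Δ ξ) - f η)

/-- The graph of `L` on the continuous functions of finitely many coordinates. -/
def genGraph (c : JumpRates d q) : Set (C(Config d q, ℝ) × C(Config d q, ℝ)) :=
  {p | (∃ Λ : Finset (Site d), DependsOn (p.1 : Config d q → ℝ) (Λ : Set (Site d))) ∧
    ∀ η, p.2 η = c.gen p.1 η}

end JumpRates

/-! ### Markov semigroups -/

/-- A Markov (Feller) semigroup on the configuration space, given by its transition kernels. -/
structure FellerSemigroup (d q : ℕ) where
  kernel : ℝ≥0 → Kernel (Config d q) (Config d q)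
  isMarkov : ∀ t, IsMarkovKernel (kernel t)
  zero : kernel 0 = Kernel.id
  add : ∀ s t, kernel (s + t) = kernel t ∘ₖ kernel s
  feller : ∀ t (f : C(Config d q, ℝ)), Continuous fun η => ∫ ω, f ω ∂(kernel t η)
  right_continuous : ∀ f : C(Config d q, ℝ),
    Tendsto (fun t => (⟨fun η => ∫ ω, f ω ∂(kernel t η), feller t f⟩ : C(Config d q, ℝ)))
      (𝓝[>] 0) (𝓝 f)

namespace FellerSemigroup

/-- The action `P_t f` on continuous functions. -/
def op (P : FellerSemigroup d q) (t : ℝ≥0) (f : C(Config d q, ℝ)) : C(Config d q, ℝ) :=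
  ⟨fun η => ∫ ω, f ω ∂(P.kernel t η), P.feller t f⟩

/-- The action `P_t ν` on probability measures. -/
def evolve (P : FellerSemigroup d q) (t : ℝ≥0) (ν : ProbabilityMeasure (Config d q)) :
    ProbabilityMeasure (Config d q) :=
  haveI := P.isMarkov t
  ⟨(ν : Measure (Config d q)).bind (P.kernel t), inferInstance⟩

/-- The graph of the infinitesimal generator: `g = lim_{t ↓ 0} (P_t f - f) / t` in supremum
norm. -/
def generatorGraph (P : FellerSemigroup d q) :
    Set (C(Config d q, ℝ) × C(Config d q, ℝ)) :=
  {p | Tendsto (fun t : ℝ≥0 => ((t : ℝ)⁻¹) • (P.op t p.1 - p.1)) (𝓝[>] 0) (𝓝 p.2)}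

/-- `P` is the semigroup `(P_t^L)` of the particle system with rates `c`: its generator is the
closure of `L` on the functions of finitely many coordinates. -/
def IsSemigroupOf (P : FellerSemigroup d q) (c : JumpRates d q) : Prop :=
  P.generatorGraph = closure c.genGraph

/-- `μ` is time-stationary. -/
def IsStationary (P : FellerSemigroup d q) (μ : ProbabilityMeasure (Config d q)) : Prop :=
  ∀ t, P.evolve t μ = μ

end FellerSemigroup

/-! ### The approximated relative entropy loss -/

/-- The integral `∫ f⁺ dν - ∫ f⁻ dν` of a function with values in `[-∞, ∞]`. -/
def eintegral (ν : Measure (Config d q)) (f : Config d q → EReal) : EReal :=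
  ((∫⁻ η, (f η).toENNReal ∂ν : ℝ≥0∞) : EReal) - ((∫⁻ η, (-f η).toENNReal ∂ν : ℝ≥0∞) : EReal)

/-- `log (ν(σ_{Δ∩Λ} | η_{Λ∖Δ}) / ν(η_{Δ∩Λ} | η_{Λ∖Δ}))`, with `log 0 = -∞`. -/
def logRatio (ν : Measure (Config d q)) (Λ Δ : Finset (Site d)) (σ : Δ → Fin q)
    (η : Config d q) : EReal :=
  ENNReal.log
    (ν[|cyl (Λ \ Δ) ((Λ \ Δ).restrict η)]
        (cyl (Δ ∩ Λ) ((Δ ∩ Λ).restrict (Function.updateFinset η Δ σ))) /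
      ν[|cyl (Λ \ Δ) ((Λ \ Δ).restrict η)] (cyl (Δ ∩ Λ) ((Δ ∩ Λ).restrict η)))

/-- The cube `Λ_n = [-2^n + 1, 2^n - 1]^d`. -/
def bigBox (d n : ℕ) : Finset (Site d) := box d (2 ^ n - 1)

/-- The cube `[-2^n + n + 1, 2^n - n - 1]^d`. -/
def innerBox (d n : ℕ) : Finset (Site d) := box d (2 ^ n - n - 1)

/-- The finite-volume approximated entropy loss
`|Λ_n|⁻¹ ∑_{i ∈ innerBox} ∑_{Δ ∋ i} ∑_σ |Δ|⁻¹
  ∫ ν(dη) c_Δ(η, σ_Δ) log (ν(σ_{Δ∩Λ_n} | η_{Λ_n∖Δ}) / ν(η_{Δ∩Λ_n} | η_{Λ_n∖Δ}))`,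
an extended real number; where `c_Δ(η, σ_Δ) = 0` the integrand is `0`. -/
def approxEntropyLoss (c : JumpRates d q) (ν : Measure (Config d q)) (n : ℕ) : EReal :=
  ((((bigBox d n).card : ℝ)⁻¹ : ℝ) : EReal) *
    ∑ i ∈ innerBox d n, ∑' Δ : {Δ : Finset (Site d) // i ∈ Δ}, ∑ σ : Δ.1 → Fin q,
      (((Δ.1.card : ℝ)⁻¹ : ℝ) : EReal) *
        eintegral ν (fun η => (c.rate Δ.1 η σ : EReal) * logRatio ν (bigBox d n) Δ.1 σ η)

/-- The finite-volume energy loss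
`-|Λ|⁻¹ ∑_{ω_Λ} ν(L 1_{ω_Λ}) log μ(ω_Λ)` in the cube `Λ = [-n, n]^d`. -/
def energyLoss (c : JumpRates d q) (ν μ : Measure (Config d q)) (n : ℕ) : ℝ :=
  -(((box d n).card : ℝ)⁻¹ * ∑ ω : box d n → Fin q,
    (∫ η, c.gen ((cyl (box d n) ω).indicator 1) η ∂ν) * Real.log (μ.real (cyl (box d n) ω)))

/-- The approximated relative entropy loss `g̃_L(ν|μ) = g̃_L(ν) + ρ_L(ν,μ)` exists and has the
value `x`: here `g̃_L(ν) ∈ [-∞, ∞]` is the limit of the approximated entropy losses and the real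
number `ρ_L(ν,μ)` is the limit of the energy losses. -/
def HasApproxRelEntropyLoss (c : JumpRates d q) (ν μ : ProbabilityMeasure (Config d q))
    (x : EReal) : Prop :=
  ∃ (g : EReal) (r : ℝ), Tendsto (approxEntropyLoss c ν) atTop (𝓝 g) ∧
    Tendsto (energyLoss c ν μ) atTop (𝓝 r) ∧ x = g + r

/-- The approximated zero entropy loss condition for the dynamics with rates `c` and semigroup
`P`, the specification `γ` and the measure `μ`. -/
structure ApproxZeroEntropyLoss (c : JumpRates d q) (P : FellerSemigroup d q)
    (γ : Specification d q) (μ : ProbabilityMeasure (Config d q)) : Prop where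
  spec_translationInvariant : γ.IsTranslationInvariant
  spec_nonNull : γ.IsNonNull
  spec_quasilocal : γ.IsQuasilocal
  gibbs : γ.IsGibbs μ
  translationInvariant : IsTranslationInvariant μ
  asymptoticallyDecoupled : IsAsymptoticallyDecoupled μ
  stationary : P.IsStationary μ
  entropyLoss : ∀ ν : ProbabilityMeasure (Config d q), IsTranslationInvariant ν →
    ∃ x : EReal, HasApproxRelEntropyLoss c ν μ x ∧ x ≤ 0 ∧ (x = 0 → γ.IsGibbs ν)

end IPS

end

/-!
The relative entropy with respect to the stationary Gibbs measure `μ`, per site, is a Lyapunov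
function of the dynamics, and at a weak limit point of the dynamics its approximated rate of change
cannot be negative. So this rate is zero there, and the limit point is a Gibbs measure.

*Reduction to positive cylinder probabilities.* Non-nullness makes the `μ`-probabilities of all
cylinder events positive. Since `μ` is stationary, mixing an initial measure with `μ` commutes with
the dynamics, and since the DLR equations are affine it is enough to treat the mixture
(`Specification.IsGibbs.of_mix`). Therefore all logarithms below are real. The semigroup preserves
translation invariance, because shifts preserve its generator
(`FellerSemigroup.IsSemigroupOf.isTranslationInvariant_evolve`).

*Finite volume.* Let `H_N` be the relative entropy in the cube `[-N, N]^d` divided by its volume. It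
takes values in a fixed bounded interval, and along the dynamics it has the right derivative
`relLoss`, which splits into entropy and energy losses of single sites
(`hasDerivWithinAt_relEntropy_evolve`, `relLoss_eq`).

*Entropy.* The entropy loss of a site is an integral of rates against the logarithmic ratio of the
cylinder probabilities after and before a transition, which is the logarithmic density of one finite
measure with respect to another (`swapMeasure`). By Jensen's inequality it is bounded above, and for
rates that depend on finitely many coordinates it decreases with the volume
(`integral_mul_logProb_sub_anti`). Uniform continuity together with the minimal rate shows that the
actual rates are multiplicatively close to such local rates, so that this monotonicity holds up
to a small error. Averaging over the translates of a cube `Λ_m` that contain a given site well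
inside, one bounds the entropy loss of the site in any large volume by the approximated entropy
loss of order `m` (`exists_siteLoss_le_entropyLoss`).

*Energy.* As `μ` is a Gibbs measure of a quasilocal and non-null specification, the energy loss of a
site is bounded and up to a small error a function of the spins in a fixed cube
(`Specification.IsGibbs.exists_siteLoss_bounds`).

*Conclusion.* Hence, if the approximated relative entropy loss of a measure is less than `y`, the
derivatives of `H_N` at all measures are asymptotically dominated by a functional that is weakly
continuous at the given measure, where its value is less than `y` (`exists_continuousAt_bound`).
With `y ↓ 0` this shows that `H_N` asymptotically does not increase. If the loss at the limit point is negative, then by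
continuity `H_N` decreases by a fixed amount during time intervals of a fixed length after each
large `t_n`, which contradicts its boundedness (`not_decreasing_infinitely_often`).
-/

noncomputable section

namespace IPS

variable {d q : ℕ}

/-! ### Cylinder events, local functions and translations -/

theorem mem_cyl_restrict {Λ : Finset (Site d)} {η ζ : Config d q} :
    η ∈ cyl Λ (Λ.restrict ζ) ↔ ∀ x ∈ Λ, η x = ζ x := by
  simp only [cyl, Set.mem_ofPred_eq, funext_iff, Finset.restrict, Subtype.forall]

theorem self_mem_cyl (Λ : Finset (Site d)) (η : Config d q) : η ∈ cyl Λ (Λ.restrict η) := rfl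

theorem cyl_restrict_congr {Λ : Finset (Site d)} {η ζ : Config d q} (h : ∀ x ∈ Λ, η x = ζ x) :
    Λ.restrict η = Λ.restrict ζ :=
  mem_cyl_restrict.2 h

theorem isClopen_cyl (Λ : Finset (Site d)) (ω : Λ → Fin q) : IsClopen (cyl Λ ω) :=
  (isClopen_discrete {ω}).preimage (Finset.continuous_restrict Λ)

theorem measurableSet_cyl (Λ : Finset (Site d)) (ω : Λ → Fin q) : MeasurableSet (cyl Λ ω) :=
  (isClopen_cyl Λ ω).isOpen.measurableSet

theorem restrict_updateFinset' (η : Config d q) (Λ : Finset (Site d)) (ω : Λ → Fin q) :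
    Λ.restrict (Function.updateFinset η Λ ω) = ω :=
  Function.restrict_updateFinset η ω

theorem updateFinset_of_mem (η : Config d q) {Λ : Finset (Site d)} (ω : Λ → Fin q) {x : Site d}
    (hx : x ∈ Λ) : Function.updateFinset η Λ ω x = ω ⟨x, hx⟩ := by
  simp [Function.updateFinset, hx]

theorem updateFinset_of_notMem (η : Config d q) {Λ : Finset (Site d)} (ω : Λ → Fin q) {x : Site d}
    (hx : x ∉ Λ) : Function.updateFinset η Λ ω x = η x := by
  simp [Function.updateFinset, hx]

theorem continuous_of_dependsOn {α : Type*} [TopologicalSpace α] {f : Config d q → α}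
    {Λ : Finset (Site d)} (hf : DependsOn f (Λ : Set (Site d))) : Continuous f := by
  rcases isEmpty_or_nonempty (Config d q) with h | ⟨⟨η₀⟩⟩
  · exact continuous_of_discreteTopology
  · have : f = (fun ω => f (Function.updateFinset η₀ Λ ω)) ∘ Λ.restrict := by
      funext η
      refine hf fun x hx => ?_
      rw [updateFinset_of_mem _ _ hx]; rfl
    rw [this]
    exact continuous_of_discreteTopology.comp (Finset.continuous_restrict Λ)

theorem continuous_updateFinset (Δ : Finset (Site d)) (ξ : Δ → Fin q) :
    Continuous fun η : Config d q => Function.updateFinset η Δ ξ := by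
  refine continuous_pi fun x => ?_
  by_cases hx : x ∈ Δ
  · simpa only [updateFinset_of_mem _ _ hx] using continuous_const
  · simpa only [updateFinset_of_notMem _ _ hx] using continuous_apply x

theorem integrable_of_continuous (m : Measure (Config d q)) [IsFiniteMeasure m]
    {f : Config d q → ℝ} (hf : Continuous f) : Integrable f m :=
  hf.integrable_of_hasCompactSupport (HasCompactSupport.of_compactSpace f)

theorem exists_bound_of_continuous {f : Config d q → ℝ} (hf : Continuous f) :
    ∃ C, 0 ≤ C ∧ ∀ η, |f η| ≤ C := by
  obtain ⟨C, hC⟩ := isCompact_univ.exists_bound_of_continuousOn (hf.continuousOn (s := Set.univ))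
  exact ⟨max C 0, le_max_right _ _, fun η => (hC η trivial).trans (le_max_left _ _)⟩

/-- A function of the coordinates in `Λ` is a combination of indicators of cylinder events. -/
theorem eq_sum_indicator_cyl {f : Config d q → ℝ} {Λ : Finset (Site d)}
    (hf : DependsOn f (Λ : Set (Site d))) (η₀ : Config d q) :
    f = fun η => ∑ ω : Λ → Fin q,
      f (Function.updateFinset η₀ Λ ω) * (cyl Λ ω).indicator 1 η := by
  funext η
  rw [Finset.sum_eq_single (Λ.restrict η)]
  · rw [Set.indicator_of_mem (self_mem_cyl Λ η), Pi.one_apply, mul_one]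
    exact hf fun x hx => by rw [updateFinset_of_mem _ _ hx]; rfl
  · intro ω _ hω
    rw [Set.indicator_of_notMem, mul_zero]
    exact fun h => hω (Eq.symm h)
  · simp

theorem continuous_indicator_cyl (Λ : Finset (Site d)) (ω : Λ → Fin q) :
    Continuous ((cyl Λ ω).indicator (1 : Config d q → ℝ)) :=
  (isClopen_cyl Λ ω).continuous_indicator continuous_const

theorem dependsOn_indicator_cyl (Λ : Finset (Site d)) (ω : Λ → Fin q) :
    DependsOn ((cyl Λ ω).indicator (1 : Config d q → ℝ)) (Λ : Set (Site d)) := by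
  intro η ζ h
  have : η ∈ cyl Λ ω ↔ ζ ∈ cyl Λ ω := by
    simp only [cyl, Set.mem_ofPred_eq, cyl_restrict_congr (Λ := Λ) h]
  by_cases hη : η ∈ cyl Λ ω
  · rw [Set.indicator_of_mem hη, Set.indicator_of_mem (this.1 hη)]; rfl
  · rw [Set.indicator_of_notMem hη, Set.indicator_of_notMem (mt this.2 hη)]

theorem integral_eq_sum_cyl (m : Measure (Config d q)) [IsFiniteMeasure m] {f : Config d q → ℝ}
    {Λ : Finset (Site d)} (hf : DependsOn f (Λ : Set (Site d))) (η₀ : Config d q) :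
    ∫ η, f η ∂m = ∑ ω : Λ → Fin q, m.real (cyl Λ ω) * f (Function.updateFinset η₀ Λ ω) := by
  rw [integral_congr_ae (ae_of_all _ (congrFun (eq_sum_indicator_cyl hf η₀))),
    integral_finsetSum]
  · refine Finset.sum_congr rfl fun ω _ => ?_
    rw [integral_const_mul, integral_indicator_one (measurableSet_cyl Λ ω), mul_comm]
  · exact fun ω _ => (integrable_of_continuous m (continuous_indicator_cyl Λ ω)).const_mul _

/-- Finite measures that agree on all cylinder events are equal. -/
theorem measure_ext_cyl {m m' : Measure (Config d q)} [IsFiniteMeasure m]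
    (h : ∀ (Λ : Finset (Site d)) (ω : Λ → Fin q), m (cyl Λ ω) = m' (cyl Λ ω)) : m = m' := by
  have key : ∀ (Λ : Finset (Site d)), m.map Λ.restrict = m'.map Λ.restrict := by
    intro Λ
    refine Measure.ext_of_singleton fun ω => ?_
    rw [Measure.map_apply (by fun_prop) (measurableSet_singleton _),
      Measure.map_apply (by fun_prop) (measurableSet_singleton _)]
    exact h Λ ω
  refine ext_of_generate_finite _ (generateFrom_measurableCylinders (α := fun _ : Site d => Fin q)).symm
    isPiSystem_measurableCylinders (fun A hA => ?_) ?_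
  · obtain ⟨Λ, S, hS, rfl⟩ := (mem_measurableCylinders _).1 hA
    have := congrArg (fun κ => κ S) (key Λ)
    rw [Measure.map_apply (Finset.measurable_restrict Λ) hS,
      Measure.map_apply (Finset.measurable_restrict Λ) hS] at this
    exact this
  · have := congrArg (fun κ => κ Set.univ) (key ∅)
    simpa only [Measure.map_apply (Finset.measurable_restrict _) MeasurableSet.univ,
      Set.preimage_univ] using this

theorem shift_apply (i : Site d) (η : Config d q) (x : Site d) : shift i η x = η (x - i) := rfl

theorem continuous_shift (i : Site d) : Continuous (shift i : Config d q → Config d q) :=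
  continuous_pi fun x => continuous_apply (x - i)

theorem measurable_shift (i : Site d) : Measurable (shift i : Config d q → Config d q) :=
  (continuous_shift i).measurable



theorem shift_shift_neg (i : Site d) (η : Config d q) : shift i (shift (-i) η) = η := by
  funext x; simp [shift]



theorem mem_translate {i x : Site d} {Λ : Finset (Site d)} : x ∈ translate i Λ ↔ x - i ∈ Λ := by
  simp [translate, sub_eq_add_neg]

theorem translate_translate (i j : Site d) (Λ : Finset (Site d)) :
    translate j (translate i Λ) = translate (i + j) Λ := by
  ext x; simp [mem_translate, sub_sub, add_comm]

theorem translate_zero (Λ : Finset (Site d)) : translate 0 Λ = Λ := by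
  ext x; simp [mem_translate]

theorem translate_neg_translate (i : Site d) (Λ : Finset (Site d)) :
    translate (-i) (translate i Λ) = Λ := by
  rw [translate_translate, add_neg_cancel, translate_zero]

theorem translate_injective (i : Site d) : Function.Injective (translate (d := d) i) :=
  Function.LeftInverse.injective (translate_neg_translate i)

theorem card_translate (i : Site d) (Λ : Finset (Site d)) : (translate i Λ).card = Λ.card :=
  Finset.card_image_of_injective _ (add_left_injective i)

theorem shift_preimage_cyl (i : Site d) (Λ : Finset (Site d)) (η : Config d q) :
    shift i ⁻¹' cyl (translate i Λ) ((translate i Λ).restrict (shift i η))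
      = cyl Λ (Λ.restrict η) := by
  ext ζ
  rw [Set.mem_preimage, mem_cyl_restrict, mem_cyl_restrict]
  simp only [mem_translate, shift_apply]
  exact ⟨fun h x hx => by simpa using h (x + i) (by simpa using hx), fun h x hx => h _ hx⟩

/-- The bijection between local configurations in `Δ` and in its translate `Δ + i`. -/
def shiftLocal (i : Site d) (Δ : Finset (Site d)) : (Δ → Fin q) ≃ (translate i Δ → Fin q) where
  toFun ξ := fun y => ξ ⟨y - i, mem_translate.1 y.2⟩
  invFun ξ := fun y => ξ ⟨y + i, mem_translate.2 (by simp)⟩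
  left_inv ξ := by funext y; simp
  right_inv ξ := by funext y; simp

theorem shiftLocal_restrict (i : Site d) (Δ : Finset (Site d)) (σ : Config d q) :
    shiftLocal i Δ (Δ.restrict σ) = (translate i Δ).restrict (shift i σ) := rfl

theorem updateFinset_shift (i : Site d) (Δ : Finset (Site d)) (η : Config d q) (ξ : Δ → Fin q) :
    Function.updateFinset (shift i η) (translate i Δ) (shiftLocal i Δ ξ)
      = shift i (Function.updateFinset η Δ ξ) := by
  funext x
  by_cases hx : x - i ∈ Δ
  · rw [updateFinset_of_mem _ _ (mem_translate.2 hx), shift_apply, updateFinset_of_mem _ _ hx]; rfl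
  · rw [updateFinset_of_notMem _ _ (mt mem_translate.1 hx), shift_apply, shift_apply,
      updateFinset_of_notMem _ _ hx]

theorem dependsOn_comp_shift {α : Type*} {f : Config d q → α} {i : Site d} {Λ : Finset (Site d)}
    (hf : DependsOn f (translate i Λ : Set (Site d))) :
    DependsOn (fun η => f (shift i η)) (Λ : Set (Site d)) := by
  intro η ζ h
  refine hf fun x hx => h _ ?_
  exact_mod_cast mem_translate.1 (by exact_mod_cast hx)

theorem mem_box {n : ℤ} {x : Site d} : x ∈ box d n ↔ ∀ j, -n ≤ x j ∧ x j ≤ n := by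
  simp [box, Finset.mem_Icc, Pi.le_def, forall_and]

theorem box_mono {m n : ℤ} (h : m ≤ n) : box d m ⊆ box d n := fun x hx =>
  mem_box.2 fun j => by have := mem_box.1 hx j; constructor <;> linarith

theorem card_box {n : ℤ} (hn : 0 ≤ n) : ((box d n).card : ℝ) = (2 * (n : ℝ) + 1) ^ d := by
  have : (n + 1 - -n).toNat = ((2 * n + 1).toNat) := by congr 1; ring
  rw [box, Pi.card_Icc]
  simp only [Int.card_Icc, this, Finset.prod_const, Finset.card_univ, Fintype.card_fin]
  rw [Nat.cast_pow]
  congr 1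
  have h2 : (((2 * n + 1).toNat : ℤ) : ℝ) = ((2 * n + 1 : ℤ) : ℝ) := by
    rw [Int.toNat_of_nonneg (by linarith)]
  rw [Int.cast_natCast] at h2
  rw [h2]; push_cast; ring

theorem card_box_pos {n : ℤ} (hn : 0 ≤ n) : (0 : ℝ) < (box d n).card := by
  rw [card_box hn]; have : (0 : ℝ) ≤ n := by exact_mod_cast hn
  positivity

/-- Every finite set of sites lies in a centered cube. -/
theorem exists_subset_box (Λ : Finset (Site d)) : ∃ n : ℕ, Λ ⊆ box d n := by
  refine ⟨∑ x ∈ Λ, ∑ j, (x j).natAbs, fun x hx => mem_box.2 fun j => ?_⟩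
  have h1 : (x j).natAbs ≤ ∑ j, (x j).natAbs :=
    Finset.single_le_sum (f := fun j => (x j).natAbs) (fun _ _ => Nat.zero_le _) (Finset.mem_univ j)
  have h2 : ∑ j, (x j).natAbs ≤ ∑ x ∈ Λ, ∑ j, (x j).natAbs :=
    Finset.single_le_sum (f := fun x : Site d => ∑ j, (x j).natAbs) (fun _ _ => Nat.zero_le _) hx
  omega

/-- Boundary layers of the cubes `[-n, n]^d` are negligible. -/
theorem tendsto_card_box_div (a : ℤ) :
    Tendsto (fun n : ℕ => ((box d (n + a)).card : ℝ) / (box d n).card) atTop (𝓝 1) := by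
  have h1 : Tendsto (fun n : ℕ => (1 + (2 * a : ℝ) * (2 * (n : ℝ) + 1)⁻¹) ^ d) atTop (𝓝 1) := by
    have : Tendsto (fun n : ℕ => (2 * (n : ℝ) + 1)⁻¹) atTop (𝓝 0) := by
      refine tendsto_inv_atTop_zero.comp ?_
      exact tendsto_atTop_add_const_right _ _
        (tendsto_natCast_atTop_atTop.const_mul_atTop (by norm_num))
    simpa using (((this.const_mul (2 * a : ℝ)).const_add 1).pow d)
  refine h1.congr' ?_
  filter_upwards [eventually_ge_atTop a.natAbs] with n hn
  rw [card_box (by omega), card_box (by omega), ← div_pow]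
  congr 1
  have : (0 : ℝ) < 2 * n + 1 := by positivity
  push_cast
  field_simp
  ring

/-! ### The formal generator as a sum over sites -/

namespace JumpRates

variable (c : JumpRates d q)

/-- The contribution of the transitions in `Δ` to the formal generator. -/
def jump (Δ : Finset (Site d)) (f : Config d q → ℝ) (η : Config d q) : ℝ :=
  ∑ ξ : Δ → Fin q, c.rate Δ η ξ * (f (Function.updateFinset η Δ ξ) - f η)

theorem gen_eq_tsum_jump (f : Config d q → ℝ) (η : Config d q) :
    c.gen f η = ∑' Δ, c.jump Δ f η := rfl

theorem continuous_jump (Δ : Finset (Site d)) {f : Config d q → ℝ} (hf : Continuous f) :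
    Continuous (c.jump Δ f) :=
  continuous_finsetSum _ fun ξ _ => (c.continuous Δ ξ).mul
    ((hf.comp (continuous_updateFinset Δ ξ)).sub hf)

theorem jump_eq_zero_of_disjoint {Δ Λ : Finset (Site d)} {f : Config d q → ℝ}
    (hf : DependsOn f (Λ : Set (Site d))) (h : Disjoint Δ Λ) (η : Config d q) :
    c.jump Δ f η = 0 := by
  refine Finset.sum_eq_zero fun ξ _ => ?_
  rw [hf (y := η), sub_self, mul_zero]
  exact fun x hx => updateFinset_of_notMem _ _ (Finset.disjoint_right.1 h hx)

/-- The transitions that involve the origin take place inside of `Γ`. -/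
def HasTransitionsIn (Γ : Finset (Site d)) : Prop :=
  ∀ Δ, 0 ∈ Δ → ¬ Δ ⊆ Γ → ∀ η ξ, c.rate Δ η ξ = 0

/-- The possible sets of transitions that involve the origin. -/
def reps (Γ : Finset (Site d)) : Finset (Finset (Site d)) := Γ.powerset.filter fun Δ => 0 ∈ Δ

theorem mem_reps {Γ Δ : Finset (Site d)} : Δ ∈ reps Γ ↔ Δ ⊆ Γ ∧ 0 ∈ Δ := by
  simp [reps]

/-- The contribution of the site `i` to the formal generator: the transitions in each `Δ` are
distributed evenly among the sites of `Δ`. -/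
def siteGen (Γ : Finset (Site d)) (i : Site d) (f : Config d q → ℝ) (η : Config d q) : ℝ :=
  ∑ Δ ∈ reps Γ, (Δ.card : ℝ)⁻¹ * c.jump (translate i Δ) f η

theorem continuous_siteGen (Γ : Finset (Site d)) (i : Site d) {f : Config d q → ℝ}
    (hf : Continuous f) : Continuous (c.siteGen Γ i f) :=
  continuous_finsetSum _ fun _ _ => continuous_const.mul (c.continuous_jump _ hf)

theorem jump_sub (Δ : Finset (Site d)) (f g : Config d q → ℝ) (η : Config d q) :
    c.jump Δ (fun ζ => f ζ - g ζ) η = c.jump Δ f η - c.jump Δ g η := by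
  rw [jump, jump, jump, ← Finset.sum_sub_distrib]
  exact Finset.sum_congr rfl fun ξ _ => by ring

theorem siteGen_sub (Γ : Finset (Site d)) (i : Site d) (f g : Config d q → ℝ) (η : Config d q) :
    c.siteGen Γ i (fun ζ => f ζ - g ζ) η = c.siteGen Γ i f η - c.siteGen Γ i g η := by
  rw [siteGen, siteGen, siteGen, ← Finset.sum_sub_distrib]
  exact Finset.sum_congr rfl fun Δ _ => by rw [jump_sub]; ring

variable {c}

theorem jump_eq_sum_cyl (Δ : Finset (Site d)) {Λ : Finset (Site d)} {f : Config d q → ℝ}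
    (hf : DependsOn f (Λ : Set (Site d))) (η₀ η : Config d q) :
    c.jump Δ f η = ∑ ω : Λ → Fin q,
      f (Function.updateFinset η₀ Λ ω) * c.jump Δ ((cyl Λ ω).indicator 1) η := by
  simp only [jump, Finset.mul_sum]
  rw [Finset.sum_comm]
  refine Finset.sum_congr rfl fun ξ _ => ?_
  rw [congrFun (eq_sum_indicator_cyl hf η₀) η,
    congrFun (eq_sum_indicator_cyl hf η₀) (Function.updateFinset η Δ ξ),
    ← Finset.sum_sub_distrib, Finset.mul_sum]
  exact Finset.sum_congr rfl fun ω _ => by ring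

theorem siteGen_eq_sum_cyl (Γ : Finset (Site d)) (i : Site d) {Λ : Finset (Site d)}
    {f : Config d q → ℝ} (hf : DependsOn f (Λ : Set (Site d))) (η₀ η : Config d q) :
    c.siteGen Γ i f η = ∑ ω : Λ → Fin q,
      f (Function.updateFinset η₀ Λ ω) * c.siteGen Γ i ((cyl Λ ω).indicator 1) η := by
  simp only [siteGen, Finset.mul_sum]
  rw [Finset.sum_comm]
  refine Finset.sum_congr rfl fun Δ _ => ?_
  rw [jump_eq_sum_cyl _ hf η₀ η, Finset.mul_sum]
  exact Finset.sum_congr rfl fun ω _ => by ring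

theorem IsTranslationInvariant.rate_shift (hc : c.IsTranslationInvariant) (i : Site d)
    (Δ : Finset (Site d)) (η : Config d q) (ξ : Δ → Fin q) :
    c.rate (translate i Δ) (shift i η) (shiftLocal i Δ ξ) = c.rate Δ η ξ := by
  have h := hc i Δ η (Function.updateFinset η Δ ξ)
  rwa [← shiftLocal_restrict, restrict_updateFinset'] at h

theorem IsTranslationInvariant.jump_shift (hc : c.IsTranslationInvariant) (i : Site d)
    (Δ : Finset (Site d)) (f : Config d q → ℝ) (η : Config d q) :
    c.jump (translate i Δ) f (shift i η) = c.jump Δ (fun ζ => f (shift i ζ)) η := by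
  rw [jump, jump, ← (shiftLocal i Δ).sum_comp]
  exact Finset.sum_congr rfl fun ξ _ => by rw [hc.rate_shift, updateFinset_shift]

theorem IsTranslationInvariant.siteGen_shift (hc : c.IsTranslationInvariant)
    (Γ : Finset (Site d)) (i j : Site d) (f : Config d q → ℝ) (η : Config d q) :
    c.siteGen Γ (i + j) f (shift j η) = c.siteGen Γ i (fun ζ => f (shift j ζ)) η :=
  Finset.sum_congr rfl fun Δ _ => by rw [← translate_translate, hc.jump_shift]

theorem IsTranslationInvariant.gen_shift (hc : c.IsTranslationInvariant) (i : Site d)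
    (f : Config d q → ℝ) (η : Config d q) :
    c.gen f (shift i η) = c.gen (fun ζ => f (shift i ζ)) η := by
  let e : Finset (Site d) ≃ Finset (Site d) :=
    ⟨translate i, translate (-i), translate_neg_translate i, fun Λ => by
      rw [translate_translate, neg_add_cancel, translate_zero]⟩
  rw [gen_eq_tsum_jump, gen_eq_tsum_jump, ← e.tsum_eq]
  exact tsum_congr fun Δ => hc.jump_shift i Δ f η

theorem HasTransitionsIn.rate_eq_zero {Γ : Finset (Site d)} (hΓ : c.HasTransitionsIn Γ)
    (hc : c.IsTranslationInvariant) {Δ : Finset (Site d)} {i : Site d} (hi : i ∈ Δ)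
    (h : ¬ Δ ⊆ translate i Γ) (η : Config d q) (ξ : Δ → Fin q) : c.rate Δ η ξ = 0 := by
  rw [← hc.rate_shift (-i)]
  refine hΓ _ (mem_translate.2 (by simpa using hi)) (fun h' => h fun x hx => ?_) _ _
  have : x - i ∈ Γ := h' (mem_translate.2 (by simpa using hx))
  exact mem_translate.2 this

theorem HasTransitionsIn.jump_eq_zero {Γ : Finset (Site d)} (hΓ : c.HasTransitionsIn Γ)
    (hc : c.IsTranslationInvariant) {Δ : Finset (Site d)} {i : Site d} (hi : i ∈ Δ)
    (h : ¬ Δ ⊆ translate i Γ) (f : Config d q → ℝ) (η : Config d q) : c.jump Δ f η = 0 :=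
  Finset.sum_eq_zero fun ξ _ => by rw [hΓ.rate_eq_zero hc hi h, zero_mul]

/-- A sum over the sets that contain `i` and carry transitions runs over translates of sets
that contain the origin. -/
theorem sum_reps_translate {M : Type*} [AddCommMonoid M] {Γ : Finset (Site d)} {i : Site d}
    {𝓕 : Finset (Finset (Site d))} (g : Finset (Site d) → M) (hi : ∀ Δ ∈ 𝓕, i ∈ Δ)
    (h₁ : ∀ Δ ∈ 𝓕, ¬ Δ ⊆ translate i Γ → g Δ = 0)
    (h₂ : ∀ Δ, i ∈ Δ → Δ ⊆ translate i Γ → Δ ∉ 𝓕 → g Δ = 0) :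
    ∑ Δ ∈ 𝓕, g Δ = ∑ Δ ∈ reps Γ, g (translate i Δ) := by
  rw [← Finset.sum_image (f := g) (fun _ _ _ _ h => translate_injective i h)]
  refine Finset.sum_congr_of_eq_on_inter (fun Δ hΔ hn => ?_) (fun Δ hΔ hn => ?_) (fun _ _ _ => rfl)
  · refine h₁ Δ hΔ fun hs => hn ?_
    refine Finset.mem_image.2 ⟨translate (-i) Δ, mem_reps.2 ⟨fun x hx => ?_, ?_⟩, ?_⟩
    · have := hs (mem_translate.1 hx)
      simpa [mem_translate] using this
    · rw [mem_translate]; simpa using hi Δ hΔ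
    · rw [translate_translate, neg_add_cancel, translate_zero]
  · obtain ⟨Δ', hΔ', rfl⟩ := Finset.mem_image.1 hΔ
    rw [mem_reps] at hΔ'
    exact h₂ _ (mem_translate.2 (by simpa using hΔ'.2))
      (fun x hx => mem_translate.2 (hΔ'.1 (mem_translate.1 hx))) hn

theorem HasTransitionsIn.gen_eq_sum_siteGen {Γ : Finset (Site d)} (hΓ : c.HasTransitionsIn Γ)
    (hc : c.IsTranslationInvariant) {Λ S : Finset (Site d)} {f : Config d q → ℝ}
    (hf : DependsOn f (Λ : Set (Site d))) (hS : ∀ x ∈ Λ, translate x Γ ⊆ S) (η : Config d q) :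
    c.gen f η = ∑ i ∈ S, c.siteGen Γ i f η := by
  have hsub : ∀ Δ, c.jump Δ f η ≠ 0 → Δ ⊆ S := by
    intro Δ h
    obtain ⟨x, hx, hx'⟩ := Finset.not_disjoint_iff.1
      (mt (fun h' => c.jump_eq_zero_of_disjoint hf h' η) h)
    exact (not_not.1 (mt (fun h' => hΓ.jump_eq_zero hc hx h' f η) h)).trans (hS x hx')
  rw [gen_eq_tsum_jump, tsum_eq_sum (s := S.powerset)
    (fun Δ hΔ => not_not.1 (mt (hsub Δ) (mt Finset.mem_powerset.2 hΔ)))]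
  have hsplit : ∀ Δ, c.jump Δ f η = ∑ i ∈ Δ, (Δ.card : ℝ)⁻¹ * c.jump Δ f η := by
    intro Δ
    rcases Δ.eq_empty_or_nonempty with rfl | hne
    · rw [Finset.sum_empty]
      exact c.jump_eq_zero_of_disjoint hf (Finset.disjoint_empty_left Λ) η
    · have : (Δ.card : ℝ) ≠ 0 := by exact_mod_cast hne.card_pos.ne'
      rw [Finset.sum_const, nsmul_eq_mul, mul_inv_cancel_left₀ this]
  rw [Finset.sum_congr rfl fun Δ _ => hsplit Δ,
    Finset.sum_comm' (t' := S) (s' := fun i => S.powerset.filter fun Δ => i ∈ Δ)]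
  · refine Finset.sum_congr rfl fun i _ => ?_
    rw [sum_reps_translate (Γ := Γ) (fun Δ => (Δ.card : ℝ)⁻¹ * c.jump Δ f η)]
    · exact Finset.sum_congr rfl fun Δ _ => by rw [card_translate]
    · exact fun Δ hΔ => (Finset.mem_filter.1 hΔ).2
    · intro Δ hΔ h
      rw [hΓ.jump_eq_zero hc (Finset.mem_filter.1 hΔ).2 h, mul_zero]
    · intro Δ hi _ hn
      rw [not_not.1 (mt (hsub Δ) fun h => hn (Finset.mem_filter.2 ⟨Finset.mem_powerset.2 h, hi⟩)),
        mul_zero]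
  · intro Δ i
    simp only [Finset.mem_powerset, Finset.mem_filter]
    exact ⟨fun h => ⟨⟨h.1, h.2⟩, h.1 h.2⟩, fun h => h.1⟩

/-- A finite set which contains all transitions that involve a site of `Λ`. -/
def enlarge (Γ Λ : Finset (Site d)) : Finset (Site d) := Λ.biUnion fun x => translate x Γ

theorem HasTransitionsIn.gen_eq_sum_enlarge {Γ : Finset (Site d)} (hΓ : c.HasTransitionsIn Γ)
    (hc : c.IsTranslationInvariant) {Λ : Finset (Site d)} {f : Config d q → ℝ}
    (hf : DependsOn f (Λ : Set (Site d))) (η : Config d q) :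
    c.gen f η = ∑ i ∈ enlarge Γ Λ, c.siteGen Γ i f η :=
  hΓ.gen_eq_sum_siteGen hc hf (fun _ hx => Finset.subset_biUnion_of_mem
    (fun x => translate x Γ) hx) η

theorem HasTransitionsIn.continuous_gen {Γ : Finset (Site d)} (hΓ : c.HasTransitionsIn Γ)
    (hc : c.IsTranslationInvariant) {Λ : Finset (Site d)} {f : Config d q → ℝ}
    (hf : DependsOn f (Λ : Set (Site d))) : Continuous (c.gen f) := by
  rw [funext fun η => hΓ.gen_eq_sum_enlarge hc hf η]
  exact continuous_finsetSum _ fun i _ => c.continuous_siteGen Γ i (continuous_of_dependsOn hf)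

/-- The formal generator is linear on functions of the coordinates in `Λ`. -/
theorem HasTransitionsIn.gen_eq_sum_cyl {Γ : Finset (Site d)} (hΓ : c.HasTransitionsIn Γ)
    (hc : c.IsTranslationInvariant) {Λ : Finset (Site d)} {f : Config d q → ℝ}
    (hf : DependsOn f (Λ : Set (Site d))) (η₀ η : Config d q) :
    c.gen f η = ∑ ω : Λ → Fin q,
      f (Function.updateFinset η₀ Λ ω) * c.gen ((cyl Λ ω).indicator 1) η := by
  rw [hΓ.gen_eq_sum_enlarge hc hf]
  have hcyl : ∀ ω : Λ → Fin q, f (Function.updateFinset η₀ Λ ω) * c.gen ((cyl Λ ω).indicator 1) η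
      = ∑ i ∈ enlarge Γ Λ, f (Function.updateFinset η₀ Λ ω) *
        c.siteGen Γ i ((cyl Λ ω).indicator 1) η := fun ω => by
    rw [hΓ.gen_eq_sum_enlarge hc (dependsOn_indicator_cyl Λ ω), Finset.mul_sum]
  rw [Finset.sum_congr rfl fun ω _ => hcyl ω, Finset.sum_comm]
  exact Finset.sum_congr rfl fun i _ => siteGen_eq_sum_cyl Γ i hf η₀ η

theorem gen_sum_indicator_eq_zero (hΓ : ∃ Γ, c.HasTransitionsIn Γ)
    (hc : c.IsTranslationInvariant) (Λ : Finset (Site d)) (η : Config d q) :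
    ∑ ω : Λ → Fin q, c.gen ((cyl Λ ω).indicator 1) η = 0 := by
  obtain ⟨Γ, hΓ⟩ := hΓ
  have h := hΓ.gen_eq_sum_cyl hc (Λ := Λ) (f := fun _ => 1) (fun _ _ _ => rfl) η η
  simp only [one_mul] at h
  rw [← h]
  simp [gen]

/-- The rates of the transitions that involve the origin are bounded. -/
theorem exists_rate_le (Γ : Finset (Site d)) :
    ∃ M, 0 ≤ M ∧ ∀ Δ ∈ reps Γ, ∀ (η : Config d q) (ξ : Δ → Fin q), c.rate Δ η ξ ≤ M := by
  choose C hC0 hC using fun (Δ : Finset (Site d)) (ξ : Δ → Fin q) =>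
    exists_bound_of_continuous (c.continuous Δ ξ)
  refine ⟨∑ Δ ∈ reps Γ, ∑ ξ : Δ → Fin q, C Δ ξ,
    Finset.sum_nonneg fun Δ _ => Finset.sum_nonneg fun ξ _ => hC0 Δ ξ, fun Δ hΔ η ξ => ?_⟩
  calc c.rate Δ η ξ ≤ C Δ ξ := (le_abs_self _).trans (hC Δ ξ η)
    _ ≤ ∑ ξ : Δ → Fin q, C Δ ξ :=
      Finset.single_le_sum (f := fun ξ => C Δ ξ) (fun ξ _ => hC0 Δ ξ) (Finset.mem_univ ξ)
    _ ≤ _ := Finset.single_le_sum (f := fun Δ : Finset (Site d) => ∑ ξ : Δ → Fin q, C Δ ξ)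
      (fun Δ _ => Finset.sum_nonneg fun ξ _ => hC0 Δ ξ) hΔ

end JumpRates

/-! ### Feller semigroups -/

/-- Integration against a probability measure as a continuous linear functional on `C(Ω)`. -/
def integralCLM (ν : ProbabilityMeasure (Config d q)) : C(Config d q, ℝ) →L[ℝ] ℝ :=
  LinearMap.mkContinuous
    { toFun := fun f => ∫ η, f η ∂(ν : Measure (Config d q))
      map_add' := fun f g => integral_add (integrable_of_continuous _ f.continuous)
        (integrable_of_continuous _ g.continuous)
      map_smul' := fun a f => integral_const_mul a f } 1 (fun f => by
    have := norm_integral_le_of_norm_le_const (μ := (ν : Measure (Config d q)))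
      (ae_of_all _ fun η => f.norm_coe_le_norm η)
    simpa using this)

theorem integralCLM_apply (ν : ProbabilityMeasure (Config d q)) (f : C(Config d q, ℝ)) :
    integralCLM ν f = ∫ η, f η ∂(ν : Measure (Config d q)) := rfl

theorem abs_integralCLM_le (ν : ProbabilityMeasure (Config d q)) (f : C(Config d q, ℝ)) :
    |integralCLM ν f| ≤ ‖f‖ := by
  simpa using (integralCLM ν).le_of_opNorm_le (LinearMap.mkContinuous_norm_le _ zero_le_one _) f

namespace FellerSemigroup

variable (P : FellerSemigroup d q)

instance (t : ℝ≥0) : IsMarkovKernel (P.kernel t) := P.isMarkov t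

theorem op_apply (t : ℝ≥0) (f : C(Config d q, ℝ)) (η : Config d q) :
    P.op t f η = ∫ ω, f ω ∂(P.kernel t η) := rfl

/-- The operators `P_t` as continuous linear maps. -/
def opCLM (t : ℝ≥0) : C(Config d q, ℝ) →L[ℝ] C(Config d q, ℝ) :=
  LinearMap.mkContinuous
    { toFun := P.op t
      map_add' := fun f g => ContinuousMap.ext fun _ =>
        integral_add (integrable_of_continuous _ f.continuous)
          (integrable_of_continuous _ g.continuous)
      map_smul' := fun a f => ContinuousMap.ext fun _ => integral_const_mul a f } 1 (fun f => by
    rw [one_mul]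
    refine (ContinuousMap.norm_le _ (norm_nonneg f)).2 fun η => ?_
    have := norm_integral_le_of_norm_le_const (μ := P.kernel t η)
      (ae_of_all _ fun ω => f.norm_coe_le_norm ω)
    rw [probReal_univ, mul_one] at this
    exact this)

theorem opCLM_apply (t : ℝ≥0) (f : C(Config d q, ℝ)) : P.opCLM t f = P.op t f := rfl

theorem norm_op_le (t : ℝ≥0) (f : C(Config d q, ℝ)) : ‖P.op t f‖ ≤ ‖f‖ :=
  (ContinuousLinearMap.le_of_opNorm_le (P.opCLM t)
    (LinearMap.mkContinuous_norm_le _ zero_le_one _) f).trans_eq (one_mul _)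

theorem op_sub (t : ℝ≥0) (f g : C(Config d q, ℝ)) : P.op t (f - g) = P.op t f - P.op t g :=
  map_sub (P.opCLM t) f g

theorem op_smul (t : ℝ≥0) (a : ℝ) (f : C(Config d q, ℝ)) : P.op t (a • f) = a • P.op t f :=
  map_smul (P.opCLM t) a f

theorem op_zero (f : C(Config d q, ℝ)) : P.op 0 f = f := by
  ext η
  rw [op_apply, P.zero, Kernel.id_apply, integral_dirac]

theorem op_add (s t : ℝ≥0) (f : C(Config d q, ℝ)) : P.op (s + t) f = P.op s (P.op t f) := by
  ext η
  rw [op_apply, P.add, Kernel.integral_comp (integrable_of_continuous _ f.continuous)]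
  rfl

theorem tendsto_op_zero (f : C(Config d q, ℝ)) : Tendsto (fun t => P.op t f) (𝓝 0) (𝓝 f) := by
  have h : ContinuousWithinAt (fun t => P.op t f) (Set.Ioi 0) 0 := by
    rw [ContinuousWithinAt, op_zero]; exact P.right_continuous f
  have h' := continuousWithinAt_Ioi_iff_Ici.1 h
  rw [show Set.Ici (0 : ℝ≥0) = Set.univ from Set.Ici_bot, continuousWithinAt_univ, ContinuousAt,
    op_zero] at h'
  exact h'

theorem continuous_op (f : C(Config d q, ℝ)) : Continuous fun t => P.op t f := by
  have key : ∀ s t : ℝ≥0, s ≤ t → dist (P.op t f) (P.op s f) ≤ ‖P.op (nndist t s) f - f‖ := by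
    intro s t hst
    have h : t = s + nndist t s := by
      have h1 : dist t s = t - s := by
        rw [NNReal.dist_eq, abs_of_nonneg (sub_nonneg.2 (NNReal.coe_le_coe.2 hst))]
      apply NNReal.coe_injective
      rw [NNReal.coe_add, coe_nndist, h1]; ring
    have h2 : P.op t f = P.op s (P.op (nndist t s) f) := by rw [← op_add, ← h]
    rw [dist_eq_norm, h2, ← op_sub]
    exact P.norm_op_le _ _
  refine continuous_iff_continuousAt.2 fun t => tendsto_iff_dist_tendsto_zero.2 ?_
  refine squeeze_zero (fun _ => dist_nonneg) (g := fun s => ‖P.op (nndist s t) f - f‖) ?_ ?_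
  · intro s
    rcases le_total t s with h | h
    · exact key t s h
    · rw [dist_comm, nndist_comm]; exact key s t h
  · have h1 : Tendsto (fun s => nndist s t) (𝓝 t) (𝓝 0) := by
      have : Continuous fun s : ℝ≥0 => nndist s t := by fun_prop
      simpa using this.tendsto t
    exact tendsto_iff_norm_sub_tendsto_zero.1 ((P.tendsto_op_zero f).comp h1)

theorem continuous_op_uncurry : Continuous fun p : ℝ≥0 × C(Config d q, ℝ) => P.op p.1 p.2 := by
  refine continuous_prod_of_continuous_lipschitzWith' _ 1 (fun t => ?_) (fun f => P.continuous_op f)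
  refine LipschitzWith.of_dist_le_mul fun f g => ?_
  rw [dist_eq_norm, dist_eq_norm, NNReal.coe_one, one_mul, ← op_sub]
  exact P.norm_op_le _ _

theorem op_mem_generatorGraph {f g : C(Config d q, ℝ)} (h : (f, g) ∈ P.generatorGraph) (s : ℝ≥0) :
    (P.op s f, P.op s g) ∈ P.generatorGraph := by
  have h1 := ((P.opCLM s).continuous.tendsto g).comp h
  refine h1.congr fun t => ?_
  simp only [Function.comp, opCLM_apply]
  rw [op_smul, op_sub, ← op_add, ← op_add, add_comm]

theorem tendsto_toNNReal_sub (s : ℝ) :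
    Tendsto (fun y : ℝ => (y - s).toNNReal) (𝓝[>] s) (𝓝[>] 0) := by
  refine tendsto_nhdsWithin_iff.2 ⟨?_, ?_⟩
  · have : Continuous fun y : ℝ => (y - s).toNNReal := by fun_prop
    have h := this.tendsto s
    simp only [sub_self, Real.toNNReal_zero] at h
    exact h.mono_left nhdsWithin_le_nhds
  · filter_upwards [self_mem_nhdsWithin] with y hy
    simpa using hy

theorem hasDerivWithinAt_op {f g : C(Config d q, ℝ)} (h : (f, g) ∈ P.generatorGraph) {s : ℝ}
    (hs : 0 ≤ s) :
    HasDerivWithinAt (fun s : ℝ => P.op s.toNNReal f) (P.op s.toNNReal g) (Set.Ici s) s := by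
  rw [hasDerivWithinAt_iff_tendsto_slope, Set.Ici_sdiff_left]
  have h1 := ((P.opCLM s.toNNReal).continuous.tendsto g).comp
    (Tendsto.comp h (tendsto_toNNReal_sub s))
  refine h1.congr' ?_
  filter_upwards [self_mem_nhdsWithin] with y hy
  have hy' : s < y := hy
  have h2 : y.toNNReal = s.toNNReal + (y - s).toNNReal := by
    rw [← Real.toNNReal_add hs (by linarith)]; congr 1; ring
  simp only [Function.comp, opCLM_apply, slope, vsub_eq_sub]
  rw [op_smul, op_sub, ← op_add, ← h2, Real.coe_toNNReal _ (by linarith)]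

/-- Two Feller semigroups agree where their generators do: here for a semigroup and its conjugate
by an isometry `U` which preserves the generator. -/
theorem op_comm_of_generatorGraph_comm (U : C(Config d q, ℝ) →L[ℝ] C(Config d q, ℝ))
    (hU : ∀ f g, (f, g) ∈ P.generatorGraph → (U f, U g) ∈ P.generatorGraph)
    {f g : C(Config d q, ℝ)} (h : (f, g) ∈ P.generatorGraph) (t : ℝ≥0) :
    U (P.op t f) = P.op t (U f) := by
  -- the curve `s ↦ P_{t-s} U P_s f` has vanishing right derivative
  let H : ℝ → C(Config d q, ℝ) := fun s => P.op (t - s : ℝ).toNNReal (U (P.op s.toNNReal f))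
  have hcont : Continuous H := by
    have h1 : Continuous fun s : ℝ => P.op s.toNNReal f :=
      (P.continuous_op f).comp continuous_real_toNNReal
    have h2 : Continuous fun s : ℝ => ((t - s : ℝ).toNNReal, U (P.op s.toNNReal f)) :=
      (by fun_prop : Continuous fun s : ℝ => (t - s : ℝ).toNNReal).prodMk (U.continuous.comp h1)
    exact P.continuous_op_uncurry.comp h2
  have hder : ∀ s ∈ Set.Ico (0 : ℝ) t, HasDerivWithinAt H 0 (Set.Ici s) s := by
    intro s hs
    rw [hasDerivWithinAt_iff_tendsto_slope, Set.Ici_sdiff_left]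
    have hg := P.op_mem_generatorGraph h s.toNNReal
    set f' := P.op s.toNNReal f with hf'
    set g' := P.op s.toNNReal g
    have h1 : Tendsto (fun r : ℝ≥0 => U ((r : ℝ)⁻¹ • (P.op r f' - f'))
        - (r : ℝ)⁻¹ • (P.op r (U f') - U f')) (𝓝[>] 0) (𝓝 (U g' - U g')) :=
      ((U.continuous.tendsto g').comp hg).sub (hU _ _ hg)
    rw [sub_self] at h1
    have h2 := tendsto_zero_iff_norm_tendsto_zero.1 (h1.comp (tendsto_toNNReal_sub s))
    refine tendsto_zero_iff_norm_tendsto_zero.2 (squeeze_zero' (.of_forall fun _ => norm_nonneg _) ?_ h2)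
    filter_upwards [Ioo_mem_nhdsGT hs.2] with y hy
    have e1 : y.toNNReal = (y - s).toNNReal + s.toNNReal := by
      rw [← Real.toNNReal_add (by linarith [hy.1]) hs.1]; congr 1; ring
    have e2 : (t - s : ℝ).toNNReal = (t - y : ℝ).toNNReal + (y - s).toNNReal := by
      rw [← Real.toNNReal_add (by linarith [hy.2]) (by linarith [hy.1])]; congr 1; ring
    have e3 : slope H s y = P.op (t - y : ℝ).toNNReal
        (U (((y - s).toNNReal : ℝ)⁻¹ • (P.op (y - s).toNNReal f' - f'))
          - ((y - s).toNNReal : ℝ)⁻¹ • (P.op (y - s).toNNReal (U f') - U f')) := by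
      simp only [slope, vsub_eq_sub, H]
      rw [e2, op_add P (t - y : ℝ).toNNReal, e1, op_add, ← hf', ← op_sub, map_smul, map_sub,
        ← smul_sub, op_smul, Real.coe_toNNReal _ (by linarith [hy.1])]
      congr 2
      abel
    rw [e3]
    exact P.norm_op_le _ _
  have := constant_of_has_deriv_right_zero hcont.continuousOn hder t ⟨t.2, le_rfl⟩
  simpa [H, op_zero] using this

/-! ### Evolution of measures -/

theorem integral_evolve (t : ℝ≥0) (ν : ProbabilityMeasure (Config d q)) (f : C(Config d q, ℝ)) :
    ∫ η, f η ∂(P.evolve t ν : Measure (Config d q)) = integralCLM ν (P.op t f) := by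
  have h := Kernel.integral_comp (η := P.kernel t) (κ := Kernel.const Unit (ν : Measure (Config d q)))
    (a := ()) (f := f) (integrable_of_continuous _ f.continuous)
  rw [Kernel.comp_apply, Kernel.const_apply] at h
  exact h

theorem continuous_integral_evolve (ν : ProbabilityMeasure (Config d q)) {f : Config d q → ℝ}
    (hf : Continuous f) :
    Continuous fun t => ∫ η, f η ∂(P.evolve t ν : Measure (Config d q)) := by
  have : (fun t => ∫ η, f η ∂(P.evolve t ν : Measure (Config d q)))
      = fun t => integralCLM ν (P.op t ⟨f, hf⟩) := funext fun t => P.integral_evolve t ν ⟨f, hf⟩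
  rw [this]
  exact (integralCLM ν).continuous.comp (P.continuous_op _)

theorem evolve_eq_of_integral {ν : ProbabilityMeasure (Config d q)} {m : Measure (Config d q)}
    [IsFiniteMeasure m] {t : ℝ≥0}
    (h : ∀ f : C(Config d q, ℝ), ∫ η, f η ∂m = integralCLM ν (P.op t f)) :
    (P.evolve t ν : Measure (Config d q)) = m := by
  refine ext_of_forall_integral_eq_of_IsFiniteMeasure fun f => ?_
  exact (P.integral_evolve t ν f.toContinuousMap).trans (h f.toContinuousMap).symm

theorem tendsto_evolve_add {ν νstar : ProbabilityMeasure (Config d q)} {u : ℕ → ℝ≥0}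
    (h : Tendsto (fun n => P.evolve (u n) ν) atTop (𝓝 νstar)) :
    Tendsto (fun p : ℕ × ℝ≥0 => P.evolve (u p.1 + p.2) ν) (atTop ×ˢ 𝓝 0) (𝓝 νstar) := by
  rw [ProbabilityMeasure.tendsto_iff_forall_integral_tendsto] at h ⊢
  intro f
  have h1 := (h f).comp (tendsto_fst (g := 𝓝 (0 : ℝ≥0)))
  have h2 : Tendsto (fun p : ℕ × ℝ≥0 =>
      ∫ η, f η ∂(P.evolve (u p.1 + p.2) ν : Measure (Config d q))
        - ∫ η, f η ∂(P.evolve (u p.1) ν : Measure (Config d q))) (atTop ×ˢ 𝓝 0) (𝓝 0) := by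
    have h3 := (tendsto_iff_norm_sub_tendsto_zero.1 (P.tendsto_op_zero f.toContinuousMap)).comp
      (tendsto_snd (f := (atTop : Filter ℕ)))
    refine squeeze_zero_norm (fun p => ?_) h3
    have e1 := P.integral_evolve (u p.1 + p.2) ν f.toContinuousMap
    have e2 := P.integral_evolve (u p.1) ν f.toContinuousMap
    simp only [BoundedContinuousFunction.coe_toContinuousMap] at e1 e2
    rw [e1, e2, ← map_sub, op_add, ← op_sub]
    exact (abs_integralCLM_le _ _).trans (P.norm_op_le _ _)
  simpa using h2.add h1

variable {P} {c : JumpRates d q}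

theorem IsSemigroupOf.mem_generatorGraph (hP : P.IsSemigroupOf c) {Γ : Finset (Site d)}
    (hΓ : c.HasTransitionsIn Γ) (hc : c.IsTranslationInvariant) {Λ : Finset (Site d)}
    {f : Config d q → ℝ} (hf : DependsOn f (Λ : Set (Site d))) :
    ((⟨f, continuous_of_dependsOn hf⟩, ⟨c.gen f, hΓ.continuous_gen hc hf⟩) :
      C(Config d q, ℝ) × C(Config d q, ℝ)) ∈ P.generatorGraph := by
  rw [hP]
  exact subset_closure ⟨⟨Λ, hf⟩, fun _ => rfl⟩

/-- The forward equation for functions of finitely many coordinates. -/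
theorem IsSemigroupOf.hasDerivWithinAt_integral_evolve (hP : P.IsSemigroupOf c)
    {Γ : Finset (Site d)} (hΓ : c.HasTransitionsIn Γ) (hc : c.IsTranslationInvariant)
    (ν : ProbabilityMeasure (Config d q)) {Λ : Finset (Site d)} {f : Config d q → ℝ}
    (hf : DependsOn f (Λ : Set (Site d))) {s : ℝ} (hs : 0 ≤ s) :
    HasDerivWithinAt (fun s : ℝ => ∫ η, f η ∂(P.evolve s.toNNReal ν : Measure (Config d q)))
      (∫ η, c.gen f η ∂(P.evolve s.toNNReal ν : Measure (Config d q))) (Set.Ici s) s := by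
  have h := (integralCLM ν).hasFDerivAt.comp_hasDerivWithinAt s
    (P.hasDerivWithinAt_op (hP.mem_generatorGraph hΓ hc hf) hs)
  have e1 : (fun s : ℝ => ∫ η, f η ∂(P.evolve s.toNNReal ν : Measure (Config d q)))
      = (integralCLM ν) ∘ fun s : ℝ => P.op s.toNNReal ⟨f, continuous_of_dependsOn hf⟩ :=
    funext fun s => P.integral_evolve s.toNNReal ν ⟨f, continuous_of_dependsOn hf⟩
  have e2 := P.integral_evolve s.toNNReal ν ⟨c.gen f, hΓ.continuous_gen hc hf⟩
  rw [ContinuousMap.coe_mk] at e2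
  rw [e1, e2]
  exact h

/-- The dynamics preserves translation invariance: shifts preserve the formal generator, hence its
closure, which determines the semigroup. -/
theorem IsSemigroupOf.isTranslationInvariant_evolve (hP : P.IsSemigroupOf c)
    {Γ : Finset (Site d)} (hΓ : c.HasTransitionsIn Γ) (hc : c.IsTranslationInvariant)
    {ν : ProbabilityMeasure (Config d q)} (hν : IPS.IsTranslationInvariant ν) (t : ℝ≥0) :
    IPS.IsTranslationInvariant (P.evolve t ν) := by
  intro i
  let τ : C(Config d q, Config d q) := ⟨shift i, continuous_shift i⟩
  let U : C(Config d q, ℝ) →L[ℝ] C(Config d q, ℝ) :=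
    { toFun := fun f => f.comp τ
      map_add' := fun _ _ => rfl
      map_smul' := fun _ _ => rfl
      cont := ContinuousMap.continuous_precomp τ }
  have hU : ∀ f g, (f, g) ∈ P.generatorGraph → (U f, U g) ∈ P.generatorGraph := by
    intro f g h
    rw [hP] at h ⊢
    refine map_mem_closure (f := fun p : C(Config d q, ℝ) × C(Config d q, ℝ) => (U p.1, U p.2))
      (by fun_prop) h ?_
    rintro ⟨f, g⟩ ⟨⟨Λ, hf⟩, hg⟩
    refine ⟨⟨translate (-i) Λ, ?_⟩, fun η => ?_⟩
    · refine dependsOn_comp_shift (i := i) ?_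
      rwa [translate_translate, neg_add_cancel, translate_zero]
    · exact (hg _).trans (hc.gen_shift i f η)
  have : IsProbabilityMeasure ((P.evolve t ν : Measure (Config d q)).map (shift i)) :=
    Measure.isProbabilityMeasure_map (measurable_shift i).aemeasurable
  refine measure_ext_cyl fun Λ ω => ?_
  rw [Measure.map_apply (measurable_shift i) (measurableSet_cyl Λ ω),
    ← measureReal_eq_measureReal_iff]
  let f : C(Config d q, ℝ) := ⟨(cyl Λ ω).indicator 1, continuous_indicator_cyl Λ ω⟩
  have h1 : U (P.op t f) = P.op t (U f) := P.op_comm_of_generatorGraph_comm U hU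
    (hP.mem_generatorGraph hΓ hc (dependsOn_indicator_cyl Λ ω)) t
  have h2 : integralCLM ν (U (P.op t f)) = integralCLM ν (P.op t f) := by
    have h3 : integralCLM ν (P.op t f)
        = ∫ η, P.op t f η ∂((ν : Measure (Config d q)).map (shift i)) := by rw [hν i]; rfl
    rw [h3, integral_map (measurable_shift i).aemeasurable
      (P.op t f).continuous.aestronglyMeasurable]
    rfl
  rw [← integral_indicator_one (measurableSet_cyl Λ ω),
    ← integral_indicator_one (measurable_shift i (measurableSet_cyl Λ ω))]
  exact (P.integral_evolve t ν (U f)).trans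
    ((congrArg _ h1.symm).trans (h2.trans (P.integral_evolve t ν f).symm))

end FellerSemigroup

/-! ### Mixtures and limits of measures -/

/-- The even mixture of two probability measures. -/
def mix (ν μ : ProbabilityMeasure (Config d q)) : ProbabilityMeasure (Config d q) :=
  ⟨(2⁻¹ : ℝ≥0∞) • (ν : Measure (Config d q)) + (2⁻¹ : ℝ≥0∞) • (μ : Measure (Config d q)),
    ⟨by simp [ENNReal.inv_two_add_inv_two]⟩⟩

theorem coe_mix (ν μ : ProbabilityMeasure (Config d q)) : (mix ν μ : Measure (Config d q))
    = (2⁻¹ : ℝ≥0∞) • (ν : Measure (Config d q)) + (2⁻¹ : ℝ≥0∞) • (μ : Measure (Config d q)) := rfl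

theorem integral_mix (ν μ : ProbabilityMeasure (Config d q)) {f : Config d q → ℝ}
    (hf : Continuous f) : ∫ η, f η ∂(mix ν μ : Measure (Config d q))
      = 2⁻¹ * ∫ η, f η ∂(ν : Measure (Config d q)) + 2⁻¹ * ∫ η, f η ∂(μ : Measure (Config d q)) := by
  rw [coe_mix, integral_add_measure]
  · simp [integral_smul_measure]
  · exact (integrable_of_continuous _ hf).smul_measure (by simp)
  · exact (integrable_of_continuous _ hf).smul_measure (by simp)

theorem IsTranslationInvariant.mix {ν μ : ProbabilityMeasure (Config d q)}
    (hν : IsTranslationInvariant ν) (hμ : IsTranslationInvariant μ) :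
    IsTranslationInvariant (mix ν μ) := by
  intro i
  rw [coe_mix, Measure.map_add _ _ (measurable_shift i), Measure.map_smul, Measure.map_smul, hν i,
    hμ i]

theorem FellerSemigroup.evolve_mix (P : FellerSemigroup d q) {ν μ : ProbabilityMeasure (Config d q)}
    (hμ : P.IsStationary μ) (t : ℝ≥0) : P.evolve t (IPS.mix ν μ) = IPS.mix (P.evolve t ν) μ := by
  have hfin : IsFiniteMeasure (IPS.mix (P.evolve t ν) μ : Measure (Config d q)) := inferInstance
  refine Subtype.ext ?_
  refine @evolve_eq_of_integral d q P (IPS.mix ν μ) _ hfin t fun f => ?_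
  have h := P.integral_evolve t μ f
  rw [hμ t] at h
  rw [integral_mix _ _ f.continuous, integralCLM_apply,
    integral_mix _ _ (P.op t f).continuous, P.integral_evolve, h]
  rfl

theorem tendsto_mix {α : Type*} {l : Filter α} {u : α → ProbabilityMeasure (Config d q)}
    {ν : ProbabilityMeasure (Config d q)} (h : Tendsto u l (𝓝 ν))
    (μ : ProbabilityMeasure (Config d q)) : Tendsto (fun a => mix (u a) μ) l (𝓝 (mix ν μ)) := by
  rw [ProbabilityMeasure.tendsto_iff_forall_integral_tendsto] at h ⊢
  intro f
  simp only [integral_mix _ _ f.continuous]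
  exact ((h f).const_mul _).add_const _

theorem IsTranslationInvariant.of_tendsto {α : Type*} {l : Filter α} [l.NeBot]
    {u : α → ProbabilityMeasure (Config d q)} {ν : ProbabilityMeasure (Config d q)}
    (h : Tendsto u l (𝓝 ν)) (hu : ∀ a, IsTranslationInvariant (u a)) :
    IsTranslationInvariant ν := by
  intro i
  have : IsProbabilityMeasure ((ν : Measure (Config d q)).map (shift i)) :=
    Measure.isProbabilityMeasure_map (measurable_shift i).aemeasurable
  refine ext_of_forall_integral_eq_of_IsFiniteMeasure fun f => ?_
  rw [ProbabilityMeasure.tendsto_iff_forall_integral_tendsto] at h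
  have h1 := h (f.compContinuous ⟨shift i, continuous_shift i⟩)
  refine tendsto_nhds_unique ?_ (h f)
  rw [integral_map (measurable_shift i).aemeasurable f.continuous.aestronglyMeasurable]
  refine h1.congr fun a => ?_
  conv_rhs => rw [← hu a i]
  rw [integral_map (measurable_shift i).aemeasurable f.continuous.aestronglyMeasurable]
  rfl

/-! ### Cylinder probabilities and entropy inequalities -/

/-- The probability of the cylinder event that contains `η`. -/
def prob (m : Measure (Config d q)) (Λ : Finset (Site d)) (η : Config d q) : ℝ :=
  m.real (cyl Λ (Λ.restrict η))

/-- The logarithm of the probability of the cylinder event that contains `η`. -/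
def logProb (m : Measure (Config d q)) (Λ : Finset (Site d)) (η : Config d q) : ℝ :=
  Real.log (prob m Λ η)

/-- All cylinder events have positive probability. -/
def ChargesCylinders (m : Measure (Config d q)) : Prop := ∀ Λ η, 0 < prob m Λ η

theorem dependsOn_prob (m : Measure (Config d q)) (Λ : Finset (Site d)) :
    DependsOn (prob m Λ) (Λ : Set (Site d)) := fun η ζ h => by
  rw [prob, prob, cyl_restrict_congr (Λ := Λ) h]

theorem dependsOn_logProb (m : Measure (Config d q)) (Λ : Finset (Site d)) :
    DependsOn (logProb m Λ) (Λ : Set (Site d)) := fun η ζ h => by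
  rw [logProb, logProb, dependsOn_prob m Λ h]

theorem continuous_prob (m : Measure (Config d q)) (Λ : Finset (Site d)) :
    Continuous (prob m Λ) := continuous_of_dependsOn (dependsOn_prob m Λ)

theorem continuous_logProb (m : Measure (Config d q)) (Λ : Finset (Site d)) :
    Continuous (logProb m Λ) := continuous_of_dependsOn (dependsOn_logProb m Λ)

theorem prob_updateFinset (m : Measure (Config d q)) (Λ : Finset (Site d)) (η : Config d q)
    (ω : Λ → Fin q) : prob m Λ (Function.updateFinset η Λ ω) = m.real (cyl Λ ω) := by
  rw [prob, restrict_updateFinset']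

theorem prob_anti (m : Measure (Config d q)) [IsFiniteMeasure m] {V Λ : Finset (Site d)}
    (h : V ⊆ Λ) (η : Config d q) : prob m Λ η ≤ prob m V η :=
  measureReal_mono fun _ hζ => mem_cyl_restrict.2 fun x hx => mem_cyl_restrict.1 hζ x (h hx)

theorem IsTranslationInvariant.prob_shift {ν : ProbabilityMeasure (Config d q)}
    (hν : IsTranslationInvariant ν) (i : Site d) (Λ : Finset (Site d)) (η : Config d q) :
    prob ν (translate i Λ) (shift i η) = prob ν Λ η := by
  rw [prob, prob, ← shift_preimage_cyl i Λ η,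
    ← map_measureReal_apply (measurable_shift i) (measurableSet_cyl _ _), hν i]

theorem IsTranslationInvariant.logProb_shift {ν : ProbabilityMeasure (Config d q)}
    (hν : IsTranslationInvariant ν) (i : Site d) (Λ : Finset (Site d)) (η : Config d q) :
    logProb ν (translate i Λ) (shift i η) = logProb ν Λ η := by
  rw [logProb, logProb, hν.prob_shift]

theorem IsTranslationInvariant.integral_shift {ν : ProbabilityMeasure (Config d q)}
    (hν : IsTranslationInvariant ν) (i : Site d) {f : Config d q → ℝ} (hf : Continuous f) :
    ∫ η, f (shift i η) ∂(ν : Measure (Config d q)) = ∫ η, f η ∂(ν : Measure (Config d q)) := by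
  conv_rhs => rw [← hν i]
  rw [integral_map (measurable_shift i).aemeasurable hf.aestronglyMeasurable]

theorem continuous_prob_div {m ν : Measure (Config d q)} (hν : ChargesCylinders ν)
    (Λ : Finset (Site d)) : Continuous fun η => prob m Λ η / prob ν Λ η :=
  (continuous_prob m Λ).div (continuous_prob ν Λ) fun η => (hν Λ η).ne'

section Comparison

variable {m ν : Measure (Config d q)} [IsFiniteMeasure m] [IsFiniteMeasure ν]

/-- On functions of the coordinates in `Λ`, the ratio of the cylinder probabilities is the density
of `m` with respect to `ν`. -/
theorem integral_mul_prob_div (hν : ChargesCylinders ν) {Λ : Finset (Site d)}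
    {h : Config d q → ℝ} (hh : DependsOn h (Λ : Set (Site d))) :
    ∫ η, h η * (prob m Λ η / prob ν Λ η) ∂ν = ∫ η, h η ∂m := by
  rcases isEmpty_or_nonempty (Config d q) with he | ⟨⟨η₀⟩⟩
  · rw [Measure.eq_zero_of_isEmpty ν, Measure.eq_zero_of_isEmpty m]
    simp
  · rw [integral_eq_sum_cyl ν (Λ := Λ) _ η₀, integral_eq_sum_cyl m hh η₀]
    · refine Finset.sum_congr rfl fun ω _ => ?_
      have h0 := hν Λ (Function.updateFinset η₀ Λ ω)
      rw [prob_updateFinset] at h0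
      rw [prob_updateFinset, prob_updateFinset]
      field_simp
    · intro η ζ hηζ
      simp only [hh hηζ, dependsOn_prob m Λ hηζ, dependsOn_prob ν Λ hηζ]



/-- The logarithmic ratio, weighted with a bounded nonnegative function, is bounded above. -/
theorem integral_mul_logProb_sub_le (hm : ChargesCylinders m) (hν : ChargesCylinders ν)
    (Λ : Finset (Site d)) {r : Config d q → ℝ} (hr : Continuous r) {M : ℝ} (h0 : ∀ η, 0 ≤ r η)
    (hM : ∀ η, r η ≤ M) :
    ∫ η, r η * (logProb m Λ η - logProb ν Λ η) ∂ν ≤ M * m.real Set.univ := by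
  have h1 : ∫ η, M * (prob m Λ η / prob ν Λ η) ∂ν = M * m.real Set.univ := by
    rw [integral_mul_prob_div hν (h := fun _ => M) (fun _ _ _ => rfl), integral_const, smul_eq_mul,
      mul_comm]
  rw [← h1]
  refine integral_mono
    (integrable_of_continuous ν (hr.mul ((continuous_logProb m Λ).sub (continuous_logProb ν Λ))))
    (integrable_of_continuous ν (continuous_const.mul (continuous_prob_div hν Λ))) fun η => ?_
  have hpos := div_pos (hm Λ η) (hν Λ η)
  have h2 : logProb m Λ η - logProb ν Λ η ≤ prob m Λ η / prob ν Λ η := by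
    rw [logProb, logProb, ← Real.log_div (hm Λ η).ne' (hν Λ η).ne']
    exact (Real.log_le_sub_one_of_pos hpos).trans (by linarith)
  exact (mul_le_mul_of_nonneg_left h2 (h0 η)).trans (mul_le_mul_of_nonneg_right (hM η) hpos.le)

/-- Monotonicity in the volume of the logarithmic ratio, weighted with a nonnegative function of
finitely many coordinates: a form of Jensen's inequality. -/
theorem integral_mul_logProb_sub_anti (hm : ChargesCylinders m) (hν : ChargesCylinders ν)
    {V Λ : Finset (Site d)} (hVΛ : V ⊆ Λ) {r : Config d q → ℝ}
    (hr : DependsOn r (V : Set (Site d))) (h0 : ∀ η, 0 ≤ r η) :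
    ∫ η, r η * (logProb m Λ η - logProb ν Λ η) ∂ν
      ≤ ∫ η, r η * (logProb m V η - logProb ν V η) ∂ν := by
  have hrc := continuous_of_dependsOn hr
  have hdep : DependsOn (fun η => r η * (prob ν V η / prob m V η)) (V : Set (Site d)) := by
    intro η ζ h
    simp only [hr h, dependsOn_prob m V h, dependsOn_prob ν V h]
  have e1 : ∫ η, r η * (prob ν V η / prob m V η) * (prob m Λ η / prob ν Λ η) ∂ν = ∫ η, r η ∂ν := by
    rw [integral_mul_prob_div hν (hdep.mono (by exact_mod_cast hVΛ)), integral_mul_prob_div hm hr]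
  have i1 : Integrable (fun η => r η * (prob ν V η / prob m V η) * (prob m Λ η / prob ν Λ η)) ν :=
    integrable_of_continuous ν ((continuous_of_dependsOn hdep).mul (continuous_prob_div hν Λ))
  have i2 : Integrable r ν := integrable_of_continuous ν hrc
  have iL : ∀ W : Finset (Site d),
      Integrable (fun η => r η * (logProb m W η - logProb ν W η)) ν := fun W =>
    integrable_of_continuous ν (hrc.mul ((continuous_logProb m W).sub (continuous_logProb ν W)))
  have key := integral_mono ((iL Λ).sub (iL V)) (i1.sub i2) fun η => ?_
  · simp only [Pi.sub_apply] at key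
    rw [integral_sub (iL Λ) (iL V), integral_sub i1 i2, e1] at key
    linarith
  · simp only [Pi.sub_apply]
    have p1 := hm Λ η
    have p2 := hν Λ η
    have p3 := hm V η
    have p4 := hν V η
    have h := Real.log_le_sub_one_of_pos (mul_pos (div_pos p4 p3) (div_pos p1 p2))
    rw [Real.log_mul (div_pos p4 p3).ne' (div_pos p1 p2).ne', Real.log_div p4.ne' p3.ne',
      Real.log_div p1.ne' p2.ne'] at h
    have := mul_le_mul_of_nonneg_left h (h0 η)
    simp only [logProb]
    linarith

/-- Approximate monotonicity in the volume for weights which are close to a function of finitely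
many coordinates. -/
theorem integral_mul_logProb_sub_le_of_approx (hm : ChargesCylinders m) (hν : ChargesCylinders ν)
    {V Λ : Finset (Site d)} (hVΛ : V ⊆ Λ) {r s : Config d q → ℝ} (hr : Continuous r)
    (hs : DependsOn s (V : Set (Site d))) (h0 : ∀ η, 0 ≤ s η) {M ε : ℝ} (hM : ∀ η, s η ≤ M)
    (hε : 0 ≤ ε) (hε1 : ε ≤ 1) (h1 : ∀ η, (1 - ε) * s η ≤ r η) (h2 : ∀ η, r η ≤ (1 + ε) * s η) :
    ∫ η, r η * (logProb m Λ η - logProb ν Λ η) ∂ν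
      ≤ (1 - ε) / (1 + ε) * ∫ η, r η * (logProb m V η - logProb ν V η) ∂ν
        + 4 * ε * (M * m.real Set.univ) := by
  have hsc := continuous_of_dependsOn hs
  have hL : ∀ W : Finset (Site d), Continuous fun η => logProb m W η - logProb ν W η := fun W =>
    (continuous_logProb m W).sub (continuous_logProb ν W)
  have iL : ∀ (W : Finset (Site d)) {f : Config d q → ℝ}, Continuous f →
      Integrable (fun η => f η * (logProb m W η - logProb ν W η)) ν := fun W f hf =>
    integrable_of_continuous ν (hf.mul (hL W))
  have lin : ∀ (W : Finset (Site d)) (a b : ℝ),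
      ∫ η, (a * s η + b * r η) * (logProb m W η - logProb ν W η) ∂ν
        = a * ∫ η, s η * (logProb m W η - logProb ν W η) ∂ν
          + b * ∫ η, r η * (logProb m W η - logProb ν W η) ∂ν := by
    intro W a b
    rw [← integral_const_mul, ← integral_const_mul,
      ← integral_add ((iL W hsc).const_mul a) ((iL W hr).const_mul b)]
    exact integral_congr_ae (ae_of_all _ fun η => by ring)
  have u1 := integral_mul_logProb_sub_le hm hν Λ (r := fun η => -(1 - ε) * s η + 1 * r η)
    (M := 2 * ε * M) (by fun_prop) (fun η => by linarith [h1 η])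
    (fun η => by nlinarith [h2 η, hM η])
  have u2 := integral_mul_logProb_sub_le hm hν V (r := fun η => (1 + ε) * s η + (-1) * r η)
    (M := 2 * ε * M) (by fun_prop) (fun η => by linarith [h2 η])
    (fun η => by nlinarith [h1 η, hM η])
  have u3 := integral_mul_logProb_sub_anti hm hν hVΛ hs h0
  rw [lin] at u1 u2
  rcases isEmpty_or_nonempty (Config d q) with he | ⟨⟨η₀⟩⟩
  · rw [Measure.eq_zero_of_isEmpty ν, Measure.eq_zero_of_isEmpty m]
    simp
  have hM0 : 0 ≤ M * m.real Set.univ := mul_nonneg ((h0 η₀).trans (hM η₀)) measureReal_nonneg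
  generalize ∫ η, s η * (logProb m Λ η - logProb ν Λ η) ∂ν = SΛ at *
  generalize ∫ η, s η * (logProb m V η - logProb ν V η) ∂ν = SV at *
  generalize ∫ η, r η * (logProb m Λ η - logProb ν Λ η) ∂ν = RΛ at *
  generalize ∫ η, r η * (logProb m V η - logProb ν V η) ∂ν = RV at *
  generalize m.real Set.univ = K at *
  have ha0 : 0 ≤ (1 - ε) / (1 + ε) := div_nonneg (by linarith) (by linarith)
  have ha1 : (1 - ε) / (1 + ε) ≤ 1 := (div_le_one (by linarith)).2 (by linarith)
  have e : (1 - ε) * SV = (1 - ε) / (1 + ε) * ((1 + ε) * SV) := by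
    have : (1 + ε) ≠ 0 := by linarith
    field_simp
  have v1 : RΛ ≤ (1 - ε) * SV + 2 * ε * M * K := by nlinarith
  have v2 : (1 - ε) / (1 + ε) * ((1 + ε) * SV) ≤ (1 - ε) / (1 + ε) * (RV + 2 * ε * M * K) :=
    mul_le_mul_of_nonneg_left (by linarith) ha0
  have v3 : (1 - ε) / (1 + ε) * (2 * ε * M * K) ≤ 2 * ε * M * K :=
    mul_le_of_le_one_left (by nlinarith) ha1
  rw [e] at v1
  rw [mul_add] at v2
  linarith

end Comparison

/-- The measure with `m(ω_Λ) = ν(σ_Δ ω_{Λ∖Δ})` for all `Λ ⊇ Δ`: condition the configuration to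
equal `σ` on `Δ`, without normalization, and replace it there by counting measure. -/
def swapMeasure (ν : Measure (Config d q)) (Δ : Finset (Site d)) (σ : Δ → Fin q) :
    Measure (Config d q) :=
  ∑ a : Δ → Fin q, (ν.restrict (cyl Δ σ)).map fun ζ => Function.updateFinset ζ Δ a

section Swap

variable (ν : Measure (Config d q)) [IsFiniteMeasure ν] (Δ : Finset (Site d)) (σ : Δ → Fin q)

instance : IsFiniteMeasure (swapMeasure ν Δ σ) := by
  unfold swapMeasure; infer_instance

theorem swapMeasure_real_apply {A : Set (Config d q)} (hA : MeasurableSet A) :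
    (swapMeasure ν Δ σ).real A
      = ∑ a : Δ → Fin q, ν.real ((fun ζ => Function.updateFinset ζ Δ a) ⁻¹' A ∩ cyl Δ σ) := by
  rw [swapMeasure, Measure.real, Measure.finsetSum_apply, ENNReal.toReal_sum]
  · refine Finset.sum_congr rfl fun a _ => ?_
    have hm := (continuous_updateFinset (q := q) Δ a).measurable
    rw [Measure.map_apply hm hA, Measure.restrict_apply (hm hA), Measure.real]
  · exact fun a _ => measure_ne_top _ _

theorem prob_swapMeasure {Λ : Finset (Site d)} (h : Δ ⊆ Λ) (η : Config d q) :
    prob (swapMeasure ν Δ σ) Λ η = prob ν Λ (Function.updateFinset η Δ σ) := by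
  rw [prob, swapMeasure_real_apply _ _ _ (measurableSet_cyl _ _),
    Finset.sum_eq_single (Δ.restrict η)]
  · rw [prob]
    congr 1
    ext ζ
    rw [Set.mem_inter_iff, Set.mem_preimage, mem_cyl_restrict, mem_cyl_restrict]
    constructor
    · rintro ⟨h1, h2⟩ x hx
      by_cases hxΔ : x ∈ Δ
      · rw [updateFinset_of_mem _ _ hxΔ, ← h2]; rfl
      · have := h1 x hx
        rwa [updateFinset_of_notMem _ _ hxΔ] at this ⊢
    · intro h1
      refine ⟨fun x hx => ?_, ?_⟩
      · by_cases hxΔ : x ∈ Δ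
        · rw [updateFinset_of_mem _ _ hxΔ]; rfl
        · have := h1 x hx
          rwa [updateFinset_of_notMem _ _ hxΔ] at this ⊢
      · funext x
        have := h1 x (h x.2)
        rwa [updateFinset_of_mem _ _ x.2] at this
  · intro a _ ha
    rw [show (fun ζ => Function.updateFinset ζ Δ a) ⁻¹' cyl Λ (Λ.restrict η) ∩ cyl Δ σ = ∅ from ?_,
      measureReal_empty]
    refine Set.eq_empty_of_forall_notMem fun ζ hζ => ha ?_
    funext x
    have : Function.updateFinset ζ Δ a x = η x := mem_cyl_restrict.1 hζ.1 x (h x.2)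
    rwa [updateFinset_of_mem _ _ x.2] at this
  · simp

variable {ν} in
theorem ChargesCylinders.swapMeasure (hν : ChargesCylinders ν) :
    ChargesCylinders (swapMeasure ν Δ σ) := fun Λ η => by
  refine lt_of_lt_of_le ?_ (prob_anti _ (Finset.subset_union_left (s₂ := Δ)) η)
  rw [prob_swapMeasure ν Δ σ (Λ := Λ ∪ Δ) Finset.subset_union_right]
  exact hν _ _

theorem swapMeasure_real_univ_le [IsProbabilityMeasure ν] :
    (swapMeasure ν Δ σ).real Set.univ ≤ (q : ℝ) ^ Δ.card := by
  rw [swapMeasure_real_apply _ _ _ MeasurableSet.univ]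
  refine (Finset.sum_le_card_nsmul _ _ 1 fun a _ => measureReal_le_one).trans ?_
  simp

end Swap

/-- The logarithmic ratio of cylinder probabilities before and after a transition, weighted with a
bounded nonnegative function, is bounded above uniformly in the volume. -/
theorem integral_mul_logProb_update_sub_le {ν : Measure (Config d q)} [IsProbabilityMeasure ν]
    (hν : ChargesCylinders ν) (Λ Δ : Finset (Site d)) (σ : Δ → Fin q) {r : Config d q → ℝ}
    (hr : Continuous r) {M : ℝ} (h0 : ∀ η, 0 ≤ r η) (hM : ∀ η, r η ≤ M) :
    ∫ η, r η * (logProb ν Λ (Function.updateFinset η Δ σ) - logProb ν Λ η) ∂ν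
      ≤ M * (q : ℝ) ^ Δ.card := by
  obtain ⟨η₀⟩ : Nonempty (Config d q) := nonempty_of_isProbabilityMeasure ν
  have hq : (1 : ℝ) ≤ q := by exact_mod_cast (Fin.pos (η₀ 0))
  have hM0 := (h0 η₀).trans (hM η₀)
  -- only the part of the transition inside of `Λ` matters
  let σ' : (Δ ∩ Λ : Finset (Site d)) → Fin q := fun x => σ ⟨x, (Finset.mem_inter.1 x.2).1⟩
  have e : ∀ η, logProb ν Λ (Function.updateFinset η Δ σ)
      = logProb (swapMeasure ν (Δ ∩ Λ) σ') Λ η := by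
    intro η
    rw [logProb, logProb, prob_swapMeasure _ _ _ Finset.inter_subset_right]
    congr 1
    refine dependsOn_prob ν Λ fun x hx => ?_
    have hx : x ∈ Λ := hx
    by_cases hxΔ : x ∈ Δ
    · rw [updateFinset_of_mem _ _ hxΔ, updateFinset_of_mem _ _ (Finset.mem_inter.2 ⟨hxΔ, hx⟩)]
    · rw [updateFinset_of_notMem _ _ hxΔ,
        updateFinset_of_notMem _ _ fun h => hxΔ (Finset.mem_inter.1 h).1]
  simp only [e]
  refine (integral_mul_logProb_sub_le (hν.swapMeasure _ _) hν Λ hr h0 hM).trans ?_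
  refine mul_le_mul_of_nonneg_left ((swapMeasure_real_univ_le _ _ _).trans ?_) hM0
  exact pow_le_pow_right₀ hq (Finset.card_le_card Finset.inter_subset_left)

/-! ### The entropy loss per site -/

/-- The contribution of the site `i` to `ν(L log κ(·_Λ))`. For `κ = ν` this is an entropy loss, for
the stationary measure `κ = μ` it is minus an energy loss. -/
def siteLoss (c : JumpRates d q) (Γ : Finset (Site d)) (ν κ : Measure (Config d q))
    (Λ : Finset (Site d)) (i : Site d) : ℝ :=
  ∫ η, c.siteGen Γ i (logProb κ Λ) η ∂ν

section SiteLoss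

variable {c : JumpRates d q} {Γ : Finset (Site d)}

theorem siteLoss_shift (hc : c.IsTranslationInvariant) {ν κ : ProbabilityMeasure (Config d q)}
    (hν : IsTranslationInvariant ν) (hκ : IsTranslationInvariant κ) (Λ : Finset (Site d))
    (i j : Site d) : siteLoss c Γ ν κ (translate j Λ) (i + j) = siteLoss c Γ ν κ Λ i := by
  rw [siteLoss, ← hν.integral_shift j (c.continuous_siteGen Γ _ (continuous_logProb _ _)), siteLoss]
  refine integral_congr_ae (ae_of_all _ fun η => ?_)
  simp only
  rw [hc.siteGen_shift]
  simp only [hκ.logProb_shift]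

theorem siteLoss_eq_zero_site (hc : c.IsTranslationInvariant)
    {ν κ : ProbabilityMeasure (Config d q)} (hν : IsTranslationInvariant ν)
    (hκ : IsTranslationInvariant κ) (Λ : Finset (Site d)) (i : Site d) :
    siteLoss c Γ ν κ Λ i = siteLoss c Γ ν κ (translate (-i) Λ) 0 := by
  rw [← siteLoss_shift hc hν hκ Λ i (-i), add_neg_cancel]

theorem continuous_transition (c : JumpRates d q) (Δ : Finset (Site d)) (ξ : Δ → Fin q)
    {f : Config d q → ℝ} (hf : Continuous f) :
    Continuous fun η => c.rate Δ η ξ * (f (Function.updateFinset η Δ ξ) - f η) :=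
  (c.continuous Δ ξ).mul ((hf.comp (continuous_updateFinset Δ ξ)).sub hf)

theorem integral_jump (c : JumpRates d q) (m : Measure (Config d q)) [IsFiniteMeasure m]
    (Δ : Finset (Site d)) {f : Config d q → ℝ} (hf : Continuous f) :
    ∫ η, c.jump Δ f η ∂m = ∑ ξ : Δ → Fin q,
      ∫ η, c.rate Δ η ξ * (f (Function.updateFinset η Δ ξ) - f η) ∂m :=
  integral_finsetSum _ fun ξ _ => integrable_of_continuous m (continuous_transition c Δ ξ hf)

theorem integral_siteGen (c : JumpRates d q) (Γ : Finset (Site d)) (m : Measure (Config d q))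
    [IsFiniteMeasure m] (i : Site d) {f : Config d q → ℝ} (hf : Continuous f) :
    ∫ η, c.siteGen Γ i f η ∂m = ∑ Δ ∈ JumpRates.reps Γ,
      (Δ.card : ℝ)⁻¹ * ∫ η, c.jump (translate i Δ) f η ∂m := by
  simp only [JumpRates.siteGen]
  rw [integral_finsetSum]
  · exact Finset.sum_congr rfl fun Δ _ => integral_const_mul _ _
  · exact fun Δ _ => (integrable_of_continuous m (c.continuous_jump _ hf)).const_mul _

theorem siteLoss_zero_eq (c : JumpRates d q) (Γ : Finset (Site d)) (ν κ : Measure (Config d q))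
    [IsFiniteMeasure ν] (Λ : Finset (Site d)) :
    siteLoss c Γ ν κ Λ 0 = ∑ Δ ∈ JumpRates.reps Γ, (Δ.card : ℝ)⁻¹ * ∑ ξ : Δ → Fin q,
      ∫ η, c.rate Δ η ξ * (logProb κ Λ (Function.updateFinset η Δ ξ) - logProb κ Λ η) ∂ν := by
  rw [siteLoss, integral_siteGen _ _ _ _ (continuous_logProb κ Λ)]
  refine Finset.sum_congr rfl fun Δ _ => ?_
  rw [translate_zero, integral_jump _ _ _ (continuous_logProb κ Λ)]

/-- Sum of a constant per transition with the weights of `siteLoss`. -/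
theorem sum_reps_const_bound (X : (Δ : Finset (Site d)) → (Δ → Fin q) → ℝ) (B : Finset (Site d) → ℝ)
    (h : ∀ Δ ∈ JumpRates.reps Γ, ∀ ξ, X Δ ξ ≤ B Δ) :
    ∑ Δ ∈ JumpRates.reps Γ, (Δ.card : ℝ)⁻¹ * ∑ ξ : Δ → Fin q, X Δ ξ
      ≤ ∑ Δ ∈ JumpRates.reps Γ, (Δ.card : ℝ)⁻¹ * ((q : ℝ) ^ Δ.card * B Δ) := by
  refine Finset.sum_le_sum fun Δ hΔ => mul_le_mul_of_nonneg_left ?_ (by positivity)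
  refine (Finset.sum_le_card_nsmul _ _ _ fun ξ _ => h Δ hΔ ξ).trans_eq ?_
  simp

/-- The entropy loss per site is bounded above, uniformly in the measure and the volume. -/
theorem exists_siteLoss_le (hc : c.IsTranslationInvariant) (Γ : Finset (Site d)) :
    ∃ C, 0 ≤ C ∧ ∀ ν : ProbabilityMeasure (Config d q), IsTranslationInvariant ν →
      ChargesCylinders (ν : Measure (Config d q)) → ∀ Λ i, siteLoss c Γ ν ν Λ i ≤ C := by
  obtain ⟨M, hM0, hM⟩ := JumpRates.exists_rate_le (c := c) Γ
  refine ⟨∑ Δ ∈ JumpRates.reps Γ, (Δ.card : ℝ)⁻¹ * ((q : ℝ) ^ Δ.card * (M * (q : ℝ) ^ Δ.card)),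
    by positivity, fun ν hν hpos Λ i => ?_⟩
  rw [siteLoss_eq_zero_site hc hν hν, siteLoss_zero_eq]
  exact sum_reps_const_bound _ _ fun Δ hΔ ξ =>
    integral_mul_logProb_update_sub_le hpos _ _ _ (c.continuous Δ ξ) (c.nonneg Δ · ξ) (hM Δ hΔ · ξ)

/-- The rates are multiplicatively close to functions of the coordinates in a large cube: uniform
continuity gives this up to an additive error, which the minimal rate dominates. -/
theorem exists_local_rate (hcont : c.IsUniformlyContinuous) (hmin : c.HasMinimalRate)
    (Γ : Finset (Site d)) {ε : ℝ} (hε : 0 < ε) (hε1 : ε ≤ 1 / 2) (η₀ : Config d q) :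
    ∃ m₀ : ℕ, ∀ m : ℕ, m₀ ≤ m → ∀ Δ ∈ JumpRates.reps Γ, ∀ (η : Config d q) (ξ : Δ → Fin q),
      (1 - ε) * c.rate Δ (Function.updateFinset η₀ (box d m) ((box d m).restrict η)) ξ
          ≤ c.rate Δ η ξ ∧
        c.rate Δ η ξ
          ≤ (1 + ε) * c.rate Δ (Function.updateFinset η₀ (box d m) ((box d m).restrict η)) ξ := by
  choose δ hδ0 hδ using hmin
  have hex : ∃ δ₀ : ℝ, 0 < δ₀ ∧ ∀ Δ ∈ JumpRates.reps Γ, δ₀ ≤ δ Δ := by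
    rcases (JumpRates.reps Γ).eq_empty_or_nonempty with h | h
    · exact ⟨1, one_pos, by simp [h]⟩
    · exact ⟨(JumpRates.reps Γ).inf' h δ, (Finset.lt_inf'_iff h).2 fun Δ _ => hδ0 Δ,
        fun Δ hΔ => Finset.inf'_le _ hΔ⟩
  obtain ⟨δ₀, hδ₀, hδΔ⟩ := hex
  obtain ⟨Λ₀, hΛ₀⟩ := hcont (ε * δ₀) (by positivity)
  obtain ⟨m₀, hm₀⟩ := exists_subset_box Λ₀
  refine ⟨m₀, fun m hm Δ hΔ η ξ => ?_⟩
  have h1 := abs_le.1 (hΛ₀ (box d m) (hm₀.trans (box_mono (by exact_mod_cast hm))) Δ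
    (JumpRates.mem_reps.1 hΔ).2 η η₀ ξ)
  set a := c.rate Δ (Function.updateFinset η₀ (box d m) ((box d m).restrict η)) ξ with ha
  have ha0 : 0 ≤ a := c.nonneg _ _ _
  have hb0 := c.nonneg Δ η ξ
  have hda := hδΔ Δ hΔ
  rcases ha0.eq_or_lt with h0 | hpos
  · rcases hb0.eq_or_lt with h0' | hpos'
    · rw [← h0, ← h0']; simp
    · have := hδ Δ η ξ hpos'
      nlinarith
  · have := hδ Δ _ ξ hpos
    have h2 : ε * δ₀ ≤ ε * a := mul_le_mul_of_nonneg_left (by linarith) hε.le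
    constructor <;> linarith

/-- The entropy loss per site is almost decreasing in the volume. -/
theorem exists_siteLoss_le_siteLoss (hcont : c.IsUniformlyContinuous) (hmin : c.HasMinimalRate) (Γ : Finset (Site d)) :
    ∃ C, 0 ≤ C ∧ ∀ ε, 0 < ε → ε ≤ 1 / 2 → ∃ m₀ : ℕ, ∀ m : ℕ, m₀ ≤ m → ∀ V Λ : Finset (Site d),
      box d m ⊆ V → V ⊆ Λ → ∀ ν : ProbabilityMeasure (Config d q),
      ChargesCylinders (ν : Measure (Config d q)) →
      siteLoss c Γ ν ν Λ 0 ≤ (1 - ε) / (1 + ε) * siteLoss c Γ ν ν V 0 + ε * C := by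
  rcases isEmpty_or_nonempty (Config d q) with he | ⟨⟨η₀⟩⟩
  · refine ⟨0, le_rfl, fun ε _ _ => ⟨0, fun m _ V Λ _ _ ν => ?_⟩⟩
    obtain ⟨η⟩ : Nonempty (Config d q) :=
      nonempty_of_isProbabilityMeasure (ν : Measure (Config d q))
    exact he.elim η
  obtain ⟨M, hM0, hM⟩ := JumpRates.exists_rate_le (c := c) Γ
  obtain ⟨R, hR⟩ := exists_subset_box Γ
  refine ⟨∑ Δ ∈ JumpRates.reps Γ, (Δ.card : ℝ)⁻¹ *
    ((q : ℝ) ^ Δ.card * (4 * (M * (q : ℝ) ^ Δ.card))), by positivity, fun ε hε hε1 => ?_⟩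
  obtain ⟨m₀, hm₀⟩ := exists_local_rate hcont hmin Γ hε hε1 η₀
  refine ⟨max m₀ R, fun m hm V Λ hmV hVΛ ν hν => ?_⟩
  have key := sum_reps_const_bound (Γ := Γ) (fun (Δ : Finset (Site d)) (ξ : Δ → Fin q) =>
    ∫ η, c.rate Δ η ξ * (logProb ν Λ (Function.updateFinset η Δ ξ) - logProb ν Λ η)
        ∂(ν : Measure (Config d q))
      - (1 - ε) / (1 + ε) * ∫ η, c.rate Δ η ξ *
        (logProb ν V (Function.updateFinset η Δ ξ) - logProb ν V η) ∂(ν : Measure (Config d q)))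
    (fun Δ => ε * (4 * (M * (q : ℝ) ^ Δ.card))) ?_
  · rw [siteLoss_zero_eq, siteLoss_zero_eq]
    refine (sub_le_iff_le_add'.1 (le_trans (le_of_eq ?_) (key.trans (le_of_eq ?_))))
    · rw [Finset.mul_sum, ← Finset.sum_sub_distrib]
      refine Finset.sum_congr rfl fun Δ _ => ?_
      rw [Finset.sum_sub_distrib, ← Finset.mul_sum]
      ring
    · rw [Finset.mul_sum]
      exact Finset.sum_congr rfl fun Δ _ => by ring
  · intro Δ hΔ ξ
    have hΔV : Δ ⊆ V := ((JumpRates.mem_reps.1 hΔ).1.trans hR).trans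
      ((box_mono (by exact_mod_cast (le_max_right m₀ R).trans hm)).trans hmV)
    have e : ∀ W, Δ ⊆ W → ∀ η, logProb ν W (Function.updateFinset η Δ ξ)
        = logProb (swapMeasure ν Δ ξ) W η := fun W hW η => by
      rw [logProb, logProb, prob_swapMeasure _ _ _ hW]
    simp only [e V hΔV, e Λ (hΔV.trans hVΛ)]
    have hloc : DependsOn (fun η : Config d q => c.rate Δ
        (Function.updateFinset η₀ (box d m) ((box d m).restrict η)) ξ) (V : Set (Site d)) := by
      intro η ζ h
      simp only [cyl_restrict_congr (Λ := box d m) fun x hx => h x (hmV hx)]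
    have h := integral_mul_logProb_sub_le_of_approx (hν.swapMeasure Δ ξ) hν hVΛ
      (c.continuous Δ ξ) hloc (fun η => c.nonneg _ _ _) (M := M) (ε := ε) (fun η => hM Δ hΔ _ _)
      hε.le (by linarith) (fun η => (hm₀ m ((le_max_left _ _).trans hm) Δ hΔ η ξ).1)
      (fun η => (hm₀ m ((le_max_left _ _).trans hm) Δ hΔ η ξ).2)
    have h' : 4 * ε * (M * (swapMeasure (ν : Measure (Config d q)) Δ ξ).real Set.univ)
        ≤ ε * (4 * (M * (q : ℝ) ^ Δ.card)) := by
      have := mul_le_mul_of_nonneg_left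
        (swapMeasure_real_univ_le (ν : Measure (Config d q)) Δ ξ) hM0
      nlinarith
    linarith

/-- The finite-volume approximated entropy loss as a real number. -/
def entropyLoss (c : JumpRates d q) (Γ : Finset (Site d)) (ν : Measure (Config d q)) (n : ℕ) : ℝ :=
  ((bigBox d n).card : ℝ)⁻¹ * ∑ i ∈ innerBox d n, siteLoss c Γ ν ν (bigBox d n) i

theorem lt_two_pow_int (m : ℕ) : (m : ℤ) + 1 ≤ 2 ^ m := by exact_mod_cast Nat.lt_two_pow_self

theorem card_innerBox_pos (d m : ℕ) : (0 : ℝ) < (innerBox d m).card :=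
  card_box_pos (by have := lt_two_pow_int m; linarith)

theorem card_bigBox_pos (d m : ℕ) : (0 : ℝ) < (bigBox d m).card :=
  card_box_pos (by have := lt_two_pow_int m; linarith)

/-- The entropy loss of a site deep inside of a large volume is almost dominated by the average over
the inner sites of a cube: the volume contains all the translates of this cube in which the
given site is an inner one. -/
theorem exists_siteLoss_le_entropyLoss (hc : c.IsTranslationInvariant)
    (hcont : c.IsUniformlyContinuous) (hmin : c.HasMinimalRate) (Γ : Finset (Site d)) :
    ∃ C, 0 ≤ C ∧ ∀ ε, 0 < ε → ε ≤ 1 / 2 → ∃ m₀ : ℕ, ∀ m : ℕ, m₀ ≤ m →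
      ∀ (Λ : Finset (Site d)) (i : Site d), translate i (box d (2 ^ (m + 1))) ⊆ Λ →
      ∀ ν : ProbabilityMeasure (Config d q), IsTranslationInvariant ν →
      ChargesCylinders (ν : Measure (Config d q)) →
      siteLoss c Γ ν ν Λ i ≤ (1 - ε) / (1 + ε) *
        (((bigBox d m).card : ℝ) / (innerBox d m).card * entropyLoss c Γ ν m) + ε * C := by
  obtain ⟨C, hC0, hC⟩ := exists_siteLoss_le_siteLoss hcont hmin Γ
  refine ⟨C, hC0, fun ε hε hε1 => ?_⟩
  obtain ⟨m₀, hm₀⟩ := hC ε hε hε1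
  refine ⟨m₀, fun m hm Λ i hi ν hν hpos => ?_⟩
  have hI := card_innerBox_pos d m
  have hB := card_bigBox_pos d m
  have h2 := lt_two_pow_int m
  have h2' : (2 : ℤ) ^ (m + 1) = 2 * 2 ^ m := by ring
  have key : ∀ k ∈ innerBox d m, siteLoss c Γ ν ν Λ i
      ≤ (1 - ε) / (1 + ε) * siteLoss c Γ ν ν (bigBox d m) k + ε * C := by
    intro k hk
    rw [siteLoss_eq_zero_site hc hν hν Λ i, siteLoss_eq_zero_site hc hν hν (bigBox d m) k]
    refine hm₀ m hm _ _ (fun x hx => ?_) (fun x hx => ?_) ν hpos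
    · rw [mem_translate, bigBox, mem_box]
      intro j
      have h3 := mem_box.1 hx j
      have h4 := mem_box.1 hk j
      simp only [Pi.sub_apply, Pi.neg_apply]
      constructor <;> linarith
    · rw [mem_translate, bigBox, mem_box] at hx
      rw [mem_translate]
      refine hi (mem_translate.2 (mem_box.2 fun j => ?_))
      have h3 := hx j
      have h4 := mem_box.1 hk j
      simp only [Pi.sub_apply, Pi.neg_apply] at h3 ⊢
      constructor <;> linarith
  have hsum := Finset.sum_le_sum key
  rw [Finset.sum_const, nsmul_eq_mul, Finset.sum_add_distrib, Finset.sum_const, nsmul_eq_mul,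
    ← Finset.mul_sum] at hsum
  have e : ((bigBox d m).card : ℝ) / (innerBox d m).card * entropyLoss c Γ ν m
      = ((innerBox d m).card : ℝ)⁻¹ * ∑ k ∈ innerBox d m, siteLoss c Γ ν ν (bigBox d m) k := by
    rw [entropyLoss]; field_simp
  rw [e]
  refine le_of_mul_le_mul_left (hsum.trans (le_of_eq ?_)) hI
  field_simp

end SiteLoss

/-! ### The approximated entropy loss as a real number -/

theorem eintegral_coe (ν : Measure (Config d q)) [IsFiniteMeasure ν] {f : Config d q → ℝ}
    (hf : Continuous f) : eintegral ν (fun η => (f η : EReal)) = ((∫ η, f η ∂ν : ℝ) : EReal) := by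
  have hi := integrable_of_continuous ν hf
  rw [integral_eq_lintegral_pos_part_sub_lintegral_neg_part hi, eintegral, EReal.coe_sub]
  simp only [← EReal.coe_neg, EReal.real_coe_toENNReal]
  have h1 : ∫⁻ η, ENNReal.ofReal (f η) ∂ν ≠ ⊤ := hi.lintegral_lt_top.ne
  have h2 : ∫⁻ η, ENNReal.ofReal (-f η) ∂ν ≠ ⊤ := hi.neg.lintegral_lt_top.ne
  rw [EReal.coe_ennreal_toReal h1, EReal.coe_ennreal_toReal h2]

theorem cyl_inter_cyl {Λ Δ : Finset (Site d)} (ζ : Config d q) :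
    cyl (Λ \ Δ) ((Λ \ Δ).restrict ζ) ∩ cyl (Δ ∩ Λ) ((Δ ∩ Λ).restrict ζ)
      = cyl Λ (Λ.restrict ζ) := by
  ext η
  simp only [Set.mem_inter_iff, mem_cyl_restrict, Finset.mem_sdiff, Finset.mem_inter]
  constructor
  · rintro ⟨h1, h2⟩ x hx
    by_cases hxΔ : x ∈ Δ
    · exact h2 x ⟨hxΔ, hx⟩
    · exact h1 x ⟨hx, hxΔ⟩
  · exact fun h => ⟨fun x hx => h x hx.1, fun x hx => h x hx.2⟩

theorem logRatio_eq (ν : Measure (Config d q)) [IsFiniteMeasure ν] (hν : ChargesCylinders ν)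
    (Λ Δ : Finset (Site d)) (σ : Δ → Fin q) (η : Config d q) :
    logRatio ν Λ Δ σ η
      = ((logProb ν Λ (Function.updateFinset η Δ σ) - logProb ν Λ η : ℝ) : EReal) := by
  set ζ := Function.updateFinset η Δ σ
  have hoff : (Λ \ Δ).restrict η = (Λ \ Δ).restrict ζ := cyl_restrict_congr fun x hx =>
    (updateFinset_of_notMem _ _ (Finset.mem_sdiff.1 hx).2).symm
  have hB : ν (cyl (Λ \ Δ) ((Λ \ Δ).restrict η)) ≠ 0 := fun h => by
    have := hν (Λ \ Δ) η
    rw [prob, Measure.real, h] at this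
    simp at this
  have e1 : ν (cyl (Λ \ Δ) ((Λ \ Δ).restrict η) ∩ cyl (Δ ∩ Λ) ((Δ ∩ Λ).restrict ζ))
      = ENNReal.ofReal (prob ν Λ ζ) := by
    rw [hoff, cyl_inter_cyl, prob, ofReal_measureReal]
  have e2 : ν (cyl (Λ \ Δ) ((Λ \ Δ).restrict η) ∩ cyl (Δ ∩ Λ) ((Δ ∩ Λ).restrict η))
      = ENNReal.ofReal (prob ν Λ η) := by
    rw [cyl_inter_cyl, prob, ofReal_measureReal]
  rw [logRatio, cond_apply (measurableSet_cyl _ _), cond_apply (measurableSet_cyl _ _), e1, e2,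
    ENNReal.mul_div_mul_left _ _ (ENNReal.inv_ne_zero.2 (measure_ne_top _ _))
      (ENNReal.inv_ne_top.2 hB),
    ← ENNReal.ofReal_div_of_pos (hν Λ η), ENNReal.log_ofReal_of_pos (div_pos (hν Λ ζ) (hν Λ η)),
    Real.log_div (hν Λ ζ).ne' (hν Λ η).ne']
  rfl

theorem coe_finset_sum {α : Type*} (s : Finset α) (f : α → ℝ) :
    ((∑ a ∈ s, f a : ℝ) : EReal) = ∑ a ∈ s, (f a : EReal) := by
  classical
  induction s using Finset.induction_on with
  | empty => simp
  | insert a s ha ih => rw [Finset.sum_insert ha, Finset.sum_insert ha, EReal.coe_add, ih]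

/-- If `ν` charges all cylinder events, no infinite value occurs in the approximated entropy
loss. -/
theorem approxEntropyLoss_eq {c : JumpRates d q} {Γ : Finset (Site d)}
    (hΓ : c.HasTransitionsIn Γ) (hc : c.IsTranslationInvariant) (ν : Measure (Config d q))
    [IsFiniteMeasure ν] (hν : ChargesCylinders ν) (n : ℕ) :
    approxEntropyLoss c ν n = (entropyLoss c Γ ν n : EReal) := by
  rw [approxEntropyLoss, entropyLoss, EReal.coe_mul, coe_finset_sum]
  congr 1
  refine Finset.sum_congr rfl fun i _ => ?_
  set f := logProb ν (bigBox d n) with hf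
  have hfc : Continuous f := continuous_logProb ν _
  let g : Finset (Site d) → ℝ := fun Δ => (Δ.card : ℝ)⁻¹ * ∫ η, c.jump Δ f η ∂ν
  have hterm : ∀ Δ : {Δ : Finset (Site d) // i ∈ Δ}, ∑ σ : Δ.1 → Fin q,
      (((Δ.1.card : ℝ)⁻¹ : ℝ) : EReal) *
        eintegral ν (fun η => (c.rate Δ.1 η σ : EReal) * logRatio ν (bigBox d n) Δ.1 σ η)
      = ((g Δ.1 : ℝ) : EReal) := by
    intro Δ
    simp only [g]
    rw [integral_jump c ν Δ.1 hfc, Finset.mul_sum, coe_finset_sum]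
    refine Finset.sum_congr rfl fun σ _ => ?_
    rw [EReal.coe_mul, ← eintegral_coe ν (continuous_transition c Δ.1 σ hfc)]
    congr 2
    funext η
    rw [logRatio_eq ν hν, EReal.coe_mul]
  have hzero : ∀ Δ, i ∈ Δ → ¬ Δ ⊆ translate i Γ → g Δ = 0 := by
    intro Δ hi h
    simp only [g]
    rw [integral_congr_ae (ae_of_all _ fun η => hΓ.jump_eq_zero hc hi h f η)]
    simp
  rw [tsum_congr hterm, tsum_eq_sum (s := (translate i Γ).powerset.subtype fun Δ => i ∈ Δ),
    Finset.sum_subtype_eq_sum_filter (fun Δ => ((g Δ : ℝ) : EReal)),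
    ← coe_finset_sum, JumpRates.sum_reps_translate (Γ := Γ) (i := i)]
  · rw [siteLoss, integral_siteGen c Γ ν i hfc]
    congr 1
    exact Finset.sum_congr rfl fun Δ _ => by simp only [g, card_translate]
  · exact fun Δ hΔ => (Finset.mem_filter.1 hΔ).2
  · exact fun Δ hΔ h => hzero Δ (Finset.mem_filter.1 hΔ).2 h
  · exact fun Δ hi hs hn =>
      absurd (Finset.mem_filter.2 ⟨Finset.mem_powerset.2 hs, hi⟩) hn
  · intro Δ hΔ
    rw [hzero Δ.1 Δ.2 fun h => hΔ (Finset.mem_subtype.2 (Finset.mem_powerset.2 h)), EReal.coe_zero]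

/-! ### Gibbs measures: positivity and quasilocality of cylinder probabilities -/

/-- Events in the sigma-algebra of the coordinates in `S` do not depend on the other ones. -/
theorem mem_iff_of_measurableSet_cylinderEvents {S : Set (Site d)} {A : Set (Config d q)}
    (hA : MeasurableSet[cylinderEvents S] A) {η ζ : Config d q} (h : ∀ x ∈ S, η x = ζ x) :
    η ∈ A ↔ ζ ∈ A := by
  have hle : cylinderEvents (X := fun _ : Site d => Fin q) S
      ≤ MeasurableSpace.comap (fun (η : Config d q) (x : S) => η x) ⊤ := by
    refine iSup₂_le fun x hx => ?_
    rintro B ⟨D, -, rfl⟩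
    exact ⟨{ω | ω ⟨x, hx⟩ ∈ D}, trivial, rfl⟩
  obtain ⟨B, -, rfl⟩ := hle A hA
  have : (fun x : S => η x) = fun x : S => ζ x := funext fun x => h x x.2
  rw [Set.mem_preimage, Set.mem_preimage, this]

theorem measurableSet_cylinderEvents_cyl {S : Set (Site d)} {Λ : Finset (Site d)}
    (h : (Λ : Set (Site d)) ⊆ S) (η : Config d q) :
    MeasurableSet[cylinderEvents S] (cyl Λ (Λ.restrict η)) := by
  have : cyl Λ (Λ.restrict η) = ⋂ x ∈ Λ, (fun ζ : Config d q => ζ x) ⁻¹' {η x} := by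
    ext ζ
    simp only [mem_cyl_restrict, Set.mem_iInter, Set.mem_preimage, Set.mem_singleton_iff]
  rw [this]
  refine MeasurableSet.biInter Λ.countable_toSet fun x hx => ?_
  exact measurable_cylinderEvent_apply (h hx) (measurableSet_singleton _)

namespace Specification

variable {γ : Specification d q}

instance (Λ : Finset (Site d)) (η : Config d q) : IsProbabilityMeasure (γ.kernel Λ η) :=
  γ.isMarkov Λ η

theorem kernel_congr (γ : Specification d q) {Λ : Finset (Site d)} {η ζ : Config d q}
    (h : ∀ x ∉ Λ, η x = ζ x) : γ.kernel Λ η = γ.kernel Λ ζ := by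
  refine Measure.ext fun A hA => ?_
  have hm : Measurable[cylinderEvents ((Λ : Set (Site d))ᶜ)] fun ξ => γ.kernel Λ ξ A :=
    (γ.kernel Λ).measurable_coe hA
  have := (mem_iff_of_measurableSet_cylinderEvents (hm (measurableSet_singleton (γ.kernel Λ ζ A)))
    (η := η) (ζ := ζ) fun x hx => h x hx).2 rfl
  exact this

theorem measurable_prob (γ : Specification d q) (Λ : Finset (Site d)) (σ : Λ → Fin q) :
    Measurable (γ.prob Λ σ) :=
  ((γ.kernel Λ).measurable_coe (measurableSet_cyl Λ σ)).mono cylinderEvents_le_pi le_rfl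
    |>.ennreal_toReal

theorem prob_nonneg (γ : Specification d q) (Λ : Finset (Site d)) (σ : Λ → Fin q)
    (η : Config d q) : 0 ≤ γ.prob Λ σ η := measureReal_nonneg

theorem prob_le_one (γ : Specification d q) (Λ : Finset (Site d)) (σ : Λ → Fin q)
    (η : Config d q) : γ.prob Λ σ η ≤ 1 := measureReal_le_one

/-- The conditional probabilities `γ_Δ(η_Δ | ·)`, averaged over the configurations that agree with
`η` on `Λ ∖ Δ`. -/
theorem IsGibbs.prob_eq_setIntegral {μ : ProbabilityMeasure (Config d q)} (hμ : γ.IsGibbs μ)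
    {Δ Λ : Finset (Site d)} (h : Δ ⊆ Λ) (η : Config d q) :
    IPS.prob μ Λ η
      = ∫ ξ in cyl (Λ \ Δ) ((Λ \ Δ).restrict η), γ.prob Δ (Δ.restrict η) ξ
          ∂(μ : Measure (Config d q)) := by
  have hB : MeasurableSet[cylinderEvents ((Δ : Set (Site d))ᶜ)]
      (cyl (Λ \ Δ) ((Λ \ Δ).restrict η)) :=
    measurableSet_cylinderEvents_cyl (fun x hx => (Finset.mem_sdiff.1 hx).2) η
  have h1 := (γ.proper Δ).setLIntegral_eq_comp cylinderEvents_le_pi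
    (μ := (μ : Measure (Config d q))) (measurableSet_cyl Δ (Δ.restrict η)) hB
  rw [hμ Δ, Set.inter_comm] at h1
  have h2 : cyl (Λ \ Δ) ((Λ \ Δ).restrict η) ∩ cyl Δ (Δ.restrict η) = cyl Λ (Λ.restrict η) := by
    have := cyl_inter_cyl (Λ := Λ) (Δ := Δ) η
    rwa [Finset.inter_eq_left.2 h] at this
  rw [h2] at h1
  rw [IPS.prob, Measure.real, ← h1, ← integral_toReal]
  · rfl
  · exact (((γ.kernel Δ).measurable_coe (measurableSet_cyl Δ _)).mono cylinderEvents_le_pi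
      le_rfl).aemeasurable
  · exact ae_of_all _ fun ξ => measure_lt_top _ _

theorem integrable_prob (γ : Specification d q) (m : Measure (Config d q)) [IsFiniteMeasure m]
    (Λ : Finset (Site d)) (σ : Λ → Fin q) : Integrable (γ.prob Λ σ) m :=
  Integrable.of_bound (γ.measurable_prob Λ σ).aestronglyMeasurable 1
    (ae_of_all _ fun η => by
      rw [Real.norm_of_nonneg (γ.prob_nonneg Λ σ η)]; exact γ.prob_le_one Λ σ η)

theorem IsGibbs.mul_prob_le {μ : ProbabilityMeasure (Config d q)} (hμ : γ.IsGibbs μ)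
    {Δ Λ : Finset (Site d)} (h : Δ ⊆ Λ) (η : Config d q) {a : ℝ}
    (ha : ∀ ξ : Config d q, (∀ x ∈ Λ \ Δ, ξ x = η x) → a ≤ γ.prob Δ (Δ.restrict η) ξ) :
    a * IPS.prob μ (Λ \ Δ) η ≤ IPS.prob μ Λ η := by
  rw [hμ.prob_eq_setIntegral h η]
  have := setIntegral_mono_on (μ := (μ : Measure (Config d q)))
    (integrable_const a).integrableOn (γ.integrable_prob μ Δ (Δ.restrict η)).integrableOn
    (measurableSet_cyl (Λ \ Δ) ((Λ \ Δ).restrict η)) fun ξ hξ => ha ξ (mem_cyl_restrict.1 hξ)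
  rwa [setIntegral_const, smul_eq_mul, mul_comm] at this

theorem IsGibbs.prob_le_mul {μ : ProbabilityMeasure (Config d q)} (hμ : γ.IsGibbs μ)
    {Δ Λ : Finset (Site d)} (h : Δ ⊆ Λ) (η : Config d q) {b : ℝ}
    (hb : ∀ ξ : Config d q, (∀ x ∈ Λ \ Δ, ξ x = η x) → γ.prob Δ (Δ.restrict η) ξ ≤ b) :
    IPS.prob μ Λ η ≤ b * IPS.prob μ (Λ \ Δ) η := by
  rw [hμ.prob_eq_setIntegral h η]
  have := setIntegral_mono_on (μ := (μ : Measure (Config d q)))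
    (γ.integrable_prob μ Δ (Δ.restrict η)).integrableOn (integrable_const b).integrableOn
    (measurableSet_cyl (Λ \ Δ) ((Λ \ Δ).restrict η)) fun ξ hξ => hb ξ (mem_cyl_restrict.1 hξ)
  rwa [setIntegral_const, smul_eq_mul, mul_comm _ b] at this

theorem exists_le_prob_singleton (hγ : γ.IsTranslationInvariant) (h0 : γ.IsNonNull) :
    ∃ δ : ℝ, 0 < δ ∧ δ ≤ 1 ∧ ∀ (x : Site d) (η ξ : Config d q),
      δ ≤ γ.prob {x} (Finset.restrict {x} η) ξ := by
  obtain ⟨δ, hδ, h⟩ := h0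
  refine ⟨min δ 1, lt_min hδ one_pos, min_le_right _ _, fun x η ξ => (min_le_left _ _).trans ?_⟩
  -- the kernel does not see the spin at `x`, so `ξ` may be assumed to agree with `η` there
  set ζ := Function.updateFinset ξ {x} (Finset.restrict {x} η) with hζ
  have e1 : γ.kernel {x} ξ = γ.kernel {x} ζ :=
    γ.kernel_congr fun y hy => (updateFinset_of_notMem _ _ hy).symm
  have e2 : Finset.restrict {x} η = Finset.restrict {x} ζ := (restrict_updateFinset' _ _ _).symm
  have e3 : translate x {0} = {x} := by
    ext y; rw [mem_translate, Finset.mem_singleton, Finset.mem_singleton, sub_eq_zero]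
  have h1 := hγ {0} x (shift (-x) ζ)
  rw [shift_shift_neg, e3] at h1
  rw [prob, e1, e2, h1, map_measureReal_apply (measurable_shift x) (measurableSet_cyl _ _)]
  have h2 : shift x ⁻¹' cyl {x} (Finset.restrict {x} ζ)
      = cyl {0} (Finset.restrict {0} (shift (-x) ζ)) := by
    rw [← shift_preimage_cyl x {0}, shift_shift_neg, e3]
  rw [h2]
  exact h _

/-- A non-null Gibbs measure gives the spins in `Δ` at least an exponentially small conditional
probability, uniformly in the volume. -/
theorem IsGibbs.exists_pow_mul_prob_le {μ : ProbabilityMeasure (Config d q)} (hμ : γ.IsGibbs μ)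
    (hγ : γ.IsTranslationInvariant) (h0 : γ.IsNonNull) :
    ∃ δ : ℝ, 0 < δ ∧ δ ≤ 1 ∧ ∀ (Δ Λ : Finset (Site d)) (η : Config d q),
      δ ^ Δ.card * IPS.prob μ (Λ \ Δ) η ≤ IPS.prob μ Λ η := by
  obtain ⟨δ, hδ, hδ1, h⟩ := exists_le_prob_singleton hγ h0
  refine ⟨δ, hδ, hδ1, fun Δ Λ η => ?_⟩
  induction Δ using Finset.induction_on with
  | empty => simp
  | insert x Δ hx ih =>
    rw [Finset.card_insert_of_notMem hx, pow_succ, mul_assoc]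
    refine (mul_le_mul_of_nonneg_left ?_ (by positivity)).trans ih
    have e : Λ \ insert x Δ = (Λ \ Δ) \ {x} := by
      ext y; simp only [Finset.mem_sdiff, Finset.mem_insert, Finset.mem_singleton]; tauto
    rw [e]
    by_cases hxΛ : x ∈ Λ \ Δ
    · exact hμ.mul_prob_le (Finset.singleton_subset_iff.2 hxΛ) η fun ξ _ => h x η ξ
    · rw [Finset.sdiff_eq_self_of_disjoint (Finset.disjoint_singleton_right.2 hxΛ)]
      exact mul_le_of_le_one_left measureReal_nonneg hδ1

end Specification

theorem prob_empty (μ : ProbabilityMeasure (Config d q)) (η : Config d q) :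
    prob μ ∅ η = 1 := by
  have : cyl ∅ (Finset.restrict ∅ η) = (Set.univ : Set (Config d q)) :=
    Set.eq_univ_of_forall fun ζ => mem_cyl_restrict.2 (by simp)
  rw [prob, this, probReal_univ]

theorem pow_le_prob {μ : ProbabilityMeasure (Config d q)} {δ : ℝ}
    (h : ∀ (Δ Λ : Finset (Site d)) (η : Config d q),
      δ ^ Δ.card * prob μ (Λ \ Δ) η ≤ prob μ Λ η) (Λ : Finset (Site d)) (η : Config d q) :
    δ ^ Λ.card ≤ prob μ Λ η := by
  have := h Λ Λ η
  rwa [Finset.sdiff_self, prob_empty, mul_one] at this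

theorem logProb_sdiff_updateFinset (m : Measure (Config d q)) (Λ Δ : Finset (Site d))
    (η : Config d q) (σ : Δ → Fin q) :
    logProb m (Λ \ Δ) (Function.updateFinset η Δ σ) = logProb m (Λ \ Δ) η :=
  dependsOn_logProb m _ fun _ hx =>
    updateFinset_of_notMem _ _ (Finset.mem_sdiff.1 (Finset.mem_coe.1 hx)).2

/-- A transition in `Δ` changes the energy by at most a multiple of the size of `Δ`. -/
theorem abs_logProb_update_sub_le {μ : ProbabilityMeasure (Config d q)} {δ : ℝ} (hδ : 0 < δ)
    (h : ∀ (Δ Λ : Finset (Site d)) (η : Config d q),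
      δ ^ Δ.card * prob μ (Λ \ Δ) η ≤ prob μ Λ η) (Λ Δ : Finset (Site d)) (σ : Δ → Fin q)
    (η : Config d q) :
    |logProb μ Λ (Function.updateFinset η Δ σ) - logProb μ Λ η| ≤ -(Δ.card * Real.log δ) := by
  have hpos : ∀ Λ η, 0 < prob (μ : Measure (Config d q)) Λ η := fun Λ η =>
    (pow_pos hδ _).trans_le (pow_le_prob h Λ η)
  have h1 : ∀ ζ, Δ.card * Real.log δ + logProb μ (Λ \ Δ) ζ ≤ logProb μ Λ ζ := fun ζ => by
    have := Real.log_le_log (mul_pos (pow_pos hδ _) (hpos _ ζ)) (h Δ Λ ζ)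
    rwa [Real.log_mul (pow_pos hδ _).ne' (hpos _ ζ).ne', Real.log_pow] at this
  have h2 : ∀ ζ, logProb μ Λ ζ ≤ logProb μ (Λ \ Δ) ζ := fun ζ =>
    Real.log_le_log (hpos _ ζ) (prob_anti _ Finset.sdiff_subset ζ)
  have e := logProb_sdiff_updateFinset (μ : Measure (Config d q)) Λ Δ η σ
  have a1 := h1 η
  have a2 := h2 η
  have a3 := h1 (Function.updateFinset η Δ σ)
  have a4 := h2 (Function.updateFinset η Δ σ)
  rw [abs_le]
  constructor <;> linarith

theorem abs_log_sub_log_le {a b g ε κ : ℝ} (hκ : 0 < κ) (ha : κ ≤ a) (hb : κ ≤ b)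
    (hag : |a - g| ≤ ε) (hbg : |b - g| ≤ ε) : |Real.log a - Real.log b| ≤ 2 * ε / κ := by
  have key : ∀ a b : ℝ, κ ≤ a → κ ≤ b → |a - g| ≤ ε → |b - g| ≤ ε →
      Real.log a - Real.log b ≤ 2 * ε / κ := by
    intro a b ha hb hag hbg
    have ha0 := hκ.trans_le ha
    have hb0 := hκ.trans_le hb
    have h1 := Real.log_le_sub_one_of_pos (div_pos ha0 hb0)
    rw [Real.log_div ha0.ne' hb0.ne'] at h1
    have h2 : a / b - 1 = (a - b) / b := by field_simp
    have h3 : a - b ≤ 2 * ε := by linarith [(abs_le.1 hag).2, (abs_le.1 hbg).1]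
    have h4 : 0 ≤ 2 * ε := by linarith [(abs_nonneg _).trans hag]
    calc Real.log a - Real.log b ≤ (a - b) / b := by linarith
      _ ≤ 2 * ε / b := by gcongr
      _ ≤ 2 * ε / κ := by gcongr
  exact abs_le.2 ⟨by linarith [key b a hb ha hbg hag], key a b ha hb hag hbg⟩

/-- For a quasilocal specification, the energy difference of a transition in `Δ` is determined up to
a small error by the spins in a large volume. -/
theorem Specification.IsGibbs.exists_abs_logProb_update_sub_sub_le {γ : Specification d q}
    {μ : ProbabilityMeasure (Config d q)} (hμ : γ.IsGibbs μ) (hq : γ.IsQuasilocal) {δ : ℝ}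
    (hδ : 0 < δ) (h : ∀ (Δ Λ : Finset (Site d)) (η : Config d q),
      δ ^ Δ.card * IPS.prob μ (Λ \ Δ) η ≤ IPS.prob μ Λ η)
    (Δ : Finset (Site d)) {ε : ℝ} (hε : 0 < ε) :
    ∃ k₀ : ℕ, ∀ k : ℕ, k₀ ≤ k → ∀ V Λ : Finset (Site d), box d k ⊆ V → V ⊆ Λ →
      ∀ (σ : Δ → Fin q) (η : Config d q),
      |(logProb μ Λ (Function.updateFinset η Δ σ) - logProb μ Λ η)
        - (logProb μ V (Function.updateFinset η Δ σ) - logProb μ V η)| ≤ ε := by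
  set κ := δ ^ Δ.card with hκ
  have hκ0 : 0 < κ := pow_pos hδ _
  have hpos : ∀ Λ η, 0 < IPS.prob (μ : Measure (Config d q)) Λ η := fun Λ η =>
    (pow_pos hδ _).trans_le (pow_le_prob h Λ η)
  obtain ⟨W, hW⟩ := hq Δ (ε * κ / 4) (by positivity)
  obtain ⟨k₀, hk₀⟩ := exists_subset_box (W ∪ Δ)
  refine ⟨k₀, fun k hk V Λ hkV hVΛ σ η => ?_⟩
  have hWV : W ∪ Δ ⊆ V := (hk₀.trans (box_mono (by exact_mod_cast hk))).trans hkV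
  have hWV' := Finset.subset_union_left.trans hWV
  have hΔV := Finset.subset_union_right.trans hWV
  -- the ratios `μ(ζ_U) / μ(ζ_{U∖Δ})` are averages of `γ_Δ(ζ_Δ | ·)`
  have hratio : ∀ U : Finset (Site d), V ⊆ U → ∀ ζ : Config d q,
      |IPS.prob μ U ζ / IPS.prob μ (U \ Δ) ζ - γ.prob Δ (Δ.restrict ζ) ζ| ≤ ε * κ / 4 ∧
        κ ≤ IPS.prob μ U ζ / IPS.prob μ (U \ Δ) ζ := by
    intro U hU ζ
    have hloc : ∀ ξ : Config d q, (∀ x ∈ U \ Δ, ξ x = ζ x) →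
        |γ.prob Δ (Δ.restrict ζ) ξ - γ.prob Δ (Δ.restrict ζ) ζ| ≤ ε * κ / 4 := by
      intro ξ hξ
      have h1 := hW V hWV' ζ ξ
      have h2 : γ.kernel Δ (Function.updateFinset ξ V (V.restrict ζ)) = γ.kernel Δ ξ := by
        refine γ.kernel_congr fun x hx => ?_
        by_cases hxV : x ∈ V
        · rw [updateFinset_of_mem _ _ hxV]
          exact (hξ x (Finset.mem_sdiff.2 ⟨hU hxV, hx⟩)).symm
        · rw [updateFinset_of_notMem _ _ hxV]
      rwa [Specification.prob, h2] at h1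
    have p := hpos (U \ Δ) ζ
    refine ⟨abs_le.2 ⟨?_, ?_⟩, (le_div_iff₀ p).2 (h Δ U ζ)⟩
    · rw [neg_le_sub_iff_le_add, ← sub_le_iff_le_add, le_div_iff₀ p]
      exact hμ.mul_prob_le (hΔV.trans hU) ζ fun ξ hξ => by linarith [(abs_le.1 (hloc ξ hξ)).1]
    · rw [sub_le_iff_le_add, div_le_iff₀ p]
      exact hμ.prob_le_mul (hΔV.trans hU) ζ fun ξ hξ => by linarith [(abs_le.1 (hloc ξ hξ)).2]
  have hdiff : ∀ ζ : Config d q, |(logProb μ Λ ζ - logProb μ (Λ \ Δ) ζ)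
      - (logProb μ V ζ - logProb μ (V \ Δ) ζ)| ≤ ε / 2 := by
    intro ζ
    have r1 := hratio Λ hVΛ ζ
    have r2 := hratio V subset_rfl ζ
    have := abs_log_sub_log_le hκ0 r1.2 r2.2 r1.1 r2.1
    rw [Real.log_div (hpos _ _).ne' (hpos _ _).ne', Real.log_div (hpos _ _).ne' (hpos _ _).ne'] at this
    refine this.trans (le_of_eq ?_)
    field_simp
    ring
  have b1 := abs_le.1 (hdiff η)
  have b2 := abs_le.1 (hdiff (Function.updateFinset η Δ σ))
  rw [logProb_sdiff_updateFinset, logProb_sdiff_updateFinset] at b2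
  rw [abs_le]
  constructor <;> linarith

/-! ### The energy loss per site -/

section Energy

variable {c : JumpRates d q}

/-- The weighted number of transitions that involve the origin. -/
def transitionMass (q : ℕ) (Γ : Finset (Site d)) : ℝ :=
  ∑ Δ ∈ JumpRates.reps Γ, (Δ.card : ℝ)⁻¹ * (q : ℝ) ^ Δ.card

theorem transitionMass_nonneg (q : ℕ) (Γ : Finset (Site d)) : 0 ≤ transitionMass q Γ := by
  unfold transitionMass; positivity

theorem abs_sum_reps_le {Γ : Finset (Site d)} {M B : ℝ} (hM0 : 0 ≤ M)
    (hM : ∀ Δ ∈ JumpRates.reps Γ, ∀ (η : Config d q) (ξ : Δ → Fin q), c.rate Δ η ξ ≤ M)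
    (ν : ProbabilityMeasure (Config d q))
    (D : (Δ : Finset (Site d)) → (Δ → Fin q) → Config d q → ℝ)
    (hD : ∀ Δ ∈ JumpRates.reps Γ, ∀ ξ η, |D Δ ξ η| ≤ B) :
    |∑ Δ ∈ JumpRates.reps Γ, (Δ.card : ℝ)⁻¹ * ∑ ξ : Δ → Fin q,
      ∫ η, c.rate Δ η ξ * D Δ ξ η ∂(ν : Measure (Config d q))| ≤ transitionMass q Γ * (M * B) := by
  rw [transitionMass, Finset.sum_mul]
  refine (Finset.abs_sum_le_sum_abs _ _).trans (Finset.sum_le_sum fun Δ hΔ => ?_)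
  rw [abs_mul, abs_of_nonneg (by positivity : (0 : ℝ) ≤ (Δ.card : ℝ)⁻¹), mul_assoc]
  refine mul_le_mul_of_nonneg_left ((Finset.abs_sum_le_sum_abs _ _).trans ?_) (by positivity)
  refine (Finset.sum_le_card_nsmul _ _ (M * B) fun ξ _ => ?_).trans_eq (by simp)
  have := norm_integral_le_of_norm_le_const (μ := (ν : Measure (Config d q)))
    (f := fun η => c.rate Δ η ξ * D Δ ξ η) (C := M * B) (ae_of_all _ fun η => by
      rw [norm_mul, Real.norm_of_nonneg (c.nonneg _ _ _)]
      exact mul_le_mul (hM Δ hΔ η ξ) (hD Δ hΔ ξ η) (abs_nonneg _) hM0)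
  rwa [probReal_univ, mul_one] at this

/-- The energy loss per site is bounded, and up to a small error it is determined by the spins in a
large cube. -/
theorem Specification.IsGibbs.exists_siteLoss_bounds {γ : Specification d q}
    {μ : ProbabilityMeasure (Config d q)} (hμ : γ.IsGibbs μ) (hμt : IPS.IsTranslationInvariant μ)
    (hγ : γ.IsTranslationInvariant) (h0 : γ.IsNonNull) (hq : γ.IsQuasilocal)
    (hc : c.IsTranslationInvariant) (Γ : Finset (Site d)) :
    (∃ C, 0 ≤ C ∧ ∀ ν : ProbabilityMeasure (Config d q), IPS.IsTranslationInvariant ν →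
      ∀ Λ i, |siteLoss c Γ ν μ Λ i| ≤ C) ∧
    ∀ ε, 0 < ε → ∃ k : ℕ, ∀ (Λ : Finset (Site d)) (i : Site d), translate i (box d k) ⊆ Λ →
      ∀ ν : ProbabilityMeasure (Config d q), IPS.IsTranslationInvariant ν →
      |siteLoss c Γ ν μ Λ i - siteLoss c Γ ν μ (box d k) 0| ≤ ε := by
  obtain ⟨δ, hδ, hδ1, h⟩ := hμ.exists_pow_mul_prob_le hγ h0
  obtain ⟨M, hM0, hM⟩ := JumpRates.exists_rate_le (c := c) Γ
  have hlog : 0 ≤ -Real.log δ := neg_nonneg.2 (Real.log_nonpos hδ.le hδ1)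
  have hT := transitionMass_nonneg q Γ
  constructor
  · refine ⟨transitionMass q Γ * (M * (Γ.card * -Real.log δ)), by positivity, fun ν hν Λ i => ?_⟩
    rw [siteLoss_eq_zero_site hc hν hμt, siteLoss_zero_eq]
    refine abs_sum_reps_le hM0 hM ν (fun Δ ξ η => logProb μ (translate (-i) Λ)
      (Function.updateFinset η Δ ξ) - logProb μ (translate (-i) Λ) η) fun Δ hΔ ξ η => ?_
    refine (abs_logProb_update_sub_le hδ h _ _ _ _).trans ?_
    rw [← mul_neg]
    refine mul_le_mul_of_nonneg_right ?_ hlog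
    exact_mod_cast Finset.card_le_card (JumpRates.mem_reps.1 hΔ).1
  · intro ε hε
    have hden : 0 < transitionMass q Γ * M + 1 := by positivity
    choose k₀ hk₀ using fun Δ : Finset (Site d) =>
      hμ.exists_abs_logProb_update_sub_sub_le hq hδ h Δ (div_pos hε hden)
    refine ⟨(JumpRates.reps Γ).sup k₀, fun Λ i hi ν hν => ?_⟩
    set k := (JumpRates.reps Γ).sup k₀
    have hsub : box d k ⊆ translate (-i) Λ := fun x hx => by
      rw [mem_translate, sub_neg_eq_add]
      exact hi (mem_translate.2 (by simpa using hx))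
    rw [siteLoss_eq_zero_site hc hν hμt, siteLoss_zero_eq, siteLoss_zero_eq,
      ← Finset.sum_sub_distrib]
    have e := abs_sum_reps_le hM0 hM ν (fun Δ ξ η =>
      (logProb μ (translate (-i) Λ) (Function.updateFinset η Δ ξ) - logProb μ (translate (-i) Λ) η)
        - (logProb μ (box d k) (Function.updateFinset η Δ ξ) - logProb μ (box d k) η))
      (B := ε / (transitionMass q Γ * M + 1))
      fun Δ hΔ ξ η => hk₀ Δ k (Finset.le_sup (f := k₀) hΔ) _ _ subset_rfl hsub ξ η
    refine le_trans (le_of_eq ?_) (e.trans ?_)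
    · congr 1
      refine Finset.sum_congr rfl fun Δ _ => ?_
      rw [← mul_sub, ← Finset.sum_sub_distrib]
      congr 1
      refine Finset.sum_congr rfl fun ξ _ => ?_
      rw [← integral_sub
        (integrable_of_continuous _ (continuous_transition c Δ ξ (continuous_logProb _ _)))
        (integrable_of_continuous _ (continuous_transition c Δ ξ (continuous_logProb _ _)))]
      exact integral_congr_ae (ae_of_all _ fun η => by ring)
    · rw [← mul_assoc, mul_div_assoc', div_le_iff₀ hden]
      nlinarith

end Energy

/-! ### The relative entropy loss in finite volume -/

theorem tendsto_card_bigBox_div (d : ℕ) :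
    Tendsto (fun m : ℕ => ((bigBox d m).card : ℝ) / (innerBox d m).card) atTop (𝓝 1) := by
  have h0 : Tendsto (fun m : ℕ => 2 * (m : ℝ) / (2 * 2 ^ m - 1)) atTop (𝓝 0) := by
    have h1 := (tendsto_pow_const_div_const_pow_of_one_lt 1 (one_lt_two (α := ℝ))).const_mul 2
    rw [mul_zero] at h1
    refine squeeze_zero (fun m => ?_) (fun m => ?_) h1
    all_goals have h2 : (1 : ℝ) ≤ 2 ^ m := one_le_pow₀ one_le_two
    · exact div_nonneg (by positivity) (by linarith)
    · rw [pow_one, mul_div_assoc]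
      refine mul_le_mul_of_nonneg_left ?_ zero_le_two
      exact div_le_div_of_nonneg_left (by positivity) (by positivity) (by linarith)
  have h3 : Tendsto (fun m : ℕ => ((1 - 2 * (m : ℝ) / (2 * 2 ^ m - 1)) ^ d)⁻¹) atTop (𝓝 1) := by
    have := ((h0.const_sub 1).pow d).inv₀ (by simp)
    simpa using this
  refine h3.congr fun m => ?_
  have h2 : (1 : ℝ) ≤ 2 ^ m := one_le_pow₀ one_le_two
  have h4 := lt_two_pow_int m
  have h5 : (2 * (2 : ℝ) ^ m - 1) ≠ 0 := by linarith
  rw [bigBox, innerBox, card_box (by linarith), card_box (by linarith), ← div_pow, ← inv_pow]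
  congr 1
  push_cast
  rw [one_sub_div h5, inv_div]
  congr 1 <;> ring

/-- Bound of a sum over an enlarged cube with different bounds in the bulk and at the boundary. -/
theorem inv_card_mul_sum_box_le {s : Site d → ℝ} {N R K : ℕ} {b C : ℝ}
    (hC : ∀ i ∈ box d (N + R), s i ≤ C) (hb : ∀ i ∈ box d (N + -(K : ℤ)), s i ≤ b) :
    ((box d N).card : ℝ)⁻¹ * ∑ i ∈ box d (N + R), s i
      ≤ b * (((box d (N + -(K : ℤ))).card : ℝ) / (box d N).card)
        + C * (((box d (N + R)).card : ℝ) / (box d N).card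
          - ((box d (N + -(K : ℤ))).card : ℝ) / (box d N).card) := by
  have hsub : box d (N + -(K : ℤ)) ⊆ box d (N + R) := box_mono (by linarith)
  have h1 : ∑ i ∈ box d (N + -(K : ℤ)), s i ≤ (box d (N + -(K : ℤ))).card * b := by
    simpa using Finset.sum_le_card_nsmul _ _ _ hb
  have h2 : ∑ i ∈ box d (N + R) \ box d (N + -(K : ℤ)), s i
      ≤ ((box d (N + R)).card - (box d (N + -(K : ℤ))).card) * C := by
    have := Finset.sum_le_card_nsmul (box d (N + R) \ box d (N + -(K : ℤ))) s C
      fun i hi => hC i (Finset.sdiff_subset hi)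
    rw [nsmul_eq_mul, Finset.cast_card_sdiff hsub] at this
    exact this
  have h3 : (0 : ℝ) < (box d N).card := card_box_pos (by positivity)
  rw [← Finset.sum_sdiff hsub]
  calc _ ≤ ((box d N).card : ℝ)⁻¹ * (((box d (N + R)).card - (box d (N + -(K : ℤ))).card) * C
        + (box d (N + -(K : ℤ))).card * b) := by gcongr
    _ = _ := by field_simp; ring

/-- The relative entropy with respect to `μ` in the cube `[-N, N]^d` per site. -/
def relEntropy (ν μ : Measure (Config d q)) (N : ℕ) : ℝ :=
  ((box d N).card : ℝ)⁻¹ * ∫ η, (logProb ν (box d N) η - logProb μ (box d N) η) ∂ν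

/-- The rate of change of the relative entropy in the cube `[-N, N]^d` per site. -/
def relLoss (c : JumpRates d q) (ν μ : Measure (Config d q)) (N : ℕ) : ℝ :=
  ((box d N).card : ℝ)⁻¹ *
    ∫ η, c.gen (fun ζ => logProb ν (box d N) ζ - logProb μ (box d N) ζ) η ∂ν

theorem relEntropy_nonneg {ν μ : ProbabilityMeasure (Config d q)}
    (hν : ChargesCylinders (ν : Measure (Config d q)))
    (hμ : ChargesCylinders (μ : Measure (Config d q))) (N : ℕ) : 0 ≤ relEntropy (ν : Measure (Config d q)) μ N := by
  refine mul_nonneg (by positivity) ?_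
  have h1 := integral_mul_prob_div (m := (μ : Measure (Config d q))) hν (Λ := box d N)
    (h := fun _ => 1) (fun _ _ _ => rfl)
  simp only [one_mul, integral_const, probReal_univ, smul_eq_mul, mul_one] at h1
  have i1 : Integrable (fun η => 1 - prob (μ : Measure (Config d q)) (box d N) η
      / prob (ν : Measure (Config d q)) (box d N) η) (ν : Measure (Config d q)) :=
    integrable_of_continuous _ (continuous_const.sub (continuous_prob_div hν _))
  have h2 : ∫ η, (1 - prob (μ : Measure (Config d q)) (box d N) η
      / prob (ν : Measure (Config d q)) (box d N) η) ∂(ν : Measure (Config d q)) = 0 := by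
    rw [integral_sub (integrable_const _)
      (integrable_of_continuous _ (continuous_prob_div hν _)), h1]
    simp
  rw [← h2]
  refine integral_mono i1 (integrable_of_continuous _
    ((continuous_logProb _ _).sub (continuous_logProb _ _))) fun η => ?_
  have p1 := hν (box d N) η
  have p2 := hμ (box d N) η
  have := Real.log_le_sub_one_of_pos (div_pos p2 p1)
  rw [Real.log_div p2.ne' p1.ne'] at this
  simp only [logProb]
  linarith

theorem relEntropy_le {ν μ : ProbabilityMeasure (Config d q)}
    (hν : ChargesCylinders (ν : Measure (Config d q))) {δ : ℝ} (hδ : 0 < δ)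
    (hμ : ∀ (Λ : Finset (Site d)) (η : Config d q), δ ^ Λ.card ≤ prob μ Λ η) (N : ℕ) :
    relEntropy (ν : Measure (Config d q)) μ N ≤ -Real.log δ := by
  have hN : (0 : ℝ) < (box d N).card := card_box_pos (by positivity)
  rw [relEntropy, inv_mul_le_iff₀ hN]
  have := integral_mono (μ := (ν : Measure (Config d q)))
    (integrable_of_continuous _ ((continuous_logProb (ν : Measure (Config d q)) (box d N)).sub
      (continuous_logProb (μ : Measure (Config d q)) (box d N))))
    (integrable_const ((box d N).card * -Real.log δ)) fun η => ?_
  · simpa using this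
  · have h1 : logProb ν (box d N) η ≤ 0 := Real.log_nonpos (hν _ _).le measureReal_le_one
    have h2 : (box d N).card * Real.log δ ≤ logProb μ (box d N) η := by
      rw [← Real.log_pow]; exact Real.log_le_log (pow_pos hδ _) (hμ _ _)
    simp only [Pi.sub_apply]
    linarith

section RelLoss

variable {c : JumpRates d q} {Γ : Finset (Site d)}

theorem translate_subset_box {Γ : Finset (Site d)} {R : ℕ} (hR : Γ ⊆ box d R) {N : ℕ}
    {x : Site d} (hx : x ∈ box d N) : translate x Γ ⊆ box d (N + R) := by
  intro y hy
  have h1 := mem_box.1 (hR (mem_translate.1 hy))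
  have h2 := mem_box.1 hx
  refine mem_box.2 fun j => ?_
  have h3 := h1 j
  have h4 := h2 j
  simp only [Pi.sub_apply] at h3
  constructor <;> linarith

theorem integral_gen_eq_sum (hΓ : c.HasTransitionsIn Γ) (hc : c.IsTranslationInvariant) {R : ℕ}
    (hR : Γ ⊆ box d R) (m : Measure (Config d q)) [IsFiniteMeasure m] {N : ℕ}
    {f : Config d q → ℝ} (hf : DependsOn f (box d N : Set (Site d))) :
    ∫ η, c.gen f η ∂m = ∑ i ∈ box d (N + R), ∫ η, c.siteGen Γ i f η ∂m := by
  rw [← integral_finsetSum]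
  · exact integral_congr_ae (ae_of_all _ fun η =>
      hΓ.gen_eq_sum_siteGen hc hf (fun x hx => translate_subset_box hR hx) η)
  · exact fun i _ => integrable_of_continuous _ (c.continuous_siteGen Γ i (continuous_of_dependsOn hf))

theorem relLoss_eq (hΓ : c.HasTransitionsIn Γ) (hc : c.IsTranslationInvariant) {R : ℕ}
    (hR : Γ ⊆ box d R) (ν μ : Measure (Config d q)) [IsFiniteMeasure ν] (N : ℕ) :
    relLoss c ν μ N = ((box d N).card : ℝ)⁻¹ * ∑ i ∈ box d (N + R),
      (siteLoss c Γ ν ν (box d N) i - siteLoss c Γ ν μ (box d N) i) := by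
  rw [relLoss, integral_gen_eq_sum hΓ hc hR]
  · congr 1
    refine Finset.sum_congr rfl fun i _ => ?_
    rw [siteLoss, siteLoss, ← integral_sub
      (integrable_of_continuous _ (c.continuous_siteGen Γ i (continuous_logProb _ _)))
      (integrable_of_continuous _ (c.continuous_siteGen Γ i (continuous_logProb _ _)))]
    exact integral_congr_ae (ae_of_all _ fun η => c.siteGen_sub _ _ _ _ _)
  · intro η ζ h
    simp only [dependsOn_logProb _ _ h]

theorem integral_gen_eq_sum_cyl (hΓ : c.HasTransitionsIn Γ) (hc : c.IsTranslationInvariant)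
    (m : Measure (Config d q)) [IsFiniteMeasure m] {Λ : Finset (Site d)}
    {f : Config d q → ℝ} (hf : DependsOn f (Λ : Set (Site d))) (η₀ : Config d q) :
    ∫ η, c.gen f η ∂m = ∑ ω : Λ → Fin q, f (Function.updateFinset η₀ Λ ω) *
      ∫ η, c.gen ((cyl Λ ω).indicator 1) η ∂m := by
  rw [integral_congr_ae (ae_of_all _ fun η => hΓ.gen_eq_sum_cyl hc hf η₀ η), integral_finsetSum]
  · exact Finset.sum_congr rfl fun ω _ => integral_const_mul _ _
  · exact fun ω _ => (integrable_of_continuous m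
      (hΓ.continuous_gen hc (dependsOn_indicator_cyl Λ ω))).const_mul _

theorem energyLoss_eq (hΓ : c.HasTransitionsIn Γ) (hc : c.IsTranslationInvariant) {R : ℕ}
    (hR : Γ ⊆ box d R) (ν μ : Measure (Config d q)) [IsProbabilityMeasure ν] (N : ℕ) :
    energyLoss c ν μ N
      = -(((box d N).card : ℝ)⁻¹ * ∑ i ∈ box d (N + R), siteLoss c Γ ν μ (box d N) i) := by
  obtain ⟨η₀⟩ : Nonempty (Config d q) := nonempty_of_isProbabilityMeasure ν
  simp only [siteLoss]
  rw [energyLoss, ← integral_gen_eq_sum hΓ hc hR ν (dependsOn_logProb μ _),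
    integral_gen_eq_sum_cyl hΓ hc ν (dependsOn_logProb μ _) η₀]
  congr 2
  refine Finset.sum_congr rfl fun ω _ => ?_
  rw [logProb, prob_updateFinset, mul_comm]

theorem continuous_integral_probabilityMeasure {f : Config d q → ℝ} (hf : Continuous f) :
    Continuous fun ν : ProbabilityMeasure (Config d q) => ∫ η, f η ∂(ν : Measure (Config d q)) :=
  continuous_iff_continuousAt.2 fun _ =>
    ProbabilityMeasure.tendsto_iff_forall_integral_tendsto.1 tendsto_id
      (BoundedContinuousFunction.mkOfCompact ⟨f, hf⟩)

/-- The entropy loss per site is continuous at measures that charge all cylinder events. -/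
theorem continuousAt_siteLoss {ν : ProbabilityMeasure (Config d q)}
    (hν : ChargesCylinders (ν : Measure (Config d q))) (Λ : Finset (Site d)) (i : Site d) :
    ContinuousAt (fun ν : ProbabilityMeasure (Config d q) => siteLoss c Γ ν ν Λ i) ν := by
  obtain ⟨η₀⟩ : Nonempty (Config d q) :=
    nonempty_of_isProbabilityMeasure (ν : Measure (Config d q))
  have e : (fun ν : ProbabilityMeasure (Config d q) => siteLoss c Γ ν ν Λ i)
      = fun ν : ProbabilityMeasure (Config d q) => ∑ ω : Λ → Fin q,
        Real.log (∫ η, (cyl Λ ω).indicator 1 η ∂(ν : Measure (Config d q))) *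
          ∫ η, c.siteGen Γ i ((cyl Λ ω).indicator 1) η ∂(ν : Measure (Config d q)) := by
    funext ν
    rw [siteLoss, integral_congr_ae (ae_of_all _ fun η =>
      JumpRates.siteGen_eq_sum_cyl Γ i (dependsOn_logProb _ Λ) η₀ η), integral_finsetSum]
    · refine Finset.sum_congr rfl fun ω _ => ?_
      rw [integral_const_mul, logProb, prob_updateFinset,
        integral_indicator_one (measurableSet_cyl Λ ω)]
    · exact fun ω _ => (integrable_of_continuous _
        (c.continuous_siteGen Γ i (continuous_indicator_cyl Λ ω))).const_mul _
  rw [e]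
  refine tendsto_finsetSum _ fun ω _ => ?_
  refine ContinuousAt.mul (ContinuousAt.log
    (continuous_integral_probabilityMeasure (continuous_indicator_cyl Λ ω)).continuousAt ?_)
    (continuous_integral_probabilityMeasure
      (c.continuous_siteGen Γ i (continuous_indicator_cyl Λ ω))).continuousAt
  rw [integral_indicator_one (measurableSet_cyl Λ ω),
    ← prob_updateFinset (ν : Measure (Config d q)) Λ η₀ ω]
  exact (hν _ _).ne'

theorem continuousAt_entropyLoss {ν : ProbabilityMeasure (Config d q)}
    (hν : ChargesCylinders (ν : Measure (Config d q))) (m : ℕ) :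
    ContinuousAt (fun ν : ProbabilityMeasure (Config d q) => entropyLoss c Γ ν m) ν :=
  ContinuousAt.mul continuousAt_const
    (tendsto_finsetSum _ fun i _ => continuousAt_siteLoss hν _ i)

theorem continuous_siteLoss_left (Γ : Finset (Site d)) (κ : Measure (Config d q))
    (Λ : Finset (Site d)) (i : Site d) :
    Continuous fun ν : ProbabilityMeasure (Config d q) => siteLoss c Γ ν κ Λ i :=
  continuous_integral_probabilityMeasure (c.continuous_siteGen Γ i (continuous_logProb κ Λ))

end RelLoss

section UpperBound

variable {c : JumpRates d q} {Γ : Finset (Site d)} {γ : Specification d q}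
  {μ : ProbabilityMeasure (Config d q)}

/-- The relative entropy loss per site is bounded above, uniformly in the measure. -/
theorem exists_relLoss_le (hΓ : c.HasTransitionsIn Γ) (hc : c.IsTranslationInvariant)
    (hμ : γ.IsGibbs μ) (hμt : IsTranslationInvariant μ) (hγ : γ.IsTranslationInvariant)
    (h0 : γ.IsNonNull) (hq : γ.IsQuasilocal) :
    ∃ C, ∀ᶠ N : ℕ in atTop, ∀ ν : ProbabilityMeasure (Config d q), IsTranslationInvariant ν →
      ChargesCylinders (ν : Measure (Config d q)) → relLoss c ν μ N ≤ C := by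
  obtain ⟨R, hR⟩ := exists_subset_box Γ
  obtain ⟨C₁, hC₁, h₁⟩ := exists_siteLoss_le hc Γ
  obtain ⟨⟨C₂, hC₂, h₂⟩, -⟩ := hμ.exists_siteLoss_bounds hμt hγ h0 hq hc Γ
  refine ⟨(C₁ + C₂) * 2, ?_⟩
  filter_upwards [(tendsto_card_box_div (d := d) R).eventually_le_const one_lt_two]
    with N hN ν hν hpos
  rw [relLoss_eq hΓ hc hR]
  have h3 := Finset.sum_le_card_nsmul (box d (N + R))
    (fun i => siteLoss c Γ ν ν (box d N) i - siteLoss c Γ ν μ (box d N) i) (C₁ + C₂) fun i _ => by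
      linarith [h₁ ν hν hpos (box d N) i, (abs_le.1 (h₂ ν hν (box d N) i)).1]
  calc _ ≤ ((box d N).card : ℝ)⁻¹ * ((box d (N + R)).card • (C₁ + C₂)) := by gcongr
    _ = (C₁ + C₂) * (((box d (N + R)).card : ℝ) / (box d N).card) := by
      rw [nsmul_eq_mul]; ring
    _ ≤ _ := by gcongr

/-- If the approximated relative entropy loss of `ν` is less than `y`, the relative entropy loss in
large cubes of all measures is asymptotically dominated by a functional which is continuous
at measures that charge all cylinder events, and whose value at `ν` is less than `y`. -/
theorem exists_continuousAt_bound (hΓ : c.HasTransitionsIn Γ) (hc : c.IsTranslationInvariant)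
    (hcont : c.IsUniformlyContinuous) (hmin : c.HasMinimalRate)
    (hμ : γ.IsGibbs μ) (hμt : IsTranslationInvariant μ) (hγ : γ.IsTranslationInvariant)
    (h0 : γ.IsNonNull) (hq : γ.IsQuasilocal) {ν : ProbabilityMeasure (Config d q)}
    (hν : IsTranslationInvariant ν) (hpos : ChargesCylinders (ν : Measure (Config d q)))
    {x : EReal} (hx : HasApproxRelEntropyLoss c ν μ x) {y : ℝ} (hxy : x < y) :
    ∃ G : ProbabilityMeasure (Config d q) → ℝ, G ν < y ∧
      (∀ ν' : ProbabilityMeasure (Config d q), ChargesCylinders (ν' : Measure (Config d q)) →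
        ContinuousAt G ν') ∧
      ∃ θ β : ℕ → ℝ, (∀ N, 0 ≤ θ N) ∧ Tendsto θ atTop (𝓝 1) ∧ Tendsto β atTop (𝓝 0) ∧
        ∀ N, ∀ ν' : ProbabilityMeasure (Config d q), IsTranslationInvariant ν' →
          ChargesCylinders (ν' : Measure (Config d q)) →
          relLoss c ν' μ N ≤ G ν' * θ N + β N := by
  obtain ⟨g, r, hg, hr, rfl⟩ := hx
  obtain ⟨R, hR⟩ := exists_subset_box Γ
  obtain ⟨C₁, hC₁, h₁⟩ := exists_siteLoss_le hc Γ
  obtain ⟨C₃, hC₃, h₃⟩ := exists_siteLoss_le_entropyLoss hc hcont hmin Γ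
  obtain ⟨⟨C₂, hC₂, h₂⟩, hloc⟩ := hμ.exists_siteLoss_bounds hμt hγ h0 hq hc Γ
  -- a real number `z` strictly between the entropy loss and `y - r`
  have hgy : g < ((y - r : ℝ) : EReal) := by
    rw [EReal.coe_sub]
    exact (EReal.lt_sub_iff_add_lt (.inl (EReal.coe_ne_bot _)) (.inl (EReal.coe_ne_top _))).2 hxy
  obtain ⟨z, hgz, hzy⟩ := EReal.lt_iff_exists_real_btwn.1 hgy
  have hzy : z < y - r := EReal.coe_lt_coe_iff.1 hzy
  -- a precision `ε`
  have hε : ∃ ε : ℝ, 0 < ε ∧ ε ≤ 1 / 2 ∧ (1 - ε) / (1 + ε) * (1 * z) + ε * (C₃ + 2) < y - r := by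
    have hcε : ContinuousAt (fun ε : ℝ => (1 - ε) / (1 + ε) * (1 * z) + ε * (C₃ + 2)) 0 := by
      refine ContinuousAt.add (ContinuousAt.mul (ContinuousAt.div ?_ ?_ ?_) ?_) ?_ <;>
        first | fun_prop | norm_num
    have h4 : ∀ᶠ ε in 𝓝 (0 : ℝ), (1 - ε) / (1 + ε) * (1 * z) + ε * (C₃ + 2) < y - r := by
      refine hcε.eventually_lt continuousAt_const ?_
      simpa using hzy
    obtain ⟨ε, h5, h6⟩ := ((h4.filter_mono nhdsWithin_le_nhds).and
      (Ioc_mem_nhdsGT (show (0 : ℝ) < 1 / 2 by norm_num))).exists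
    exact ⟨ε, h6.1, h6.2, h5⟩
  obtain ⟨ε, hε0, hε1, hεz⟩ := hε
  have ha : 0 ≤ (1 - ε) / (1 + ε) := div_nonneg (by linarith) (by linarith)
  obtain ⟨m₀, hm₀⟩ := h₃ ε hε0 hε1
  obtain ⟨k, hk⟩ := hloc ε hε0
  -- a cube on which the entropy loss of `ν` is small
  have hm : ∃ m, m₀ ≤ m ∧ entropyLoss c Γ ν m < z ∧ (1 - ε) / (1 + ε) *
      (((bigBox d m).card : ℝ) / (innerBox d m).card * z) + ε * (C₃ + 2) < y - r := by
    have h4 : ∀ᶠ m in atTop, entropyLoss c Γ ν m < z := by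
      filter_upwards [hg.eventually_lt_const hgz] with m hm
      rw [approxEntropyLoss_eq hΓ hc _ hpos] at hm
      exact EReal.coe_lt_coe_iff.1 hm
    have h5 := ((((tendsto_card_bigBox_div d).mul_const z).const_mul
      ((1 - ε) / (1 + ε))).add_const (ε * (C₃ + 2))).eventually_lt_const hεz
    obtain ⟨m, h6, h7, h8⟩ := ((eventually_ge_atTop m₀).and (h4.and h5)).exists
    exact ⟨m, h6, h7, h8⟩
  obtain ⟨m, hmm, hmz, hmy⟩ := hm
  set ratio := ((bigBox d m).card : ℝ) / (innerBox d m).card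
  have hratio : 0 ≤ ratio := by positivity
  -- sites of the bulk
  set K : ℕ := 2 ^ (m + 1) + k
  have hbulk : ∀ (N : ℕ) (i : Site d), i ∈ box d (N + -(K : ℤ)) →
      translate i (box d (2 ^ (m + 1))) ⊆ box d N ∧ translate i (box d k) ⊆ box d N := by
    intro N i hi
    have hK : (K : ℤ) = 2 ^ (m + 1) + k := by simp [K]
    have h2m : (0 : ℤ) ≤ 2 ^ (m + 1) := by positivity
    rw [hK] at hi
    have h4 := mem_box.1 hi
    constructor
    all_goals
      intro x hx
      have h5 := mem_box.1 (mem_translate.1 hx)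
      refine mem_box.2 fun j => ?_
      have h6 := h4 j
      have h7 := h5 j
      simp only [Pi.sub_apply] at h7
      constructor <;> linarith
  have hθ := tendsto_card_box_div (d := d) (-(K : ℤ))
  have hφ := tendsto_card_box_div (d := d) R
  refine ⟨fun ν' => (1 - ε) / (1 + ε) * (ratio * entropyLoss c Γ ν' m) + ε * C₃
      + (-siteLoss c Γ ν' μ (box d k) 0 + ε), ?_, ?_,
    fun N => ((box d (N + -(K : ℤ))).card : ℝ) / (box d N).card,
    fun N => (C₁ + C₂) * (((box d (N + R)).card : ℝ) / (box d N).card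
      - ((box d (N + -(K : ℤ))).card : ℝ) / (box d N).card), fun N => by positivity, hθ, ?_, ?_⟩
  · -- the energy loss of `ν` is close to its limit
    have h4 : -siteLoss c Γ ν μ (box d k) 0 ≤ r + ε := by
      have h5 : ∀ N : ℕ, -energyLoss c ν μ N
          ≤ (siteLoss c Γ ν μ (box d k) 0 + ε) *
            (((box d (N + -(K : ℤ))).card : ℝ) / (box d N).card)
          + C₂ * (((box d (N + R)).card : ℝ) / (box d N).card
            - ((box d (N + -(K : ℤ))).card : ℝ) / (box d N).card) := by
        intro N
        rw [energyLoss_eq hΓ hc hR, neg_neg]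
        exact inv_card_mul_sum_box_le (fun i _ => (abs_le.1 (h₂ ν hν _ i)).2)
          fun i hi => by linarith [(abs_le.1 (hk _ i (hbulk N i hi).2 ν hν)).2]
      have h6 := le_of_tendsto_of_tendsto' hr.neg
        ((hθ.const_mul _).add ((hφ.sub hθ).const_mul C₂)) h5
      linarith
    have h5 : (1 - ε) / (1 + ε) * (ratio * entropyLoss c Γ ν m)
        ≤ (1 - ε) / (1 + ε) * (ratio * z) := by gcongr
    simp only
    linarith
  · intro ν' hν'
    have h4 := continuousAt_entropyLoss (c := c) (Γ := Γ) hν' m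
    have h5 := (continuous_siteLoss_left (c := c) Γ (μ : Measure (Config d q))
      (box d k) 0).continuousAt (x := ν')
    exact ((continuousAt_const.mul (continuousAt_const.mul h4)).add continuousAt_const).add
      (h5.neg.add continuousAt_const)
  · simpa using (hφ.sub hθ).const_mul (C₁ + C₂)
  · intro N ν' hν' hpos'
    rw [relLoss_eq hΓ hc hR]
    refine inv_card_mul_sum_box_le (fun i _ => ?_) fun i hi => ?_
    · linarith [h₁ ν' hν' hpos' (box d N) i, (abs_le.1 (h₂ ν' hν' (box d N) i)).1]
    · linarith [hm₀ m hmm _ i (hbulk N i hi).1 ν' hν' hpos',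
        (abs_le.1 (hk _ i (hbulk N i hi).2 ν' hν')).1]

end UpperBound

/-! ### Relative entropy along the dynamics -/

section Dynamics

variable {c : JumpRates d q} {Γ : Finset (Site d)} {P : FellerSemigroup d q}
  {ν μ : ProbabilityMeasure (Config d q)}

theorem relEntropy_eq_sum (ν : Measure (Config d q)) [IsFiniteMeasure ν]
    (μ : Measure (Config d q)) (N : ℕ) (η₀ : Config d q) :
    relEntropy ν μ N = ((box d N).card : ℝ)⁻¹ * ∑ ω : box d N → Fin q,
      (ν.real (cyl (box d N) ω) * Real.log (ν.real (cyl (box d N) ω))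
        - ν.real (cyl (box d N) ω) * Real.log (μ.real (cyl (box d N) ω))) := by
  rw [relEntropy, integral_eq_sum_cyl ν (Λ := box d N) (fun η ζ h => by
    simp only [dependsOn_logProb _ _ h]) η₀]
  congr 1
  refine Finset.sum_congr rfl fun ω _ => ?_
  rw [logProb, logProb, prob_updateFinset, prob_updateFinset, mul_sub]

theorem relLoss_eq_sum (hΓ : c.HasTransitionsIn Γ) (hc : c.IsTranslationInvariant)
    (ν : Measure (Config d q)) [IsFiniteMeasure ν] (μ : Measure (Config d q)) (N : ℕ)
    (η₀ : Config d q) :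
    relLoss c ν μ N = ((box d N).card : ℝ)⁻¹ * ∑ ω : box d N → Fin q,
      (Real.log (ν.real (cyl (box d N) ω)) - Real.log (μ.real (cyl (box d N) ω))) *
        ∫ η, c.gen ((cyl (box d N) ω).indicator 1) η ∂ν := by
  rw [relLoss, integral_gen_eq_sum_cyl hΓ hc ν (Λ := box d N) (fun η ζ h => by
    simp only [dependsOn_logProb _ _ h]) η₀]
  congr 1
  refine Finset.sum_congr rfl fun ω _ => ?_
  rw [logProb, logProb, prob_updateFinset, prob_updateFinset]

theorem real_cyl_pos {m : Measure (Config d q)} (hm : ChargesCylinders m) {Λ : Finset (Site d)}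
    (η₀ : Config d q) (ω : Λ → Fin q) : 0 < m.real (cyl Λ ω) := by
  rw [← prob_updateFinset m Λ η₀ ω]; exact hm _ _

theorem continuous_real_evolve_cyl (P : FellerSemigroup d q) (ν : ProbabilityMeasure (Config d q))
    (Λ : Finset (Site d)) (ω : Λ → Fin q) :
    Continuous fun s : ℝ => (P.evolve s.toNNReal ν : Measure (Config d q)).real (cyl Λ ω) := by
  have := (P.continuous_integral_evolve ν (continuous_indicator_cyl Λ ω)).comp
    continuous_real_toNNReal
  refine this.congr fun s => ?_
  exact integral_indicator_one (measurableSet_cyl Λ ω)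

theorem continuous_relEntropy_evolve
    (hpos : ∀ t, ChargesCylinders (P.evolve t ν : Measure (Config d q))) (N : ℕ) :
    Continuous fun s : ℝ => relEntropy (P.evolve s.toNNReal ν : Measure (Config d q)) μ N := by
  obtain ⟨η₀⟩ : Nonempty (Config d q) :=
    nonempty_of_isProbabilityMeasure (ν : Measure (Config d q))
  simp only [relEntropy_eq_sum _ _ _ η₀]
  refine continuous_const.mul (continuous_finsetSum _ fun ω _ => ?_)
  have h := continuous_real_evolve_cyl P ν (box d N) ω
  exact (h.mul (h.log fun s => (real_cyl_pos (hpos _) η₀ ω).ne')).sub (h.mul continuous_const)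

theorem continuous_relLoss_evolve (hΓ : c.HasTransitionsIn Γ) (hc : c.IsTranslationInvariant)
    (hpos : ∀ t, ChargesCylinders (P.evolve t ν : Measure (Config d q))) (N : ℕ) :
    Continuous fun s : ℝ => relLoss c (P.evolve s.toNNReal ν : Measure (Config d q)) μ N := by
  obtain ⟨η₀⟩ : Nonempty (Config d q) :=
    nonempty_of_isProbabilityMeasure (ν : Measure (Config d q))
  simp only [relLoss_eq_sum hΓ hc _ _ _ η₀]
  refine continuous_const.mul (continuous_finsetSum _ fun ω _ => ?_)
  have h := continuous_real_evolve_cyl P ν (box d N) ω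
  exact ((h.log fun s => (real_cyl_pos (hpos _) η₀ ω).ne').sub continuous_const).mul
    ((P.continuous_integral_evolve ν (hΓ.continuous_gen hc (dependsOn_indicator_cyl _ ω))).comp
      continuous_real_toNNReal)

theorem hasDerivWithinAt_relEntropy_evolve (hP : P.IsSemigroupOf c) (hΓ : c.HasTransitionsIn Γ)
    (hc : c.IsTranslationInvariant)
    (hpos : ∀ t, ChargesCylinders (P.evolve t ν : Measure (Config d q))) (N : ℕ) {s : ℝ}
    (hs : 0 ≤ s) :
    HasDerivWithinAt (fun s : ℝ => relEntropy (P.evolve s.toNNReal ν : Measure (Config d q)) μ N)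
      (relLoss c (P.evolve s.toNNReal ν : Measure (Config d q)) μ N) (Set.Ici s) s := by
  obtain ⟨η₀⟩ : Nonempty (Config d q) :=
    nonempty_of_isProbabilityMeasure (ν : Measure (Config d q))
  set D : (box d N → Fin q) → ℝ := fun ω =>
    ∫ η, c.gen ((cyl (box d N) ω).indicator 1) η ∂(P.evolve s.toNNReal ν : Measure (Config d q))
  have hD : ∀ ω : box d N → Fin q, HasDerivWithinAt
      (fun s : ℝ => (P.evolve s.toNNReal ν : Measure (Config d q)).real (cyl (box d N) ω))
      (D ω) (Set.Ici s) s := by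
    intro ω
    have h := hP.hasDerivWithinAt_integral_evolve hΓ hc ν (dependsOn_indicator_cyl (box d N) ω) hs
    simpa only [integral_indicator_one (measurableSet_cyl (box d N) ω)] using h
  -- the total rate of change of the probabilities vanishes
  have hsum : ∑ ω : box d N → Fin q, D ω = 0 := by
    rw [← integral_finsetSum]
    · rw [integral_congr_ae (ae_of_all _
        (JumpRates.gen_sum_indicator_eq_zero ⟨Γ, hΓ⟩ hc (box d N)))]
      simp
    · exact fun ω _ => integrable_of_continuous _
        (hΓ.continuous_gen hc (dependsOn_indicator_cyl _ ω))
  simp only [relEntropy_eq_sum _ _ _ η₀, relLoss_eq_sum hΓ hc _ _ _ η₀]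
  refine HasDerivWithinAt.const_mul _ ?_
  have h1 := HasDerivWithinAt.fun_sum (u := Finset.univ) fun (ω : box d N → Fin q) _ =>
    ((Real.hasDerivAt_mul_log (real_cyl_pos (hpos s.toNNReal) η₀ ω).ne').comp_hasDerivWithinAt s
      (hD ω)).sub ((hD ω).mul_const (Real.log ((μ : Measure (Config d q)).real (cyl (box d N) ω))))
  refine h1.congr_deriv ?_
  rw [← add_zero (∑ ω : box d N → Fin q, _ * D ω), ← hsum, ← Finset.sum_add_distrib]
  exact Finset.sum_congr rfl fun ω _ => by ring

theorem relEntropy_evolve_sub (hP : P.IsSemigroupOf c) (hΓ : c.HasTransitionsIn Γ)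
    (hc : c.IsTranslationInvariant)
    (hpos : ∀ t, ChargesCylinders (P.evolve t ν : Measure (Config d q))) (N : ℕ) {a b : ℝ}
    (ha : 0 ≤ a) (hab : a ≤ b) :
    relEntropy (P.evolve b.toNNReal ν : Measure (Config d q)) μ N
        - relEntropy (P.evolve a.toNNReal ν : Measure (Config d q)) μ N
      = ∫ s in a..b, relLoss c (P.evolve s.toNNReal ν : Measure (Config d q)) μ N :=
  (intervalIntegral.integral_eq_sub_of_hasDeriv_right_of_le hab
    (continuous_relEntropy_evolve hpos N).continuousOn
    (fun _ hx => (hasDerivWithinAt_relEntropy_evolve hP hΓ hc hpos N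
      (ha.trans hx.1.le)).mono Set.Ioi_subset_Ici_self)
    ((continuous_relLoss_evolve hΓ hc hpos N).intervalIntegrable _ _)).symm

end Dynamics

/-- A sequence `h` of uniformly bounded functions, whose derivatives `F` are uniformly bounded above
and asymptotically nonpositive, cannot decrease by a fixed amount on a sequence of time
intervals that tends to infinity. -/
theorem not_decreasing_infinitely_often {h F : ℕ → ℝ → ℝ} {B C : ℝ} (h0 : ∀ N s, 0 ≤ h N s)
    (hB : ∀ N s, h N s ≤ B) (hF : ∀ N, Continuous (F N))
    (hint : ∀ N a b, 0 ≤ a → a ≤ b → h N b - h N a = ∫ s in a..b, F N s)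
    (hC : ∀ᶠ N in atTop, ∀ s, F N s ≤ C)
    (hlim : ∀ s ε, 0 < ε → ∀ᶠ N in atTop, F N s ≤ ε) {t : ℕ → ℝ} (ht0 : ∀ k, 0 ≤ t k)
    (ht : Tendsto t atTop atTop) {δ ε : ℝ} (hδ : 0 < δ) (hε : 0 < ε)
    (hdec : ∀ᶠ k in atTop, ∀ᶠ N in atTop, ∀ s ∈ Set.Icc (t k) (t k + δ), F N s ≤ -ε) : False := by
  -- asymptotically, `h` does not increase
  have hmono : ∀ a b, 0 ≤ a → a ≤ b → ∀ κ, 0 < κ → ∀ᶠ N in atTop, h N b ≤ h N a + κ := by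
    intro a b ha hab κ hκ
    have h1 : Tendsto (fun N => ∫ s in a..b, max (F N s) 0) atTop (𝓝 (∫ _ in a..b, (0 : ℝ))) := by
      refine intervalIntegral.tendsto_integral_filter_of_dominated_convergence (fun _ => max C 0)
        (.of_forall fun N => ((hF N).max continuous_const).aestronglyMeasurable) ?_
        intervalIntegrable_const (ae_of_all _ fun s _ => ?_)
      · filter_upwards [hC] with N hN
        refine ae_of_all _ fun s _ => ?_
        rw [Real.norm_of_nonneg (le_max_right _ _)]
        exact max_le_max (hN s) le_rfl
      · refine tendsto_order.2 ⟨fun l hl => .of_forall fun N => hl.trans_le (le_max_right _ _),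
          fun u hu => ?_⟩
        filter_upwards [hlim s (u / 2) (by linarith)] with N hN
        exact max_lt (by linarith) hu
    rw [intervalIntegral.integral_zero] at h1
    filter_upwards [h1.eventually_lt_const hκ] with N hN
    have h2 : ∫ s in a..b, F N s ≤ ∫ s in a..b, max (F N s) 0 :=
      intervalIntegral.integral_mono_on hab ((hF N).intervalIntegrable _ _)
        (((hF N).max continuous_const).intervalIntegrable _ _) fun s _ => le_max_left _ _
    linarith [hint N a b ha hab]
  -- after `J` of the time intervals, `h` has decreased by `J ε δ`
  have key : ∀ J : ℕ, ∃ T, 0 ≤ T ∧ ∀ κ, 0 < κ → ∀ᶠ N in atTop, h N T ≤ B - J * (ε * δ) + κ := by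
    intro J
    induction J with
    | zero => exact ⟨0, le_rfl, fun κ hκ => .of_forall fun N => by simp; linarith [hB N 0]⟩
    | succ J ih =>
      obtain ⟨T, hT, hTN⟩ := ih
      obtain ⟨k, hk, hkT⟩ := (hdec.and (ht.eventually_ge_atTop T)).exists
      refine ⟨t k + δ, by linarith [ht0 k], fun κ hκ => ?_⟩
      filter_upwards [hk, hTN (κ / 2) (by linarith), hmono T (t k) hT hkT (κ / 2) (by linarith)]
        with N h1 h2 h3
      have h4 : ∫ s in (t k)..(t k + δ), F N s ≤ ∫ _ in (t k)..(t k + δ), -ε :=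
        intervalIntegral.integral_mono_on (by linarith) ((hF N).intervalIntegrable _ _)
          intervalIntegrable_const h1
      rw [intervalIntegral.integral_const, ← hint N _ _ (ht0 k) (by linarith), smul_eq_mul] at h4
      push_cast
      nlinarith
  obtain ⟨J, hJ⟩ := exists_nat_gt ((B + 1) / (ε * δ))
  rw [div_lt_iff₀ (by positivity)] at hJ
  obtain ⟨T, -, hT⟩ := key J
  obtain ⟨N, hN⟩ := (hT 1 one_pos).exists
  linarith [h0 N T]

/-! ### The attractor property -/

theorem ChargesCylinders.mix {ν μ : ProbabilityMeasure (Config d q)}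
    (hμ : ChargesCylinders (μ : Measure (Config d q))) :
    ChargesCylinders (mix ν μ : Measure (Config d q)) := by
  intro Λ η
  have h := hμ Λ η
  rw [prob, Measure.real, ENNReal.toReal_pos_iff] at h ⊢
  refine ⟨?_, measure_lt_top _ _⟩
  rw [coe_mix, Measure.add_apply, Measure.smul_apply, Measure.smul_apply, smul_eq_mul, smul_eq_mul]
  exact lt_of_lt_of_le (ENNReal.mul_pos (by simp) h.1.ne') le_add_self

/-- The DLR equations are affine in the measure: if they hold for `μ` and for the mixture of `ν` and
`μ`, they hold for `ν`. -/
theorem Specification.IsGibbs.of_mix {γ : Specification d q}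
    {ν μ : ProbabilityMeasure (Config d q)} (hμ : γ.IsGibbs μ) (h : γ.IsGibbs (mix ν μ)) :
    γ.IsGibbs ν := by
  intro Λ
  have hm : Measurable (γ.kernel Λ : Config d q → Measure (Config d q)) :=
    (γ.kernel Λ).measurable.mono cylinderEvents_le_pi le_rfl
  refine Measure.ext fun A hA => ?_
  have h1 := congrArg (fun κ => κ A) (h Λ)
  have h2 := congrArg (fun κ => κ A) (hμ Λ)
  simp only [Measure.bind_apply hA hm.aemeasurable] at h1 h2 ⊢
  rw [coe_mix, lintegral_add_measure, lintegral_smul_measure, lintegral_smul_measure, h2,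
    Measure.add_apply, Measure.smul_apply, Measure.smul_apply] at h1
  have h3 := (ENNReal.add_left_inj (by
    simpa [smul_eq_mul] using ENNReal.mul_ne_top (by simp) (measure_ne_top _ _))).1 h1
  simpa [smul_eq_mul] using (ENNReal.mul_right_inj (by simp) (by simp)).1 h3

theorem isGibbs_of_tendsto_of_chargesCylinders {c : JumpRates d q} {Γ : Finset (Site d)}
    {P : FellerSemigroup d q} {γ : Specification d q} {ν μ νstar : ProbabilityMeasure (Config d q)}
    (hc : c.IsTranslationInvariant) (hΓ : c.HasTransitionsIn Γ) (hcont : c.IsUniformlyContinuous)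
    (hmin : c.HasMinimalRate) (hP : P.IsSemigroupOf c) (hμ : ApproxZeroEntropyLoss c P γ μ)
    (hν : IsTranslationInvariant ν)
    (hpos : ∀ t, ChargesCylinders (P.evolve t ν : Measure (Config d q)))
    (hpos' : ChargesCylinders (νstar : Measure (Config d q))) {t : ℕ → ℝ≥0}
    (ht : Tendsto t atTop atTop) (hlim : Tendsto (fun n => P.evolve (t n) ν) atTop (𝓝 νstar)) :
    γ.IsGibbs νstar := by
  have hti := hP.isTranslationInvariant_evolve hΓ hc hν
  have hti' : IsTranslationInvariant νstar :=
    IsTranslationInvariant.of_tendsto hlim fun n => hti (t n)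
  have hbound : ∀ (ν' : ProbabilityMeasure (Config d q)), _ := fun ν' =>
    exists_continuousAt_bound (ν := ν') hΓ hc hcont hmin hμ.gibbs hμ.translationInvariant
      hμ.spec_translationInvariant hμ.spec_nonNull hμ.spec_quasilocal
  obtain ⟨δ, hδ, -, hδμ⟩ := hμ.gibbs.exists_pow_mul_prob_le hμ.spec_translationInvariant
    hμ.spec_nonNull
  have hμpos : ChargesCylinders (μ : Measure (Config d q)) := fun Λ η =>
    (pow_pos hδ _).trans_le (pow_le_prob hδμ Λ η)
  obtain ⟨x, hx, hx0, hxG⟩ := hμ.entropyLoss νstar hti'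
  refine hxG (hx0.eq_or_lt.resolve_right fun hneg => ?_)
  -- otherwise the relative entropy decreases at a positive rate near `νstar`
  obtain ⟨y, hxy, hy0⟩ := EReal.lt_iff_exists_real_btwn.1 hneg
  have hy0 : y < 0 := by exact_mod_cast hy0
  obtain ⟨G, hGy, hGc, θ, β, hθ0, hθ, hβ, hG⟩ := hbound νstar hti' hpos' hx hxy
  have hnear : ∃ ε > 0, ∀ᶠ k in atTop, ∀ s ∈ Set.Icc (t k : ℝ) (t k + ε),
      G (P.evolve s.toNNReal ν) < y := by
    have h1 := ((hGc νstar hpos').tendsto.comp (P.tendsto_evolve_add hlim)).eventually_lt_const hGy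
    obtain ⟨pa, hpa, pb, hpb, hab⟩ := eventually_prod_iff.1 h1
    obtain ⟨ε, hε, hball⟩ := Metric.eventually_nhds_iff.1 hpb
    refine ⟨ε / 2, by linarith, ?_⟩
    filter_upwards [hpa] with k hk s hs
    have h2 : s.toNNReal = t k + (s - t k).toNNReal := by
      have h0 := (t k).2
      apply NNReal.coe_injective
      rw [NNReal.coe_add, Real.coe_toNNReal _ (h0.trans hs.1),
        Real.coe_toNNReal _ (by linarith [hs.1])]
      ring
    have h3 : dist (s - t k).toNNReal 0 < ε := by
      rw [NNReal.dist_eq, NNReal.coe_zero, sub_zero, Real.coe_toNNReal _ (by linarith [hs.1]),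
        abs_of_nonneg (by linarith [hs.1])]
      linarith [hs.2]
    have h4 := hab hk (hball h3)
    simp only [Function.comp] at h4
    rwa [h2]
  obtain ⟨ε, hε, hnear⟩ := hnear
  obtain ⟨C, hC⟩ := exists_relLoss_le hΓ hc hμ.gibbs hμ.translationInvariant
    hμ.spec_translationInvariant hμ.spec_nonNull hμ.spec_quasilocal
  refine not_decreasing_infinitely_often
    (h := fun N s => relEntropy (P.evolve s.toNNReal ν : Measure (Config d q)) μ N)
    (F := fun N s => relLoss c (P.evolve s.toNNReal ν : Measure (Config d q)) μ N)
    (B := -Real.log δ) (C := C) (t := fun k => t k) (δ := ε) (ε := -y / 2)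
    (fun N s => relEntropy_nonneg (hpos _) hμpos N)
    (fun N s => relEntropy_le (hpos _) hδ (pow_le_prob hδμ) N)
    (fun N => continuous_relLoss_evolve hΓ hc hpos N)
    (fun N a b ha hab => relEntropy_evolve_sub hP hΓ hc hpos N ha hab)
    (hC.mono fun N hN s => hN _ (hti _) (hpos _)) (fun s κ hκ => ?_) (fun k => (t k).2)
    (NNReal.tendsto_coe_atTop.2 ht) hε (by linarith) (hnear.mono fun k hk => ?_)
  · obtain ⟨x', hx', hx0', -⟩ := hμ.entropyLoss _ (hti s.toNNReal)
    obtain ⟨G', hGy', -, θ', β', -, hθ', hβ', hG'⟩ := hbound _ (hti s.toNNReal) (hpos _) hx'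
      (hx0'.trans_lt (by exact_mod_cast hκ : (0 : EReal) < (κ : ℝ)))
    have h1 : Tendsto (fun N => G' (P.evolve s.toNNReal ν) * θ' N + β' N) atTop
        (𝓝 (G' (P.evolve s.toNNReal ν) * 1 + 0)) := (hθ'.const_mul _).add hβ'
    filter_upwards [h1.eventually_lt_const (by simpa using hGy' :
      G' (P.evolve s.toNNReal ν) * 1 + 0 < κ)] with N hN
    exact (hG' N _ (hti _) (hpos _)).trans hN.le
  · have h1 : Tendsto (fun N => y * θ N + β N) atTop (𝓝 (y * 1 + 0)) := (hθ.const_mul _).add hβ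
    filter_upwards [h1.eventually_lt_const (by linarith : y * 1 + 0 < -(-y / 2))] with N hN s hs
    refine (hG N _ (hti _) (hpos _)).trans (le_trans ?_ hN.le)
    have := mul_le_mul_of_nonneg_right (hk s hs).le (hθ0 N)
    linarith

end IPS

end

theorem mainTheorem4 (d q : ℕ) (hd : 1 ≤ d) (c : IPS.JumpRates d q)
    (hwd : c.IsWellDefined) (hti : c.IsTranslationInvariant)
    (hfin : c.HasFinitelyManyTransitions) (hcont : c.IsUniformlyContinuous)
    (hmin : c.HasMinimalRate) (htrap : c.HasNoTraps)
    (P : IPS.FellerSemigroup d q) (hP : P.IsSemigroupOf c)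
    (γ : IPS.Specification d q) (μ : ProbabilityMeasure (Config d q))
    (hμ : IPS.ApproxZeroEntropyLoss c P γ μ)
    (ν νstar : ProbabilityMeasure (Config d q)) (hν : IPS.IsTranslationInvariant ν)
    (t : ℕ → ℝ≥0) (ht : Tendsto t atTop atTop)
    (hlim : Tendsto (fun n => P.evolve (t n) ν) atTop (𝓝 νstar)) :
    γ.IsGibbs νstar := by
  obtain ⟨Γ, -, hΓ⟩ := hfin
  obtain ⟨δ, hδ, -, hδμ⟩ := hμ.gibbs.exists_pow_mul_prob_le hμ.spec_translationInvariant
    hμ.spec_nonNull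
  have hμpos : IPS.ChargesCylinders (μ : Measure (Config d q)) := fun Λ η =>
    (pow_pos hδ _).trans_le (IPS.pow_le_prob hδμ Λ η)
  -- mixing with the stationary measure commutes with the dynamics and makes all cylinder
  -- probabilities positive
  refine hμ.gibbs.of_mix (IPS.isGibbs_of_tendsto_of_chargesCylinders (ν := IPS.mix ν μ) hti hΓ hcont
    hmin hP hμ (hν.mix hμ.translationInvariant) (fun s => ?_) hμpos.mix ht ?_)
  · rw [P.evolve_mix hμ.stationary]
    exact hμpos.mix
  · simp only [P.evolve_mix hμ.stationary]
    exact IPS.tendsto_mix hlim μ
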